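/- **Setting.** Let $d\ge 2$, let $f$ be a probability density on $\mathbb{R}^d$, $X\sim f$, and let $\mathbb{S}$ be a collection of subsets of $[d]=\{1,\dots,d\}$ with $[d]\notin\mathbb{S}$. For $S\subseteq[d]$ write $x_S=(x_j)_{j\in S}$, $f_S$ for the density of $X_S$, and $\|\cdot\|_\infty$ for the sup norm on $\mathbb{R}^d$ and $\mathbb{R}^S$. For $S\in\mathbb{S}$ let $r_S:\mathbb{R}^S\to(0,\infty)$, $\bar r_S=r_S/\int r_Sf_S$ and $\lambda_S\in(0,\infty)$, and fix a version $x_S\mapsto\mathcal{L}(X_{S^c}\mid X_S=x_S)$, $x_S\in\mathbb{R}^S$, of the conditional distribution, which defines all conditional expectations given $X_S=x_S$ below. Let $a:\mathbb{R}^d\to\mathbb{R}$ be bounded, with $\|a\|_\infty=\sup|a|$. **Target.** For $m\in\mathbb{N}$ let $\mathbb{S}^{(m)}=\{(S_1,\dots,S_m)\in\mathbb{S}^m: S_{j+1}\ne S_j \text{ for } 1\le j<m\}$. Starting from $\bar a^{(0)}=a$, define for $\mathbf{S}=(S_1,\dots,S_m)$ and $S\in\mathbb{S}$ (with $S\neq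 S_m$ if $m\ge1$) $$\bar a^{(m+1)}_{(\mathbf{S},S)}(x)=\frac{\lambda_S\bar r_S(x_S)}{1+\lambda_S\bar r_S(x_S)}\,\mathbb{E}\{\bar a^{(m)}_{\mathbf{S}}(X)-\bar\theta^{(m+1)}_{(\mathbf{S},S)}\mid X_S=x_S\},\qquad \bar\theta^{(m+1)}_{(\mathbf{S},S)}=\frac{\int\frac{\lambda_S\bar r_S}{1+\lambda_S\bar r_S}\bar a^{(m)}_{\mathbf{S}}f}{\int\frac{\lambda_S\bar r_S}{1+\lambda_S\bar r_S}f_S}.$$ For $M\in\mathbb{N}$ let $\eta=1/|\mathbb{S}|$, $b_{M,\eta}(m)=\mathbb{P}(\mathrm{Bin}(M,\eta)\ge m)$ and $$\alpha_S^{(M)}=\sum_{m=1}^M(-1)^{m-1}\sum_{\mathbf{S}\in\mathbb{S}^{(m)}:\,S_m=S}b_{M,\eta}(m)\,\bar a^{(m)}_{\mathbf{S}},$$ a function of $x_S$ only. **Estimator.** Let $n\ge1$ and $X_1,\dots,X_n\overset{\text{i.i.d.}}{\sim}f$. Partition the first half $X_1,\dots,X_{\lceil n/2\rceil}$ of the sample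 into $M$ pieces $\mathcal{D}_{1},\dots,\mathcal{D}_{M}$ whose sizes differ by at most one. Let $T\ge1$, $h\in(0,1)$, $B_T=\{x:\|x\|_\infty\le T\}$, $K(z)=2^{-d}\mathbb{1}\{\|z\|_\infty\le1\}$, $K^S(u_S)=\int_{\mathbb{R}^{S^c}}K(u_S,v)\,dv$ and $K^S_h(u_S)=h^{-|S|}K^S(u_S/h)$. Put $\hat r_S^{(m)}=|\mathcal{D}_m|^{-1}\sum_{y\in\mathcal{D}_m}r_S(y_S)$, $\hat f_S^{(m)}(x_S)=|\mathcal{D}_m|^{-1}\sum_{y\in\mathcal{D}_m}K_h^S(x_S-y_S)$ and $\hat w_S^{(m)}(x_S)=\lambda_Sr_S(x_S)/\{\hat r_S^{(m)}+\lambda_Sr_S(x_S)\}$. Starting from $\hat a^{(0)}=a$, set, when $\|x_S\|_\infty\le T$, $$\hat a^{(m+1)}_{(\mathbf{S},S)}(x_S)=\hat w_S^{(m+1)}(x_S)\Bigl\{\frac{1}{|\mathcal{D}_{m+1}|}\sum_{y\in\mathcal{D}_{m+1}}\hat a^{(m)}_{\mathbf{S}}(y)\mathbb{1}_{B_T}(y)\frac{K_h^S(x_S-y_S)}{\hat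 f_S^{(m+1)}(x_S)}-\frac{\sum_{y\in\mathcal{D}_{m+1}}\hat w_S^{(m+1)}(y_S)\,\hat a^{(m)}_{\mathbf{S}}(y)\mathbb{1}_{B_T}(y)}{\sum_{y\in\mathcal{D}_{m+1}}\hat w_S^{(m+1)}(y_S)}\Bigr\},$$ and $\hat a^{(m+1)}_{(\mathbf{S},S)}(x_S)=0$ otherwise; here any quotient with zero denominator (which can occur only where $\hat f_S^{(m+1)}(x_S)=0$ or $\mathcal{D}_{m+1}=\emptyset$) is read as $0$. Finally let $\hat\alpha^{(M)}_{S,(1)}(x_S)=\sum_{m=1}^M(-1)^{m-1}\sum_{\mathbf{S}\in\mathbb{S}^{(m)}:\,S_m=S}b_{M,\eta}(m)\hat a^{(m)}_{\mathbf{S}}(x_S)$ when $\|x_S\|_\infty\le T$, and $0$ otherwise. **Proposition 7.** Let $\beta_1,\beta_2,\beta_3\in(0,1]$, $L_1,L_2,L_3\in(0,\infty)$ and $0<c\le C<\infty$, and suppose that - (A1) $|a(x)-a(x')|\le L_1\|x-x'\|_\infty^{\beta_1}$ for all $x,x'\in\mathbb{R}^d$ with $\|x-x'\|_\infty\le1$;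 - (A2) $d_{\mathrm{TV}}\bigl(\mathcal{L}(X_{S^c}\mid X_S=x_S),\mathcal{L}(X_{S^c}\mid X_S=x_S')\bigr)\le L_2\|x_S-x_S'\|_\infty^{\beta_2}$ for all $S\in\mathbb{S}$ and $x_S,x_S'\in\mathbb{R}^S$ with $\|x_S-x_S'\|_\infty\le1$, where $d_{\mathrm{TV}}=\frac12\int|p-q|$ for densities $p,q$ with respect to a common dominating measure; - (A3) $|\bar r_S(x_S)-\bar r_S(x_S')|\le L_3\|x_S-x_S'\|_\infty^{\beta_3}$ for all $S\in\mathbb{S}$ and $x_S,x_S'\in\mathbb{R}^S$ with $\|x_S-x_S'\|_\infty\le1$; - $c\le\bar r_S(x_S)\le C$ for all $S\in\mathbb{S}$ and $x_S\in\mathbb{R}^S$. Then for every $M\in\mathbb{N}=\{1,2,\dots\}$ and $S\in\mathbb{S}$, $$\mathbb{E}\Bigl\{\int(\hat\alpha^{(M)}_{S,(1)}-\alpha^{(M)}_S)^2f_S\Bigr\}\le A^MB\Bigl\{\frac Mn\Bigl(\frac Th\Bigr)^d+h^{2\beta_\wedge}+\mathbb{P}(\|X\|_\infty\ge T)\Bigr\},$$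 where $\beta_\wedge=\min(\beta_1,\beta_2,\beta_3)$, $A=28(C/c+2^d)$ and $B=16\max(\|a\|_\infty^2,1)\max\{(C/c)^2,(L_1+L_2+L_3)^2,8^d\}$. -/

import Mathlib

open MeasureTheory ProbabilityTheory
open scoped ENNReal

namespace IncompleteData

noncomputable section

variable {d n : ℕ}

/-- `ℝ^d`; its norm is the sup norm `‖x‖_∞`, and so is the norm of `S → ℝ`, i.e. of `ℝ^S`. -/
abbrev Pt (d : ℕ) : Type := Fin d → ℝ

/-- `f` is a probability density on `ℝ^d`. -/
structure IsDensity (f : Pt d → ℝ) : Prop where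
  measurable : Measurable f
  nonneg : ∀ x, 0 ≤ f x
  lintegral_eq_one : ∫⁻ x, ENNReal.ofReal (f x) = 1

/-- The distribution with density `f`. -/
def law (f : Pt d → ℝ) : Measure (Pt d) :=
  volume.withDensity fun x => ENNReal.ofReal (f x)

/-- The point of `ℝ^d` with coordinates `u` in `S` and `v` in the complement of `S`. -/
def glue (S : Finset (Fin d)) (u : S → ℝ) (v : ↥Sᶜ → ℝ) : Pt d := fun j =>
  if hj : j ∈ S then u ⟨j, hj⟩ else v ⟨j, Finset.mem_compl.2 hj⟩

/-- `κ` is a version of the conditional distribution of `X_{S^c}` given `X_S`, for `X ∼ f`: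
a Markov kernel that disintegrates the law of `(X_S, X_{S^c})`. -/
def IsCondLaw (f : Pt d → ℝ) (S : Finset (Fin d)) (κ : Kernel (S → ℝ) (↥Sᶜ → ℝ)) : Prop :=
  IsMarkovKernel κ ∧
    ((law f).map fun x => (S.restrict x, Sᶜ.restrict x)).IsCondKernel κ

/-- Total variation distance `(1/2) ∫ |p - q|`, where `p`, `q` are the densities of `P`, `Q` with
respect to the dominating measure `P + Q`. -/
def tvDist {E : Type*} [MeasurableSpace E] (P Q : Measure E) : ℝ :=
  2⁻¹ * ∫ z, |(P.rnDeriv (P + Q) z).toReal - (Q.rnDeriv (P + Q) z).toReal| ∂(P + Q)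

/-- The normalised shift `r̄_S = r_S / ∫ r_S f`. -/
def rBar (f : Pt d → ℝ) (S : Finset (Fin d)) (r : (S → ℝ) → ℝ) (u : S → ℝ) : ℝ :=
  r u / ∫ x, r (S.restrict x) ∂(law f)

/-! ### Population quantities -/

/-- The population weight `λ_S r̄_S(x_S) / (1 + λ_S r̄_S(x_S))`. -/
def wBar (f : Pt d → ℝ) (S : Finset (Fin d)) (r : (S → ℝ) → ℝ) (lam : ℝ) (x : Pt d) : ℝ :=
  lam * rBar f S r (S.restrict x) / (1 + lam * rBar f S r (S.restrict x))

/-- The centring constant `∫ w g f / ∫ w f` for the population weight `w`. -/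
def thetaBar (f : Pt d → ℝ) (S : Finset (Fin d)) (r : (S → ℝ) → ℝ) (lam : ℝ)
    (g : Pt d → ℝ) : ℝ :=
  (∫ x, wBar f S r lam x * g x ∂(law f)) / ∫ x, wBar f S r lam x ∂(law f)

/-- One population step: `x ↦ w(x_S) 𝔼{g(X) - θ̄ | X_S = x_S}`. -/
def stepBar (f : Pt d → ℝ) (S : Finset (Fin d)) (r : (S → ℝ) → ℝ) (lam : ℝ)
    (κ : Kernel (S → ℝ) (↥Sᶜ → ℝ)) (g : Pt d → ℝ) (x : Pt d) : ℝ :=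
  wBar f S r lam x *
    ∫ v, (g (glue S (S.restrict x) v) - thetaBar f S r lam g) ∂(κ (S.restrict x))

/-- `ā_Ss^{(m)}` for `Ss = (S_1, …, S_m)`, started at `ā^{(0)} = a`. -/
def aBar (f : Pt d → ℝ) (r : ∀ S : Finset (Fin d), (S → ℝ) → ℝ) (lam : Finset (Fin d) → ℝ)
    (κ : ∀ S : Finset (Fin d), Kernel (S → ℝ) (↥Sᶜ → ℝ)) (a : Pt d → ℝ) :
    (m : ℕ) → (Fin m → Finset (Fin d)) → Pt d → ℝ
  | 0, _ => a
  | m + 1, Ss =>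
      let S := Ss (Fin.last m)
      stepBar f S (r S) (lam S) (κ S) (aBar f r lam κ a m fun j => Ss j.castSucc)

/-- The sequences `Ss ∈ 𝕊^{(m+1)}` (consecutive entries distinct) whose last entry is `S`. -/
def paths (𝕊 : Finset (Finset (Fin d))) (m : ℕ) (S : Finset (Fin d)) :
    Finset (Fin (m + 1) → Finset (Fin d)) :=
  (Fintype.piFinset fun _ => 𝕊).filter fun Ss =>
    (∀ j : Fin m, Ss j.succ ≠ Ss j.castSucc) ∧ Ss (Fin.last m) = S

/-- `b_{M,η}(m) = ℙ(Bin(M, η) ≥ m)`. -/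
def binTail (M : ℕ) (η : ℝ) (m : ℕ) : ℝ :=
  ∑ j ∈ Finset.Icc m M, (M.choose j : ℝ) * η ^ j * (1 - η) ^ (M - j)

/-- `α_S^{(M,η)} = ∑_{m=1}^M (-1)^{m-1} ∑_{Ss ∈ 𝕊^{(m)}, S_m = S} b_{M,η}(m) ā_Ss^{(m)}`; the index
of summation below is `m - 1`. It is a function of `x_S` only. -/
def alpha (𝕊 : Finset (Finset (Fin d))) (f : Pt d → ℝ)
    (r : ∀ S : Finset (Fin d), (S → ℝ) → ℝ) (lam : Finset (Fin d) → ℝ)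
    (κ : ∀ S : Finset (Fin d), Kernel (S → ℝ) (↥Sᶜ → ℝ)) (a : Pt d → ℝ) (η : ℝ) (M : ℕ)
    (S : Finset (Fin d)) (x : Pt d) : ℝ :=
  ∑ m ∈ Finset.range M, (-1) ^ m *
    ∑ Ss ∈ paths 𝕊 m S, binTail M η (m + 1) * aBar f r lam κ a (m + 1) Ss x

/-! ### The estimator -/

/-- `D 1, …, D M` index a partition of the first half `X_1, …, X_{⌈n/2⌉}` of the sample into `M`
pieces whose sizes differ by at most one (indices of the sample start at `0`, and
`(n + 1) / 2 = ⌈n/2⌉`). -/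
structure IsSplit (n M : ℕ) (D : ℕ → Finset (Fin n)) : Prop where
  disjoint : ∀ m ∈ Finset.Icc 1 M, ∀ m' ∈ Finset.Icc 1 M, m ≠ m' → Disjoint (D m) (D m')
  union : (Finset.Icc 1 M).biUnion D = Finset.univ.filter fun i : Fin n => (i : ℕ) < (n + 1) / 2
  balanced : ∀ m ∈ Finset.Icc 1 M, ∀ m' ∈ Finset.Icc 1 M, (D m).card ≤ (D m').card + 1

open Classical in
/-- The uniform kernel `K(z) = 2^{-d} 1{‖z‖_∞ ≤ 1}`. -/
def unifKernel (z : Pt d) : ℝ := if ‖z‖ ≤ 1 then ((2 : ℝ) ^ d)⁻¹ else 0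

/-- `K^S(u) = ∫ K(u, v) dv`. -/
def margKernel (S : Finset (Fin d)) (u : S → ℝ) : ℝ :=
  ∫ v : ↥Sᶜ → ℝ, unifKernel (glue S u v)

/-- `K_h^S(u) = h^{-|S|} K^S(u / h)`. -/
def scaledKernel (S : Finset (Fin d)) (h : ℝ) (u : S → ℝ) : ℝ :=
  (h ^ S.card)⁻¹ * margKernel S (h⁻¹ • u)

/-- `r̂_S`, the average of `r_S` over the piece `D` of the sample `z`. -/
def rHat (S : Finset (Fin d)) (r : (S → ℝ) → ℝ) (D : Finset (Fin n)) (z : Fin n → Pt d) : ℝ :=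
  (D.card : ℝ)⁻¹ * ∑ i ∈ D, r (S.restrict (z i))

/-- `f̂_S`, the kernel density estimator from the piece `D` of the sample `z`. -/
def fHat (S : Finset (Fin d)) (h : ℝ) (D : Finset (Fin n)) (z : Fin n → Pt d) (u : S → ℝ) : ℝ :=
  (D.card : ℝ)⁻¹ * ∑ i ∈ D, scaledKernel S h (u - S.restrict (z i))

/-- The empirical weight `λ_S r_S(x_S) / (r̂_S + λ_S r_S(x_S))`. -/
def wHat (S : Finset (Fin d)) (r : (S → ℝ) → ℝ) (lam : ℝ) (D : Finset (Fin n))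
    (z : Fin n → Pt d) (x : Pt d) : ℝ :=
  lam * r (S.restrict x) / (rHat S r D z + lam * r (S.restrict x))

open Classical in
/-- `g 1_{B_T}` with `B_T = {‖y‖_∞ ≤ T}`. -/
def trunc (T : ℝ) (g : Pt d → ℝ) (y : Pt d) : ℝ := if ‖y‖ ≤ T then g y else 0

open Classical in
/-- One regression step on the piece `D` of the sample `z`, applied to `g`. Quotients `0 / 0`
are `0`, as they are for the division of the reals here. -/
def stepHat (S : Finset (Fin d)) (r : (S → ℝ) → ℝ) (lam T h : ℝ) (D : Finset (Fin n))
    (z : Fin n → Pt d) (g : Pt d → ℝ) (x : Pt d) : ℝ :=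
  if ‖S.restrict x‖ ≤ T then
    wHat S r lam D z x *
      ((D.card : ℝ)⁻¹ * ∑ i ∈ D, trunc T g (z i) *
          (scaledKernel S h (S.restrict x - S.restrict (z i)) / fHat S h D z (S.restrict x))
        - (∑ i ∈ D, wHat S r lam D z (z i) * trunc T g (z i)) / ∑ i ∈ D, wHat S r lam D z (z i))
  else 0

/-- `â_Ss^{(m)}`, started at `â^{(0)} = a`; step `m + 1` uses the piece `D (m + 1)`. -/
def aHat (r : ∀ S : Finset (Fin d), (S → ℝ) → ℝ) (lam : Finset (Fin d) → ℝ) (T h : ℝ)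
    (D : ℕ → Finset (Fin n)) (z : Fin n → Pt d) (a : Pt d → ℝ) :
    (m : ℕ) → (Fin m → Finset (Fin d)) → Pt d → ℝ
  | 0, _ => a
  | m + 1, Ss =>
      let S := Ss (Fin.last m)
      stepHat S (r S) (lam S) T h (D (m + 1)) z
        (aHat r lam T h D z a m fun j => Ss j.castSucc)

open Classical in
/-- The estimator `α̂_{S,(1)}^{(M)}` of `α_S^{(M,η)}`, computed from the sample `z`. -/
def alphaHat (𝕊 : Finset (Finset (Fin d))) (r : ∀ S : Finset (Fin d), (S → ℝ) → ℝ)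
    (lam : Finset (Fin d) → ℝ) (T h : ℝ) (D : ℕ → Finset (Fin n)) (z : Fin n → Pt d)
    (a : Pt d → ℝ) (η : ℝ) (M : ℕ) (S : Finset (Fin d)) (x : Pt d) : ℝ :=
  if ‖S.restrict x‖ ≤ T then
    ∑ m ∈ Finset.range M, (-1) ^ m *
      ∑ Ss ∈ paths 𝕊 m S, binTail M η (m + 1) * aHat r lam T h D z a (m + 1) Ss x
  else 0

/-! ### Smoothness assumptions -/

/-- (A1): local Hölder smoothness of `a`. -/
def A1 (a : Pt d → ℝ) (β L : ℝ) : Prop :=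
  ∀ x x' : Pt d, ‖x - x'‖ ≤ 1 → |a x - a x'| ≤ L * ‖x - x'‖ ^ β

/-- (A2): local Hölder smoothness in total variation of the conditional distributions. -/
def A2 (𝕊 : Finset (Finset (Fin d)))
    (κ : ∀ S : Finset (Fin d), Kernel (S → ℝ) (↥Sᶜ → ℝ)) (β L : ℝ) : Prop :=
  ∀ S ∈ 𝕊, ∀ u u' : S → ℝ, ‖u - u'‖ ≤ 1 → tvDist (κ S u) (κ S u') ≤ L * ‖u - u'‖ ^ β

/-- (A3): local Hölder smoothness of the normalised shifts. -/
def A3 (𝕊 : Finset (Finset (Fin d))) (f : Pt d → ℝ)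
    (r : ∀ S : Finset (Fin d), (S → ℝ) → ℝ) (β L : ℝ) : Prop :=
  ∀ S ∈ 𝕊, ∀ u u' : S → ℝ, ‖u - u'‖ ≤ 1 →
    |rBar f S (r S) u - rBar f S (r S) u'| ≤ L * ‖u - u'‖ ^ β

end

end IncompleteData

open IncompleteData

/-! The proof bounds, recursively in `m`, the mean squared error of the iterate `aHat` against
`aBar`, averaged jointly over the sample and a fresh point of the same law. The errors of all paths
are then combined by a weighted Cauchy–Schwarz inequality. No regularity or lower bound of `f`
enters, because everything about the design points is a counting argument combined with
exchangeability.

One step (`sq_stepHat_sub_le`). The uniform kernel makes the regression a plain average over the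
neighbours of `x`, that is, the points whose `S`-coordinates lie within `h` (`stepHat_eq`). The
error splits into the previous error averaged over neighbours, the previous error averaged over the
whole piece, the noise of both averages, the loss on empty neighbourhoods, the smoothing bias, and
the error of the estimated normalisation of `r`.

Propagation. The previous iterate does not depend on the current piece. Exchanging the fresh point
with a sample point turns the neighbour average of the previous error into a sum of inverse
neighbour counts, which is at most `2 ^ S.card`: one unit per orthant
(`lintegral_sum_near_div_count_le`). In the centring term the weights vary by a factor of at most `C
/ c`. Hence the previous error is multiplied by at most `3 * K` with `K = C / c + 2 ^ d`.

Noise. The regression noise has conditional mean zero given `X_S`, and the local weights depend on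
`S`-coordinates only, so the cross terms vanish (`integral_sq_sum_eq`). What remains is an expected
inverse neighbour count. By exchangeability it is a mean over `|D| + 1` points, and the sum of the
inverse counts is at most the number of cells of side `h` covering the cube
(`lintegral_inv_one_add_count_le`).

Bias. A population step does not lengthen the range of the function, and total variation controls
the change of the conditional law, so Hölder constants grow only linearly in `m` (`aBar_spec`).

Sum. The recursion is closed by `16 * q ^ m - 15` with `q = 14 * K - 1` (`error_constant_succ_le`).
With `η = 1 / |𝕊|` the binomial tail cancels the number of paths up to a binomial coefficient
(`card_paths_mul_binTail_le`). The total weight is thus at most `2 ^ M`, the weighted errors sum to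
at most a multiple of `(1 + q) ^ M`, and `2 * (1 + q) = 28 * K`. -/

namespace IncompleteData

noncomputable section

variable {d n : ℕ}

/-! ### Counting inequalities and weighted averages -/

section Counting

/-- Each colour class contributes at most one: its members are all related to each other, so every
inner sum is at least the size of the class. It is applied with orthants and with grid cells as
colours. -/
theorem sum_inv_sum_le {ι κ : Type*} [Fintype κ] [DecidableEq κ] (J : Finset ι) (ρ : ι → ι → ℝ)
    (hρ : ∀ i j, 0 ≤ ρ i j) (p : ι → Prop) [DecidablePred p] (col : ι → κ)
    (h : ∀ i ∈ J, ∀ j ∈ J, p i → p j → col i = col j → 1 ≤ ρ i j) :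
    ∑ i ∈ J, (if p i then (∑ j ∈ J, ρ i j)⁻¹ else 0) ≤ Fintype.card κ := by
  rw [← Finset.sum_filter, ← Finset.sum_fiberwise (J.filter p) col]
  have key : ∀ k ∈ (Finset.univ : Finset κ),
      ∑ i ∈ (J.filter p).filter (fun i => col i = k), (∑ j ∈ J, ρ i j)⁻¹ ≤ 1 := by
    intro k _
    set Q := (J.filter p).filter (fun i => col i = k) with hQ
    rcases Q.eq_empty_or_nonempty with h0 | h0
    · simp [h0]
    have hpos : (0 : ℝ) < Q.card := by exact_mod_cast h0.card_pos
    have hle : ∀ i ∈ Q, (∑ j ∈ J, ρ i j)⁻¹ ≤ (Q.card : ℝ)⁻¹ := by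
      intro i hi
      apply inv_anti₀ hpos
      have hQJ : Q ⊆ J := (Finset.filter_subset _ _).trans (Finset.filter_subset _ _)
      calc (Q.card : ℝ) = ∑ j ∈ Q, (1 : ℝ) := by simp
        _ ≤ ∑ j ∈ Q, ρ i j := by
            apply Finset.sum_le_sum
            intro j hj
            simp only [hQ, Finset.mem_filter] at hi hj
            exact h i hi.1.1 j hj.1.1 hi.1.2 hj.1.2 (hi.2.trans hj.2.symm)
        _ ≤ ∑ j ∈ J, ρ i j := Finset.sum_le_sum_of_subset_of_nonneg hQJ fun j _ _ => hρ i j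
    calc _ ≤ ∑ i ∈ Q, (Q.card : ℝ)⁻¹ := Finset.sum_le_sum hle
      _ = 1 := by simp [hpos.ne']
  calc _ ≤ ∑ k : κ, (1 : ℝ) := Finset.sum_le_sum key
    _ = _ := by simp

theorem sq_sum_mul_le {ι : Type*} (I : Finset ι) (p e : ι → ℝ) (hp : ∀ i ∈ I, 0 ≤ p i) :
    (∑ i ∈ I, p i * e i) ^ 2 ≤ (∑ i ∈ I, p i) * ∑ i ∈ I, p i * e i ^ 2 := by
  apply Finset.sum_sq_le_sum_mul_sum_of_sq_le_mul I hp
  · intro i hi; exact mul_nonneg (hp i hi) (sq_nonneg _)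
  · intro i _; exact le_of_eq (by ring)

theorem sq_sum_mul_div_le {ι : Type*} (I : Finset ι) (p e : ι → ℝ) (hp : ∀ i ∈ I, 0 ≤ p i) :
    ((∑ i ∈ I, p i * e i) / ∑ i ∈ I, p i) ^ 2 ≤ (∑ i ∈ I, p i * e i ^ 2) / ∑ i ∈ I, p i := by
  rcases (Finset.sum_nonneg hp).eq_or_lt with h0 | h0
  · simp [← h0]
  · rw [div_pow, div_le_div_iff₀ (by positivity) h0]
    have := sq_sum_mul_le I p e hp
    nlinarith

/-- The interval must contain `0` because the quotient is `0` when all weights vanish. -/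
theorem sum_mul_div_mem_Icc {ι : Type*} (I : Finset ι) (p e : ι → ℝ) (hp : ∀ i ∈ I, 0 ≤ p i)
    {lo hi : ℝ} (he : ∀ i ∈ I, e i ∈ Set.Icc lo hi) (h0 : (0 : ℝ) ∈ Set.Icc lo hi) :
    (∑ i ∈ I, p i * e i) / ∑ i ∈ I, p i ∈ Set.Icc lo hi := by
  rcases (Finset.sum_nonneg hp).eq_or_lt with h | h
  · simpa [← h] using h0
  · refine ⟨?_, ?_⟩
    · rw [le_div_iff₀ h, Finset.mul_sum]
      exact Finset.sum_le_sum fun i hi => by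
        rw [mul_comm]; exact mul_le_mul_of_nonneg_left (he i hi).1 (hp i hi)
    · rw [div_le_iff₀ h, Finset.mul_sum]
      exact Finset.sum_le_sum fun i hiI => by
        rw [mul_comm hi]; exact mul_le_mul_of_nonneg_left (he i hiI).2 (hp i hiI)

end Counting

/-! ### Neighbours of a point and deterministic bounds on their number -/

open Classical in
/-- `1{‖x_S - y_S‖ ≤ h}`. -/
def near (S : Finset (Fin d)) (h : ℝ) (x y : Pt d) : ℝ :=
  if ‖S.restrict x - S.restrict y‖ ≤ h then 1 else 0

/-- The number of points of the piece `D` whose `S`-coordinates are within `h` of those of `x`. -/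
def count (S : Finset (Fin d)) (h : ℝ) (D : Finset (Fin n)) (z : Fin n → Pt d) (x : Pt d) : ℝ :=
  ∑ i ∈ D, near S h x (z i)

theorem near_nonneg (S : Finset (Fin d)) (h : ℝ) (x y : Pt d) : 0 ≤ near S h x y := by
  unfold near; split_ifs <;> norm_num

theorem near_le_one (S : Finset (Fin d)) (h : ℝ) (x y : Pt d) : near S h x y ≤ 1 := by
  unfold near; split_ifs <;> norm_num

theorem near_eq_zero_or_one (S : Finset (Fin d)) (h : ℝ) (x y : Pt d) :
    near S h x y = 0 ∨ near S h x y = 1 := by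
  unfold near; split_ifs <;> simp

theorem near_comm (S : Finset (Fin d)) (h : ℝ) (x y : Pt d) : near S h x y = near S h y x := by
  unfold near; rw [norm_sub_rev]

theorem near_self (S : Finset (Fin d)) {h : ℝ} (hh : 0 ≤ h) (x : Pt d) : near S h x x = 1 := by
  simp [near, hh]

theorem near_congr (S : Finset (Fin d)) (h : ℝ) {x x' y y' : Pt d}
    (hx : S.restrict x = S.restrict x') (hy : S.restrict y = S.restrict y') :
    near S h x y = near S h x' y' := by
  simp [near, hx, hy]

theorem count_nonneg (S : Finset (Fin d)) (h : ℝ) (D : Finset (Fin n)) (z : Fin n → Pt d)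
    (x : Pt d) : 0 ≤ count S h D z x :=
  Finset.sum_nonneg fun _ _ => near_nonneg _ _ _ _

theorem near_sq (S : Finset (Fin d)) (h : ℝ) (x y : Pt d) : near S h x y ^ 2 = near S h x y := by
  rcases near_eq_zero_or_one S h x y with e | e <;> simp [e]

theorem count_eq_zero_or_one_le (S : Finset (Fin d)) (h : ℝ) (D : Finset (Fin n))
    (z : Fin n → Pt d) (x : Pt d) : count S h D z x = 0 ∨ 1 ≤ count S h D z x := by
  by_cases H : ∃ i ∈ D, near S h x (z i) = 1
  · obtain ⟨i, hi, e⟩ := H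
    right
    rw [← e]
    exact Finset.single_le_sum (f := fun i => near S h x (z i)) (fun _ _ => near_nonneg _ _ _ _) hi
  · left
    push Not at H
    exact Finset.sum_eq_zero fun i hi => (near_eq_zero_or_one S h x (z i)).resolve_right (H i hi)

theorem measurable_restrict (S : Finset (Fin d)) : Measurable (S.restrict : Pt d → S → ℝ) :=
  Finset.measurable_restrict S

theorem measurable_near (S : Finset (Fin d)) (h : ℝ) :
    Measurable fun p : Pt d × Pt d => near S h p.1 p.2 := by
  classical
  unfold near
  refine Measurable.ite (measurableSet_le ?_ measurable_const) measurable_const measurable_const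
  exact (((measurable_restrict S).comp measurable_fst).sub
    ((measurable_restrict S).comp measurable_snd)).norm

theorem near_measurable {Ω : Type*} [MeasurableSpace Ω] (S : Finset (Fin d)) (h : ℝ)
    {F G : Ω → Pt d} (hF : Measurable F) (hG : Measurable G) :
    Measurable fun ω => near S h (F ω) (G ω) := by
  have := (measurable_near S h).comp (hF.prodMk hG)
  exact this

theorem count_measurable {Ω : Type*} [MeasurableSpace Ω] (S : Finset (Fin d)) (h : ℝ)
    (D : Finset (Fin n)) {F : Ω → Pt d} {Z : Ω → Fin n → Pt d} (hF : Measurable F)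
    (hZ : Measurable Z) : Measurable fun ω => count S h D (Z ω) (F ω) :=
  Finset.measurable_fun_sum _ fun i _ => near_measurable S h hF ((measurable_pi_apply i).comp hZ)

/-- The neighbours of `x` among the points `z_i`, weighted by the inverse of the number of their own
neighbours, have total weight at most `2^|S|`: two neighbours of `x` in the same orthant around `x`
are neighbours of each other. -/
theorem sum_near_mul_inv_count_le (S : Finset (Fin d)) (h : ℝ) (D : Finset (Fin n))
    (z : Fin n → Pt d) (x : Pt d) :
    ∑ i ∈ D, near S h x (z i) * (count S h D z (z i))⁻¹ ≤ 2 ^ S.card := by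
  classical
  have := sum_inv_sum_le (κ := S → Bool) D (fun i j => near S h (z i) (z j))
    (fun _ _ => near_nonneg _ _ _ _) (fun i => ‖S.restrict x - S.restrict (z i)‖ ≤ h)
    (fun i s => decide (x s ≤ z i s)) (by
      intro i _ j _ hi hj hc
      have h0 : 0 ≤ h := (norm_nonneg _).trans hi
      unfold near
      rw [if_pos]
      rw [pi_norm_le_iff_of_nonneg h0] at *
      intro s
      have h1 := abs_le.1 (hi s)
      have h2 := abs_le.1 (hj s)
      have h3 := congrFun hc s
      simp only [decide_eq_decide] at h3
      simp only [Pi.sub_apply, Finset.restrict] at h1 h2 ⊢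
      rw [Real.norm_eq_abs, abs_le]
      by_cases h4 : x s ≤ z i s
      · have := h3.1 h4
        constructor <;> linarith
      · have := fun hle => h4 (h3.2 hle)
        rw [not_le] at h4
        have := not_le.1 this
        constructor <;> linarith)
  have hcard : (Fintype.card (S → Bool) : ℝ) = 2 ^ S.card := by simp
  rw [hcard] at this
  refine le_trans (le_of_eq ?_) this
  refine Finset.sum_congr rfl fun i _ => ?_
  simp only [near, count, ite_mul, one_mul, zero_mul]

/-- Among points of the cube `‖y_S‖ ≤ T`, weighted by the inverse of the number of their
neighbours, the total weight is at most the number of cells of side `h` that cover the cube. -/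
theorem sum_inv_sum_near_le {ι : Type*} (S : Finset (Fin d)) {h T : ℝ} (hh : 0 < h) (hh1 : h ≤ 1)
    (hT : 1 ≤ T) (J : Finset ι) (y : ι → Pt d) [DecidablePred fun i => ‖S.restrict (y i)‖ ≤ T] :
    ∑ i ∈ J, (if ‖S.restrict (y i)‖ ≤ T then (∑ j ∈ J, near S h (y i) (y j))⁻¹ else 0)
      ≤ (3 * (T / h)) ^ S.card := by
  classical
  -- Along each axis the cells are `[-T + l * h, -T + (l + 1) * h)` for `l = 0, …, k`. All indices
  -- that occur are at most `k`, so the reduction modulo `k + 1` in `Fin.ofNat` is inactive. Finally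
  -- `k + 1 ≤ 3 * (T / h)` because `h ≤ 1 ≤ T`.
  set k : ℕ := ⌊2 * T / h⌋₊ with hk
  have := sum_inv_sum_le (κ := S → Fin (k + 1)) J (fun i j => near S h (y i) (y j))
    (fun _ _ => near_nonneg _ _ _ _) (fun i => ‖S.restrict (y i)‖ ≤ T)
    (fun i s => Fin.ofNat (k + 1) ⌊(y i s + T) / h⌋₊) (by
      intro i _ j _ hi hj hc
      unfold near
      rw [if_pos]
      rw [pi_norm_le_iff_of_nonneg (by linarith)] at *
      intro s
      have h1 := abs_le.1 (hi s)
      have h2 := abs_le.1 (hj s)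
      have h3 := congrFun hc s
      simp only [Finset.restrict] at h1 h2
      have bd : ∀ t : ℝ, -T ≤ t → t ≤ T → ⌊(t + T) / h⌋₊ < k + 1 := by
        intro t _ h5
        rw [Nat.lt_succ_iff]
        apply Nat.floor_le_floor
        gcongr
        linarith
      rw [Fin.ext_iff, Fin.val_ofNat, Fin.val_ofNat, Nat.mod_eq_of_lt (bd _ h1.1 h1.2),
        Nat.mod_eq_of_lt (bd _ h2.1 h2.2)] at h3
      have p1 : 0 ≤ (y i s + T) / h := div_nonneg (by linarith) hh.le
      have p2 : 0 ≤ (y j s + T) / h := div_nonneg (by linarith) hh.le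
      have a1 := Nat.floor_le p1
      have a2 := Nat.lt_floor_add_one ((y i s + T) / h)
      have b1 := Nat.floor_le p2
      have b2 := Nat.lt_floor_add_one ((y j s + T) / h)
      rw [h3] at a1 a2
      simp only [Pi.sub_apply, Finset.restrict]
      rw [Real.norm_eq_abs, abs_le]
      have e1 : (y i s + T) / h * h = y i s + T := by field_simp
      have e2 : (y j s + T) / h * h = y j s + T := by field_simp
      constructor <;> nlinarith)
  refine this.trans ?_
  have hcard : (Fintype.card (S → Fin (k + 1)) : ℝ) = ((k : ℝ) + 1) ^ S.card := by simp
  rw [hcard]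
  have h1 : 1 ≤ T / h := by rw [le_div_iff₀ hh]; linarith
  have h2 : (k : ℝ) ≤ 2 * T / h := Nat.floor_le (by positivity)
  have h3 : 2 * T / h = 2 * (T / h) := by ring
  gcongr
  linarith

/-! ### Exchangeability of a fresh observation with the sample -/

section Swap

variable {E : Type*} [MeasurableSpace E]

/-- Exchanging a fresh observation with the `i`-th point of an i.i.d. sample. -/
theorem exists_measurableEquiv_swap (μ : Measure E) [SigmaFinite μ] (i : Fin n) :
    ∃ e : (E × (Fin n → E)) ≃ᵐ (E × (Fin n → E)),
      (∀ p, e p = (p.2 i, Function.update p.2 i p.1)) ∧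
      MeasurePreserving e (μ.prod (Measure.pi fun _ => μ)) (μ.prod (Measure.pi fun _ => μ)) := by
  -- The pair is viewed as `n + 1` i.i.d. coordinates with the fresh point in position `0`; the
  -- exchange is the transposition of `0` and `i.succ`.
  have h1 := measurePreserving_piFinSuccAbove (n := n) (fun _ => μ) 0
  have h2 := measurePreserving_piCongrLeft (fun _ : Fin (n + 1) => μ) (Equiv.swap 0 i.succ)
  refine ⟨((MeasurableEquiv.piFinSuccAbove (fun _ => E) 0).symm.trans
    (MeasurableEquiv.piCongrLeft (fun _ => E) (Equiv.swap 0 i.succ))).trans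
    (MeasurableEquiv.piFinSuccAbove (fun _ => E) 0), ?_, (h1.comp h2).comp h1.symm⟩
  intro p
  have key : ∀ (y : Fin (n + 1) → E) (b : Fin (n + 1)),
      MeasurableEquiv.piCongrLeft (fun _ => E) (Equiv.swap 0 i.succ) y b
        = y (Equiv.swap 0 i.succ b) := by
    intro y b
    conv_lhs => rw [← Equiv.swap_apply_self 0 i.succ b]
    exact Equiv.piCongrLeft_apply_apply (fun _ => E) _ _ _
  have s1 : (MeasurableEquiv.piFinSuccAbove (fun _ => E) 0).symm p = Fin.cons p.1 p.2 := by
    simp [MeasurableEquiv.piFinSuccAbove_symm_apply, Fin.insertNthEquiv]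
  have s2 : ∀ y : Fin (n + 1) → E, MeasurableEquiv.piFinSuccAbove (fun _ => E) 0 y
      = (y 0, fun j => y j.succ) := fun y => rfl
  simp only [MeasurableEquiv.trans_apply]
  rw [s1, s2, key, Equiv.swap_apply_left]
  refine Prod.ext (by simp) (funext fun j => ?_)
  simp only [key]
  by_cases hj : j = i
  · subst hj; simp
  · rw [Equiv.swap_apply_of_ne_of_ne (Fin.succ_ne_zero j) (by simpa using hj)]
    simp [hj]

theorem lintegral_swap (μ : Measure E) [SigmaFinite μ] (i : Fin n)
    (F : E → (Fin n → E) → ℝ≥0∞) :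
    ∫⁻ p, F p.1 p.2 ∂(μ.prod (Measure.pi fun _ => μ))
      = ∫⁻ p, F (p.2 i) (Function.update p.2 i p.1) ∂(μ.prod (Measure.pi fun _ => μ)) := by
  obtain ⟨e, he, hm⟩ := exists_measurableEquiv_swap μ i
  rw [← hm.lintegral_comp_emb e.measurableEmbedding]
  simp only [he]

theorem integrable_of_bound {Ω : Type*} [MeasurableSpace Ω] {ν : Measure Ω} [IsFiniteMeasure ν]
    {F : Ω → ℝ} (hF : Measurable F) {b : ℝ} (hb : ∀ ω, |F ω| ≤ b) : Integrable F ν :=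
  Integrable.of_bound hF.aestronglyMeasurable b (Filter.Eventually.of_forall hb)

/-- Replacing the `i`-th point by a fresh draw does not change the law of the sample. This lets one
observation be integrated out with all the others frozen. -/
theorem integral_resample (μ : Measure E) [IsProbabilityMeasure μ] (i : Fin n)
    {F : (Fin n → E) → ℝ} (hF : Measurable F) {b : ℝ} (hb : ∀ z, |F z| ≤ b) :
    ∫ z, F z ∂(Measure.pi fun _ => μ)
      = ∫ z, ∫ y, F (Function.update z i y) ∂μ ∂(Measure.pi fun _ => μ) := by
  obtain ⟨e, he, hm⟩ := exists_measurableEquiv_swap μ i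
  have h2 : MeasurePreserving (fun p : E × (Fin n → E) => Function.update p.2 i p.1)
      (μ.prod (Measure.pi fun _ => μ)) (Measure.pi fun _ => μ) := by
    have := measurePreserving_snd (μ := μ) (ν := Measure.pi fun _ : Fin n => μ) |>.comp hm
    convert this using 1
    ext1 p
    simp [he]
  rw [← h2.map_eq, integral_map h2.measurable.aemeasurable hF.aestronglyMeasurable,
    integral_prod_symm, h2.map_eq]
  exact integrable_of_bound (hF.comp h2.measurable) fun p => hb _

end Swap

/-! ### Orthogonality and neighbour counts for i.i.d. samples -/

section Sample

theorem glue_restrict (S : Finset (Fin d)) (x : Pt d) :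
    glue S (S.restrict x) (Sᶜ.restrict x) = x := by
  ext j
  unfold glue
  split_ifs <;> rfl

theorem restrict_glue (S : Finset (Fin d)) (u : S → ℝ) (v : ↥Sᶜ → ℝ) :
    S.restrict (glue S u v) = u := by
  ext ⟨j, hj⟩
  simp [glue, hj]

theorem measurable_glue (S : Finset (Fin d)) :
    Measurable fun p : (S → ℝ) × (↥Sᶜ → ℝ) => glue S p.1 p.2 := by
  refine measurable_pi_iff.2 fun j => ?_
  unfold glue
  split_ifs with hj
  · exact (measurable_pi_apply _).comp measurable_fst
  · exact (measurable_pi_apply _).comp measurable_snd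

/-- Products of a weight with a factor of conditional mean zero given `X_S`, evaluated along an
i.i.d. sample, are orthogonal if the weights depend on the sample only through the
`S`-coordinates. -/
theorem integral_sq_sum_eq (μ : Measure (Pt d)) [IsProbabilityMeasure μ] (S : Finset (Fin d))
    {ζ : Pt d → ℝ} (hζm : Measurable ζ) {B : ℝ} (hζb : ∀ x, |ζ x| ≤ B)
    (hζ : ∀ φ : (S → ℝ) → ℝ, Measurable φ → (∃ b, ∀ u, |φ u| ≤ b) →
      ∫ y, φ (S.restrict y) * ζ y ∂μ = 0)
    {q : Fin n → (Fin n → Pt d) → ℝ} (hqm : ∀ i, Measurable (q i)) (hqb : ∀ i z, |q i z| ≤ 1)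
    (hq : ∀ i j z y y', S.restrict y = S.restrict y' →
      q i (Function.update z j y) = q i (Function.update z j y'))
    (D : Finset (Fin n)) :
    ∫ z, (∑ i ∈ D, q i z * ζ (z i)) ^ 2 ∂(Measure.pi fun _ => μ)
      = ∑ i ∈ D, ∫ z, q i z ^ 2 * ζ (z i) ^ 2 ∂(Measure.pi fun _ => μ) := by
  have hB : 0 ≤ B := (abs_nonneg _).trans (hζb 0)
  have hm : ∀ i, Measurable fun z : Fin n → Pt d => q i z * ζ (z i) := fun i =>
    (hqm i).mul (hζm.comp (measurable_pi_apply i))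
  have hb : ∀ i z, |q i z * ζ (z i)| ≤ B := fun i z => by
    rw [abs_mul]
    calc _ ≤ 1 * B := mul_le_mul (hqb i z) (hζb _) (abs_nonneg _) zero_le_one
      _ = B := one_mul B
  have hint : ∀ i j, Integrable (fun z : Fin n → Pt d => (q i z * ζ (z i)) * (q j z * ζ (z j)))
      (Measure.pi fun _ => μ) := fun i j =>
    integrable_of_bound ((hm i).mul (hm j)) (b := B * B) fun z => by
      rw [abs_mul]; exact mul_le_mul (hb i z) (hb j z) (abs_nonneg _) hB
  have hcross : ∀ i j, i ≠ j → ∫ z : Fin n → Pt d, (q i z * ζ (z i)) * (q j z * ζ (z j))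
      ∂(Measure.pi fun _ => μ) = 0 := by
    intro i j hij
    -- With the other points frozen, both weights depend on the redrawn point only through its
    -- `S`-coordinates, and `ζ (z j)` is constant. The hypothesis on `ζ` then annihilates the inner
    -- integral.
    rw [integral_resample μ i (F := fun z => (q i z * ζ (z i)) * (q j z * ζ (z j)))
      ((hm i).mul (hm j)) (b := B * B) fun z => by
        rw [abs_mul]; exact mul_le_mul (hb i z) (hb j z) (abs_nonneg _) hB]
    rw [← integral_zero (Fin n → Pt d) ℝ]
    congr 1
    ext1 z
    -- The complementary coordinates are filled with `0` to express the weights as functions of `u`;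
    -- by `hq` the filling is immaterial.
    have hu : Measurable fun u : S → ℝ => Function.update z i (glue S u 0) :=
      (measurable_update z).comp ((measurable_glue S).comp (measurable_id.prodMk measurable_const))
    have h0 := hζ (fun u => q i (Function.update z i (glue S u 0))
        * q j (Function.update z i (glue S u 0)) * ζ (z j))
      ((((hqm i).comp hu).mul ((hqm j).comp hu)).mul_const _) ⟨B, fun u => by
        rw [abs_mul, abs_mul]
        calc _ ≤ 1 * 1 * B := mul_le_mul (mul_le_mul (hqb _ _) (hqb _ _) (abs_nonneg _) zero_le_one)
              (hζb _) (abs_nonneg _) (by norm_num)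
          _ = B := by ring⟩
    rw [← h0]
    congr 1
    ext1 y
    have e : ∀ k, q k (Function.update z i (glue S (S.restrict y) 0)) = q k (Function.update z i y) :=
      fun k => hq k i z _ _ (restrict_glue _ _ _)
    simp only [e, Function.update_self, Function.update_of_ne hij.symm]
    ring
  simp_rw [sq, Finset.sum_mul_sum]
  rw [integral_finsetSum _ fun i _ => integrable_finsetSum _ fun j _ => hint i j]
  refine Finset.sum_congr rfl fun i hi => ?_
  rw [integral_finsetSum _ fun j _ => hint i j, Finset.sum_eq_single i]
  · congr 1; ext1 z; ring
  · intro j _ hji; exact hcross i j hji.symm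
  · intro h; exact absurd hi h

/-- An i.i.d. centred bounded sample: the second moment of the sum. -/
theorem integral_sq_sum_centred (μ : Measure (Pt d)) [IsProbabilityMeasure μ]
    {ζ : Pt d → ℝ} (hζm : Measurable ζ) {B : ℝ} (hζb : ∀ x, |ζ x| ≤ B)
    (hζ : ∫ y, ζ y ∂μ = 0) (D : Finset (Fin n)) :
    ∫ z, (∑ i ∈ D, ζ (z i)) ^ 2 ∂(Measure.pi fun _ : Fin n => μ)
      = D.card * ∫ y, ζ y ^ 2 ∂μ := by
  -- For `S = ∅` a function of `X_S` is a constant, so conditional centring is ordinary centring.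
  have := integral_sq_sum_eq μ ∅ hζm hζb (fun φ _ _ => by
    have : ∀ y : Pt d, φ ((∅ : Finset (Fin d)).restrict y) = φ default := fun y => by
      congr 1; exact Subsingleton.elim _ _
    simp only [this]
    rw [integral_const_mul, hζ, mul_zero]) (q := fun (_ : Fin n) _ => 1)
    (fun _ => measurable_const) (by simp) (by simp) D
  simp only [one_mul, one_pow] at this
  rw [this]
  have e : ∀ i : Fin n, ∫ z : Fin n → Pt d, ζ (z i) ^ 2 ∂(Measure.pi fun _ => μ)
      = ∫ y, ζ y ^ 2 ∂μ := fun i =>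
    integral_comp_eval (μ := fun _ : Fin n => μ) (f := fun y => ζ y ^ 2)
      (hζm.pow_const 2).aestronglyMeasurable
  simp [e]

/-- Averaging over the neighbours of a fresh point inflates an expectation by at most `2^|S|`. -/
theorem lintegral_sum_near_div_count_le (μ : Measure (Pt d)) [IsProbabilityMeasure μ]
    (S : Finset (Fin d)) {h : ℝ} (hh : 0 ≤ h) (D : Finset (Fin n))
    {φ : (Fin n → Pt d) → Pt d → ℝ} (hφm : Measurable fun p : Pt d × (Fin n → Pt d) => φ p.2 p.1)
    (hφ0 : ∀ z x, 0 ≤ φ z x) (hφD : ∀ i ∈ D, ∀ z y, φ (Function.update z i y) = φ z) :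
    ∫⁻ p, ENNReal.ofReal ((∑ i ∈ D, near S h p.1 (p.2 i) * φ p.2 (p.2 i)) / count S h D p.2 p.1)
        ∂(μ.prod (Measure.pi fun _ => μ))
      ≤ ENNReal.ofReal (2 ^ S.card)
        * ∫⁻ p, ENNReal.ofReal (φ p.2 p.1) ∂(μ.prod (Measure.pi fun _ => μ)) := by
  have hev : ∀ i : Fin n, Measurable fun p : Pt d × (Fin n → Pt d) => p.2 i := fun i =>
    (measurable_pi_apply i).comp measurable_snd
  have hmi : ∀ i : Fin n, Measurable fun p : Pt d × (Fin n → Pt d) =>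
      near S h p.1 (p.2 i) := fun i => near_measurable S h measurable_fst (hev i)
  have hφi : ∀ i : Fin n, Measurable fun p : Pt d × (Fin n → Pt d) => φ p.2 (p.2 i) := fun i =>
    hφm.comp ((hev i).prodMk measurable_snd)
  have hsplit : ∀ p : Pt d × (Fin n → Pt d),
      ENNReal.ofReal ((∑ i ∈ D, near S h p.1 (p.2 i) * φ p.2 (p.2 i)) / count S h D p.2 p.1)
        = ∑ i ∈ D, ENNReal.ofReal (near S h p.1 (p.2 i) * φ p.2 (p.2 i) / count S h D p.2 p.1) := by
    intro p
    rw [Finset.sum_div, ENNReal.ofReal_sum_of_nonneg]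
    intro i _
    exact div_nonneg (mul_nonneg (near_nonneg _ _ _ _) (hφ0 _ _)) (count_nonneg _ _ _ _ _)
  simp_rw [hsplit]
  have hterm : ∀ i ∈ D, Measurable fun p : Pt d × (Fin n → Pt d) =>
      ENNReal.ofReal (near S h p.1 (p.2 i) * φ p.2 (p.2 i) / count S h D p.2 p.1) := fun i _ =>
    (((hmi i).mul (hφi i)).div
      (count_measurable S h D measurable_fst measurable_snd)).ennreal_ofReal
  rw [lintegral_finsetSum _ hterm]
  have hsw : ∀ i ∈ D, ∫⁻ p, ENNReal.ofReal (near S h p.1 (p.2 i) * φ p.2 (p.2 i)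
        / count S h D p.2 p.1) ∂(μ.prod (Measure.pi fun _ => μ))
      = ∫⁻ p, ENNReal.ofReal (φ p.2 p.1 * (near S h p.1 (p.2 i) * (count S h D p.2 (p.2 i))⁻¹))
        ∂(μ.prod (Measure.pi fun _ => μ)) := by
    intro i hi
    rw [lintegral_swap μ i fun x z => ENNReal.ofReal (near S h x (z i) * φ z (z i)
        / count S h D z x)]
    refine lintegral_congr fun p => ?_
    congr 1
    rw [hφD i hi, Function.update_self, near_comm S h (p.2 i) p.1]
    rcases near_eq_zero_or_one S h p.1 (p.2 i) with e | e
    · simp [e]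
    -- When the two exchanged points are neighbours, slot `i` counts one for the point `p.2 i` both
    -- before and after the exchange.
    · have : count S h D (Function.update p.2 i p.1) (p.2 i) = count S h D p.2 (p.2 i) := by
        refine Finset.sum_congr rfl fun j _ => ?_
        by_cases hj : j = i
        · subst hj
          rw [Function.update_self, near_self S hh, near_comm, e]
        · rw [Function.update_of_ne hj]
      rw [this, e]
      ring
  rw [Finset.sum_congr rfl hsw, ← lintegral_finsetSum _ fun i _ => ?_,
    ← lintegral_const_mul _ hφm.ennreal_ofReal]
  · refine lintegral_mono fun p => ?_
    dsimp only
    rw [← ENNReal.ofReal_sum_of_nonneg, ← Finset.mul_sum, ← ENNReal.ofReal_mul (by positivity)]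
    · apply ENNReal.ofReal_le_ofReal
      rw [mul_comm]
      exact mul_le_mul_of_nonneg_right (sum_near_mul_inv_count_le S h D p.2 p.1) (hφ0 _ _)
    · intro i _
      exact mul_nonneg (hφ0 _ _) (mul_nonneg (near_nonneg _ _ _ _)
        (inv_nonneg.2 (count_nonneg _ _ _ _ _)))
  · exact (hφm.mul ((hmi i).mul (count_measurable S h D (hev i)
      measurable_snd).inv)).ennreal_ofReal

open Classical in
/-- On the cube `‖x_S‖ ≤ T`, the expected inverse number of neighbours of a fresh point is at most
the number of cells of side `h` over the sample size. -/
theorem lintegral_inv_one_add_count_le (μ : Measure (Pt d)) [IsProbabilityMeasure μ]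
    (S : Finset (Fin d)) {h T : ℝ} (hh : 0 < h) (hh1 : h ≤ 1) (hT : 1 ≤ T) (D : Finset (Fin n)) :
    ∫⁻ p, ENNReal.ofReal (if ‖S.restrict p.1‖ ≤ T then (1 + count S h D p.2 p.1)⁻¹ else 0)
        ∂(μ.prod (Measure.pi fun _ => μ))
      ≤ ENNReal.ofReal ((3 * (T / h)) ^ S.card / (D.card + 1)) := by
  set F : Pt d → (Fin n → Pt d) → ℝ := fun x z =>
    if ‖S.restrict x‖ ≤ T then (1 + count S h D z x)⁻¹ else 0 with hF
  have hev : ∀ i : Fin n, Measurable fun p : Pt d × (Fin n → Pt d) => p.2 i := fun i =>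
    (measurable_pi_apply i).comp measurable_snd
  have hF0 : ∀ x z, 0 ≤ F x z := fun x z => by
    simp only [hF]
    split_ifs
    · exact inv_nonneg.2 (add_nonneg zero_le_one (count_nonneg _ _ _ _ _))
    · exact le_rfl
  have hFm : ∀ {G : Pt d × (Fin n → Pt d) → Pt d} {Z : Pt d × (Fin n → Pt d) → Fin n → Pt d},
      Measurable G → Measurable Z → Measurable fun p => F (G p) (Z p) := by
    intro G Z hG hZ
    refine Measurable.ite (measurableSet_le ((measurable_restrict S).comp hG).norm
      measurable_const) ?_ measurable_const
    exact ((count_measurable S h D hG hZ).const_add 1).inv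
  have hupd : ∀ i : Fin n, Measurable fun p : Pt d × (Fin n → Pt d) =>
      Function.update p.2 i p.1 := by
    intro i
    obtain ⟨e, he, -⟩ := exists_measurableEquiv_swap (Measure.dirac (0 : Pt d)) i
    have := measurable_snd.comp e.measurable
    simpa only [Function.comp_def, he] using this
  set I := ∫⁻ p, ENNReal.ofReal (F p.1 p.2) ∂(μ.prod (Measure.pi fun _ : Fin n => μ)) with hI
  -- By exchangeability each of the `|D| + 1` points may play the fresh one. Summing over these
  -- roles gives a pointwise sum of inverse counts within one common point set.
  have hsum : ((D.card : ℝ≥0∞) + 1) * I = ∫⁻ p, ENNReal.ofReal (F p.1 p.2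
      + ∑ i ∈ D, F (p.2 i) (Function.update p.2 i p.1))
        ∂(μ.prod (Measure.pi fun _ : Fin n => μ)) := by
    have e : ∀ p : Pt d × (Fin n → Pt d), ENNReal.ofReal (F p.1 p.2
        + ∑ i ∈ D, F (p.2 i) (Function.update p.2 i p.1)) = ENNReal.ofReal (F p.1 p.2)
          + ∑ i ∈ D, ENNReal.ofReal (F (p.2 i) (Function.update p.2 i p.1)) := fun p => by
      rw [ENNReal.ofReal_add (hF0 _ _) (Finset.sum_nonneg fun _ _ => hF0 _ _),
        ENNReal.ofReal_sum_of_nonneg fun _ _ => hF0 _ _]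
    simp_rw [e]
    rw [lintegral_add_left (hFm measurable_fst measurable_snd).ennreal_ofReal,
      lintegral_finsetSum _ fun i _ => (hFm (hev i) (hupd i)).ennreal_ofReal]
    have : ∀ i ∈ D, ∫⁻ p, ENNReal.ofReal (F (p.2 i) (Function.update p.2 i p.1))
        ∂(μ.prod (Measure.pi fun _ : Fin n => μ)) = I := fun i _ =>
      (lintegral_swap μ i fun x z => ENNReal.ofReal (F x z)).symm
    rw [Finset.sum_congr rfl this, Finset.sum_const, nsmul_eq_mul, add_mul, one_mul, add_comm]
  have hle : ((D.card : ℝ≥0∞) + 1) * I ≤ ENNReal.ofReal ((3 * (T / h)) ^ S.card) := by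
    rw [hsum]
    calc _ ≤ ∫⁻ _, ENNReal.ofReal ((3 * (T / h)) ^ S.card)
          ∂(μ.prod (Measure.pi fun _ : Fin n => μ)) := by
          refine lintegral_mono fun p => ENNReal.ofReal_le_ofReal ?_
          -- The index `none` stands for the fresh point. The `1` in `1 + count` is each point
          -- counted as its own neighbour.
          have := sum_inv_sum_near_le S hh hh1 hT (Finset.insertNone D)
            (fun o => o.elim p.1 p.2)
          rw [Finset.sum_insertNone] at this
          simp only [Finset.sum_insertNone, Option.elim] at this
          refine le_trans (le_of_eq ?_) this
          congr 1
          · simp only [hF, near_self S hh.le]; rfl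
          · refine Finset.sum_congr rfl fun i hi => ?_
            simp only [hF]
            congr 2
            unfold count
            rw [← Finset.add_sum_erase _ _ hi, ← Finset.add_sum_erase D (fun j => near S h (p.2 i) (p.2 j)) hi,
              Function.update_self, near_self S hh.le]
            have : ∑ j ∈ D.erase i, near S h (p.2 i) (Function.update p.2 i p.1 j)
                = ∑ j ∈ D.erase i, near S h (p.2 i) (p.2 j) :=
              Finset.sum_congr rfl fun j hj => by
                rw [Function.update_of_ne (Finset.ne_of_mem_erase hj)]
            rw [this]
            ring
      _ = _ := by simp
  have hc : ((D.card : ℝ≥0∞) + 1) = ENNReal.ofReal ((D.card : ℝ) + 1) := by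
    rw [ENNReal.ofReal_add (by positivity) zero_le_one]; simp
  rw [ENNReal.ofReal_div_of_pos (by positivity), ← hc,
    ENNReal.le_div_iff_mul_le (by simp) (by simp), mul_comm]
  exact hle

end Sample

/-! ### Local Hölder continuity -/

section Holder

variable {E : Type*} [SeminormedAddCommGroup E]

/-- Hölder continuity at scales up to `1`. -/
def LocHolder (F : E → ℝ) (β L : ℝ) : Prop :=
  ∀ x x' : E, ‖x - x'‖ ≤ 1 → |F x - F x'| ≤ L * ‖x - x'‖ ^ β

theorem LocHolder.mono_exponent {F : E → ℝ} {β β' L : ℝ} (hF : LocHolder F β L) (hL : 0 ≤ L)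
    (hβ' : 0 ≤ β') (h : β' ≤ β) : LocHolder F β' L := fun x x' hx =>
  (hF x x' hx).trans (mul_le_mul_of_nonneg_left
    (Real.rpow_le_rpow_of_exponent_ge' (norm_nonneg _) hx hβ' h) hL)

theorem LocHolder.continuous {F : E → ℝ} {β L : ℝ} (hF : LocHolder F β L) (hβ : 0 < β) :
    Continuous F := by
  rw [continuous_iff_continuousAt]
  intro x
  rw [ContinuousAt, tendsto_iff_norm_sub_tendsto_zero]
  have h1 : Filter.Tendsto (fun y : E => L * ‖y - x‖ ^ β) (nhds x) (nhds 0) := by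
    have h2 : Filter.Tendsto (fun y : E => ‖y - x‖) (nhds x) (nhds 0) :=
      tendsto_iff_norm_sub_tendsto_zero.1 Filter.tendsto_id
    have h3 := (h2.rpow_const (p := β) (Or.inr hβ.le)).const_mul L
    simpa [Real.zero_rpow hβ.ne'] using h3
  refine squeeze_zero' (Filter.Eventually.of_forall fun _ => norm_nonneg _) ?_ h1
  filter_upwards [Metric.closedBall_mem_nhds x one_pos] with y hy
  exact hF y x (by simpa [dist_eq_norm] using hy)

end Holder

/-! ### Integrals and total variation -/

section TotalVariation

/-- Both measures have mass one, so the integrand may be centred at the midpoint of its range. The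
half-length that results absorbs the factor `1/2` in `tvDist`. -/
theorem abs_integral_sub_integral_le {E : Type*} [MeasurableSpace E] (P Q : Measure E)
    [IsProbabilityMeasure P] [IsProbabilityMeasure Q] {φ : E → ℝ} (hφ : Measurable φ) {lo hi : ℝ}
    (hr : ∀ z, φ z ∈ Set.Icc lo hi) :
    |∫ z, φ z ∂P - ∫ z, φ z ∂Q| ≤ (hi - lo) * tvDist P Q := by
  set mid := (lo + hi) / 2 with hmid
  have hb : ∀ z, |φ z - mid| ≤ (hi - lo) / 2 := fun z => by
    have := hr z
    rw [abs_le, hmid]; constructor <;> linarith [this.1, this.2]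
  have hint : ∀ ν : Measure E, IsProbabilityMeasure ν → ν ≪ P + Q →
      ∫ z, φ z ∂ν - mid = ∫ z, (ν.rnDeriv (P + Q) z).toReal * (φ z - mid) ∂(P + Q) := by
    intro ν _ hac
    have := integral_rnDeriv_smul (μ := ν) (ν := P + Q) hac (f := fun z => φ z - mid)
    simp only [smul_eq_mul] at this
    rw [this, integral_sub _ (integrable_const _)]
    · simp
    · exact integrable_of_bound hφ (b := max |lo| |hi|) fun z => abs_le_max_abs_abs (hr z).1 (hr z).2
  have hPi : ∀ ν : Measure E, IsProbabilityMeasure ν →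
      Integrable (fun z => (ν.rnDeriv (P + Q) z).toReal * (φ z - mid)) (P + Q) := by
    intro ν _
    exact Measure.integrable_toReal_rnDeriv.mul_bdd (c := (hi - lo) / 2)
      (hφ.sub_const _).aestronglyMeasurable (Filter.Eventually.of_forall hb)
  have e : ∫ z, φ z ∂P - ∫ z, φ z ∂Q = ∫ z, ((P.rnDeriv (P + Q) z).toReal
      - (Q.rnDeriv (P + Q) z).toReal) * (φ z - mid) ∂(P + Q) := by
    have h1 := hint P inferInstance (Measure.AbsolutelyContinuous.rfl.add_right Q)
    have h2 := hint Q inferInstance (by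
      rw [add_comm]; exact Measure.AbsolutelyContinuous.rfl.add_right P)
    calc _ = (∫ z, φ z ∂P - mid) - (∫ z, φ z ∂Q - mid) := by ring
      _ = _ := by
        rw [h1, h2, ← integral_sub (hPi P inferInstance) (hPi Q inferInstance)]
        congr 1; ext1 z; ring
  rw [e, tvDist, ← mul_assoc, ← integral_const_mul]
  refine (abs_integral_le_integral_abs).trans (integral_mono_of_nonneg
    (Filter.Eventually.of_forall fun _ => abs_nonneg _) ?_ (Filter.Eventually.of_forall fun z => ?_))
  · exact ((Measure.integrable_toReal_rnDeriv.sub Measure.integrable_toReal_rnDeriv).abs).const_mul _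
  · dsimp only
    rw [abs_mul, mul_comm, ← div_eq_mul_inv]
    exact mul_le_mul_of_nonneg_right (hb z) (abs_nonneg _)

end TotalVariation

/-! ### Sup norms under restriction and gluing of coordinates -/

section Restrict

theorem norm_restrict_sub_le (S : Finset (Fin d)) (x x' : Pt d) :
    ‖S.restrict x - S.restrict x'‖ ≤ ‖x - x'‖ := by
  rw [pi_norm_le_iff_of_nonneg (norm_nonneg _)]
  exact fun s => norm_le_pi_norm (x - x') s

theorem norm_restrict_le (S : Finset (Fin d)) (x : Pt d) : ‖S.restrict x‖ ≤ ‖x‖ := by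
  rw [pi_norm_le_iff_of_nonneg (norm_nonneg _)]
  exact fun s => norm_le_pi_norm x s

theorem norm_glue_sub_le (S : Finset (Fin d)) (u u' : S → ℝ) (v : ↥Sᶜ → ℝ) :
    ‖glue S u v - glue S u' v‖ ≤ ‖u - u'‖ := by
  rw [pi_norm_le_iff_of_nonneg (norm_nonneg _)]
  intro j
  simp only [Pi.sub_apply, glue]
  split_ifs with hj
  · exact norm_le_pi_norm (u - u') ⟨j, hj⟩
  · simp

theorem measurable_glue_right (S : Finset (Fin d)) (u : S → ℝ) :
    Measurable fun v : ↥Sᶜ → ℝ => glue S u v :=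
  (measurable_glue S).comp (measurable_const.prodMk measurable_id)

theorem LocHolder.comp_restrict {S : Finset (Fin d)} {F : (S → ℝ) → ℝ} {β L : ℝ}
    (hF : LocHolder F β L) (hβ : 0 ≤ β) (hL : 0 ≤ L) :
    LocHolder (fun x : Pt d => F (S.restrict x)) β L := fun x x' hx =>
  (hF _ _ ((norm_restrict_sub_le S x x').trans hx)).trans
    (mul_le_mul_of_nonneg_left (Real.rpow_le_rpow (norm_nonneg _) (norm_restrict_sub_le S x x') hβ)
      hL)

end Restrict

/-! ### Conditional means given `X_S` -/

section CondMean

/-- The conditional mean `𝔼{g(X) | X_S = u}`. -/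
def condMean (S : Finset (Fin d)) (κ : Kernel (S → ℝ) (↥Sᶜ → ℝ)) (g : Pt d → ℝ) (u : S → ℝ) : ℝ :=
  ∫ v, g (glue S u v) ∂(κ u)

variable {S : Finset (Fin d)} {κ : Kernel (S → ℝ) (↥Sᶜ → ℝ)} {g : Pt d → ℝ} {lo hi : ℝ}

theorem integral_mem_Icc {E : Type*} [MeasurableSpace E] (P : Measure E) [IsProbabilityMeasure P]
    {φ : E → ℝ} (hφ : Measurable φ) (hr : ∀ z, φ z ∈ Set.Icc lo hi) :
    ∫ z, φ z ∂P ∈ Set.Icc lo hi := by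
  have hi' : Integrable φ P := integrable_of_bound hφ (b := max |lo| |hi|) fun z =>
    abs_le_max_abs_abs (hr z).1 (hr z).2
  constructor
  · simpa using integral_mono (integrable_const lo) hi' fun z => (hr z).1
  · simpa using integral_mono hi' (integrable_const hi) fun z => (hr z).2

theorem condMean_mem_Icc [IsMarkovKernel κ] (hg : Measurable g)
    (hr : ∀ x, g x ∈ Set.Icc lo hi) (u : S → ℝ) : condMean S κ g u ∈ Set.Icc lo hi :=
  integral_mem_Icc (κ u) (hg.comp (measurable_glue_right S u)) fun _ => hr _

/-- First the point moves inside `g` under a fixed conditional law, which costs `L`; then the law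
changes under a fixed integrand, which costs the length of the range times the total variation
distance. -/
theorem LocHolder.condMean [IsMarkovKernel κ] {β L L' : ℝ} (hg : LocHolder g β L) (hβ : 0 < β)
    (hL : 0 ≤ L) (hr : ∀ x, g x ∈ Set.Icc lo hi)
    (hκ : ∀ u u' : S → ℝ, ‖u - u'‖ ≤ 1 → tvDist (κ u) (κ u') ≤ L' * ‖u - u'‖ ^ β) :
    LocHolder (condMean S κ g) β (L + (hi - lo) * L') := by
  intro u u' hu
  have hgm : Measurable g := (hg.continuous hβ).measurable
  have hlh : 0 ≤ hi - lo := by linarith [(hr 0).1, (hr 0).2]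
  have hint : ∀ w t, Integrable (fun v => g (glue S w v)) (κ t) := fun w t =>
    integrable_of_bound (hgm.comp (measurable_glue_right S w)) (b := max |lo| |hi|) fun z =>
      abs_le_max_abs_abs (hr _).1 (hr _).2
  have h1 : |∫ v, g (glue S u v) ∂(κ u) - ∫ v, g (glue S u' v) ∂(κ u)| ≤ L * ‖u - u'‖ ^ β := by
    rw [← integral_sub (hint _ _) (hint _ _)]
    refine (abs_integral_le_integral_abs).trans ?_
    calc _ ≤ ∫ _, L * ‖u - u'‖ ^ β ∂(κ u) := by
          refine integral_mono_of_nonneg (Filter.Eventually.of_forall fun _ => abs_nonneg _)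
            (integrable_const _) (Filter.Eventually.of_forall fun v => ?_)
          refine (hg _ _ ((norm_glue_sub_le S u u' v).trans hu)).trans ?_
          exact mul_le_mul_of_nonneg_left
            (Real.rpow_le_rpow (norm_nonneg _) (norm_glue_sub_le S u u' v) hβ.le) hL
      _ = _ := by simp
  have h2 := abs_integral_sub_integral_le (κ u) (κ u') (hgm.comp (measurable_glue_right S u'))
    (lo := lo) (hi := hi) fun _ => hr _
  have h3 := mul_le_mul_of_nonneg_left (hκ u u' hu) hlh
  simp only [Function.comp_apply] at h2
  unfold IncompleteData.condMean
  calc _ = |(∫ v, g (glue S u v) ∂(κ u) - ∫ v, g (glue S u' v) ∂(κ u))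
        + (∫ v, g (glue S u' v) ∂(κ u) - ∫ v, g (glue S u' v) ∂(κ u'))| := by congr 1; ring
    _ ≤ _ := abs_add_le _ _
    _ ≤ L * ‖u - u'‖ ^ β + (hi - lo) * (L' * ‖u - u'‖ ^ β) := add_le_add h1 (h2.trans h3)
    _ = _ := by ring

theorem IsDensity.isProbabilityMeasure {f : Pt d → ℝ} (hf : IsDensity f) :
    IsProbabilityMeasure (law f) :=
  ⟨by rw [law, withDensity_apply _ MeasurableSet.univ]; simpa using hf.lintegral_eq_one⟩

/-- The conditional mean is characterised by its integrals against functions of `x_S`. -/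
theorem integral_mul_condMean {f : Pt d → ℝ} (hf : IsDensity f) (hκ : IsCondLaw f S κ)
    (hg : Measurable g) (hr : ∀ x, g x ∈ Set.Icc lo hi) {φ : (S → ℝ) → ℝ} (hφ : Measurable φ)
    {b : ℝ} (hb : ∀ u, |φ u| ≤ b) :
    ∫ x, φ (S.restrict x) * condMean S κ g (S.restrict x) ∂(law f)
      = ∫ x, φ (S.restrict x) * g x ∂(law f) := by
  have := hf.isProbabilityMeasure
  obtain ⟨h1, h2⟩ := hκ
  have hpair : Measurable fun x : Pt d => (S.restrict x, Sᶜ.restrict x) :=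
    (measurable_restrict S).prodMk (measurable_restrict Sᶜ)
  set ν := (law f).map fun x => (S.restrict x, Sᶜ.restrict x) with hν
  have : IsProbabilityMeasure ν := Measure.isProbabilityMeasure_map hpair.aemeasurable
  have hgl : Measurable fun p : (S → ℝ) × (↥Sᶜ → ℝ) => φ p.1 * g (glue S p.1 p.2) :=
    (hφ.comp measurable_fst).mul (hg.comp (measurable_glue S))
  have hbd : ∀ p : (S → ℝ) × (↥Sᶜ → ℝ), |φ p.1 * g (glue S p.1 p.2)| ≤ b * max |lo| |hi| :=
    fun p => by
      rw [abs_mul]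
      exact mul_le_mul (hb _) (abs_le_max_abs_abs (hr _).1 (hr _).2) (abs_nonneg _)
        ((abs_nonneg _).trans (hb 0))
  have hfst : ν.fst = (law f).map S.restrict := by
    rw [hν, Measure.fst_map_prodMk (measurable_restrict Sᶜ)]
  have e1 : ∫ x, φ (S.restrict x) * g x ∂(law f) = ∫ p, φ p.1 * g (glue S p.1 p.2) ∂ν := by
    rw [hν, integral_map hpair.aemeasurable hgl.aestronglyMeasurable]
    simp only [glue_restrict]
  have e2 : ∫ p, φ p.1 * g (glue S p.1 p.2) ∂ν
      = ∫ u, ∫ v, φ u * g (glue S u v) ∂(κ u) ∂ν.fst := by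
    conv_lhs => rw [← h2.disintegrate]
    exact Measure.integral_compProd (integrable_of_bound hgl hbd)
  rw [e1, e2, hfst, integral_map (measurable_restrict S).aemeasurable]
  · simp only [integral_const_mul]; rfl
  · have : StronglyMeasurable fun u => ∫ v, φ u * g (glue S u v) ∂(κ u) :=
      StronglyMeasurable.integral_kernel_prod_right' hgl.stronglyMeasurable
    exact this.aestronglyMeasurable

end CondMean

/-! ### The weight function, uniformly in `lam` -/

section Weights

variable {lam c C ρ s s' : ℝ}

theorem weight_nonneg (hlam : 0 < lam) (hρ : 0 < ρ) (hs : 0 < s) :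
    0 ≤ lam * s / (ρ + lam * s) := by positivity

theorem weight_le_one (hlam : 0 < lam) (hρ : 0 < ρ) (hs : 0 < s) :
    lam * s / (ρ + lam * s) ≤ 1 := by
  rw [div_le_one (by positivity)]; linarith

/-- The weight increases in `s` but less than proportionally, so weights differ by no more than the
ratio of the shifts, whatever `lam` and `ρ` are. -/
theorem weight_le_mul_weight (hlam : 0 < lam) (hρ : 0 < ρ) (hc : 0 < c) (hs : c ≤ s) (hsC : s ≤ C)
    (hs' : c ≤ s') :
    lam * s / (ρ + lam * s) ≤ C / c * (lam * s' / (ρ + lam * s')) := by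
  have h0 : 0 < s := hc.trans_le hs
  have h0' : 0 < s' := hc.trans_le hs'
  have hC : 0 < C := h0.trans_le hsC
  rw [div_mul_div_comm, div_le_div_iff₀ (by positivity) (by positivity)]
  have e1 : s * c ≤ C * s' := mul_le_mul hsC hs' hc.le hC.le
  have e2 : s * c ≤ C * s := by nlinarith
  nlinarith [mul_le_mul_of_nonneg_left e1 (mul_pos hlam hρ).le,
    mul_le_mul_of_nonneg_left e2 (mul_pos (mul_pos hlam hlam) h0').le,
    mul_nonneg (mul_nonneg hlam.le hlam.le) (mul_nonneg h0.le h0'.le),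
    mul_le_mul_of_nonneg_right (hs.trans hsC) (mul_pos (mul_pos hlam h0) (mul_pos hlam h0')).le]

/-- The denominator `(1 + lam * s) * (1 + lam * s')` is at least `(1 + lam * c) ^ 2 ≥ 4 * lam * c`,
which cancels `lam`. -/
theorem abs_weight_sub_weight_le (hlam : 0 < lam) (hc : 0 < c) (hs : c ≤ s) (hs' : c ≤ s') :
    |lam * s / (1 + lam * s) - lam * s' / (1 + lam * s')| ≤ |s - s'| / (4 * c) := by
  have h0 : 0 < s := hc.trans_le hs
  have h0' : 0 < s' := hc.trans_le hs'
  have e : lam * s / (1 + lam * s) - lam * s' / (1 + lam * s')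
      = lam * (s - s') / ((1 + lam * s) * (1 + lam * s')) := by
    field_simp; ring
  rw [e, abs_div, abs_mul, abs_of_pos hlam,
    abs_of_pos (show 0 < (1 + lam * s) * (1 + lam * s') by positivity),
    div_le_div_iff₀ (by positivity) (by positivity)]
  have h1 : (1 + lam * c) * (1 + lam * c) ≤ (1 + lam * s) * (1 + lam * s') := by gcongr
  nlinarith [sq_nonneg (1 - lam * c), abs_nonneg (s - s'),
    mul_le_mul_of_nonneg_left (show lam * (4 * c) ≤ (1 + lam * s) * (1 + lam * s') by
      nlinarith [sq_nonneg (1 - lam * c)]) (abs_nonneg (s - s'))]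

/-- The error from the estimated normalisation `ρ` is relative to the weight itself. This keeps it
harmless in a ratio of weighted sums even if all weights are small. -/
theorem abs_weight_sub_le (hlam : 0 < lam) (hρ : 0 < ρ) (hs : 0 < s) :
    |lam * s / (ρ + lam * s) - lam * s / (1 + lam * s)| ≤ lam * s / (ρ + lam * s) * |1 - ρ| := by
  have e : lam * s / (ρ + lam * s) - lam * s / (1 + lam * s)
      = lam * s / (ρ + lam * s) * ((1 - ρ) / (1 + lam * s)) := by
    field_simp; ring
  rw [e, abs_mul, abs_of_nonneg (weight_nonneg hlam hρ hs), abs_div,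
    abs_of_pos (show 0 < 1 + lam * s by positivity)]
  apply mul_le_mul_of_nonneg_left _ (weight_nonneg hlam hρ hs)
  apply div_le_self (abs_nonneg _)
  have := mul_pos hlam hs
  linarith

end Weights

/-! ### One population step: range and smoothness -/

section Population

variable {f : Pt d → ℝ} {S : Finset (Fin d)} {r : (S → ℝ) → ℝ} {lam c C : ℝ}

/-- A zero integral, which is also the value for a non-integrable `r`, would make `rBar` vanish
identically by division by zero. -/
theorem integral_ne_zero_of_le_rBar (hc : 0 < c) (hb : ∀ u, c ≤ rBar f S r u) :
    ∫ x, r (S.restrict x) ∂(law f) ≠ 0 := by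
  intro h
  have := hb 0
  rw [rBar, h, div_zero] at this
  linarith

theorem integral_rBar (hc : 0 < c) (hb : ∀ u, c ≤ rBar f S r u) :
    ∫ x, rBar f S r (S.restrict x) ∂(law f) = 1 := by
  unfold rBar
  rw [integral_div, div_self (integral_ne_zero_of_le_rBar hc hb)]

theorem le_one_le_of_rBar (hf : IsDensity f) (hc : 0 < c)
    (hm : Measurable (rBar f S r))
    (hb : ∀ u, c ≤ rBar f S r u ∧ rBar f S r u ≤ C) : c ≤ 1 ∧ 1 ≤ C := by
  have := hf.isProbabilityMeasure
  have h := integral_mem_Icc (law f) (hm.comp (measurable_restrict S)) fun x => hb _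
  simp only [Function.comp_apply] at h
  rwa [integral_rBar hc fun u => (hb u).1] at h

theorem measurable_wBar (hm : Measurable (rBar f S r)) : Measurable (wBar f S r lam) := by
  have h : Measurable fun x : Pt d => lam * rBar f S r (S.restrict x) :=
    (hm.comp (measurable_restrict S)).const_mul lam
  exact h.div (h.const_add 1)

variable {g : Pt d → ℝ} {lo hi : ℝ}

theorem wBar_mem_Icc (hlam : 0 < lam) (hc : 0 < c) (hb : ∀ u, c ≤ rBar f S r u) (x : Pt d) :
    wBar f S r lam x ∈ Set.Icc (0 : ℝ) 1 :=
  ⟨weight_nonneg hlam one_pos (hc.trans_le (hb _)), weight_le_one hlam one_pos (hc.trans_le (hb _))⟩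

theorem le_wBar (hlam : 0 < lam) (hc : 0 < c) (hb : ∀ u, c ≤ rBar f S r u) (x : Pt d) :
    lam * c / (1 + lam * c) ≤ wBar f S r lam x := by
  have := weight_le_mul_weight hlam one_pos hc le_rfl le_rfl (hb (S.restrict x))
  rwa [div_self hc.ne', one_mul] at this

theorem integral_wBar_pos (hf : IsDensity f) (hlam : 0 < lam) (hc : 0 < c)
    (hm : Measurable (rBar f S r)) (hb : ∀ u, c ≤ rBar f S r u) :
    0 < ∫ x, wBar f S r lam x ∂(law f) := by
  have := hf.isProbabilityMeasure
  have h1 : 0 < lam * c / (1 + lam * c) := by positivity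
  exact h1.trans_le (integral_mem_Icc (law f) (measurable_wBar hm) (hi := 1) fun x =>
    ⟨le_wBar hlam hc hb x, (wBar_mem_Icc hlam hc hb x).2⟩).1

theorem integrable_wBar_mul (hf : IsDensity f) (hlam : 0 < lam) (hc : 0 < c)
    (hm : Measurable (rBar f S r)) (hb : ∀ u, c ≤ rBar f S r u) (hg : Measurable g)
    (hr : ∀ x, g x ∈ Set.Icc lo hi) : Integrable (fun x => wBar f S r lam x * g x) (law f) := by
  have := hf.isProbabilityMeasure
  refine integrable_of_bound ((measurable_wBar hm).mul hg) (b := 1 * max |lo| |hi|) fun x => ?_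
  rw [abs_mul]
  have hw := wBar_mem_Icc hlam hc hb x
  exact mul_le_mul (by rw [abs_of_nonneg hw.1]; exact hw.2)
    (abs_le_max_abs_abs (hr _).1 (hr _).2) (abs_nonneg _) zero_le_one

theorem integrable_wBar (hf : IsDensity f) (hlam : 0 < lam) (hc : 0 < c)
    (hm : Measurable (rBar f S r)) (hb : ∀ u, c ≤ rBar f S r u) :
    Integrable (wBar f S r lam) (law f) := by
  simpa using integrable_wBar_mul (g := fun _ => 1) (lo := 1) (hi := 1) hf hlam hc hm hb
    measurable_const (by simp)

theorem thetaBar_mem_Icc (hf : IsDensity f) (hlam : 0 < lam) (hc : 0 < c)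
    (hm : Measurable (rBar f S r)) (hb : ∀ u, c ≤ rBar f S r u) (hg : Measurable g)
    (hr : ∀ x, g x ∈ Set.Icc lo hi) : thetaBar f S r lam g ∈ Set.Icc lo hi := by
  have hpos := integral_wBar_pos (lam := lam) hf hlam hc hm hb
  have hi1 := integrable_wBar (lam := lam) hf hlam hc hm hb
  have hi2 := integrable_wBar_mul (lam := lam) hf hlam hc hm hb hg hr
  unfold thetaBar
  constructor
  · rw [le_div_iff₀ hpos, mul_comm, ← integral_mul_const]
    exact integral_mono (hi1.mul_const _) hi2 fun x =>
      mul_le_mul_of_nonneg_left (hr x).1 (wBar_mem_Icc hlam hc hb x).1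
  · rw [div_le_iff₀ hpos, mul_comm, ← integral_mul_const]
    exact integral_mono hi2 (hi1.mul_const _) fun x =>
      mul_le_mul_of_nonneg_left (hr x).2 (wBar_mem_Icc hlam hc hb x).1

theorem integral_wBar_mul_sub_thetaBar (hf : IsDensity f) (hlam : 0 < lam) (hc : 0 < c)
    (hm : Measurable (rBar f S r)) (hb : ∀ u, c ≤ rBar f S r u) (hg : Measurable g)
    (hr : ∀ x, g x ∈ Set.Icc lo hi) :
    ∫ x, wBar f S r lam x * (g x - thetaBar f S r lam g) ∂(law f) = 0 := by
  have hpos := integral_wBar_pos (lam := lam) hf hlam hc hm hb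
  simp_rw [mul_sub]
  rw [integral_sub (integrable_wBar_mul hf hlam hc hm hb hg hr)
    ((integrable_wBar hf hlam hc hm hb).mul_const _), integral_mul_const, thetaBar,
    mul_div_cancel₀ _ hpos.ne', sub_self]

variable {κ : Kernel (S → ℝ) (↥Sᶜ → ℝ)}

theorem stepBar_eq [IsMarkovKernel κ] (hg : Measurable g) (hr : ∀ x, g x ∈ Set.Icc lo hi)
    (x : Pt d) :
    stepBar f S r lam κ g x
      = wBar f S r lam x * (condMean S κ g (S.restrict x) - thetaBar f S r lam g) := by
  unfold stepBar condMean
  rw [integral_sub _ (integrable_const _)]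
  · simp
  · exact integrable_of_bound (hg.comp (measurable_glue_right S _)) (b := max |lo| |hi|) fun z =>
      abs_le_max_abs_abs (hr _).1 (hr _).2

theorem mul_mem_Icc_of_zero_mem {w t : ℝ} (hw : w ∈ Set.Icc (0 : ℝ) 1) (ht : t ∈ Set.Icc lo hi)
    (h0 : (0 : ℝ) ∈ Set.Icc lo hi) : w * t ∈ Set.Icc lo hi := by
  constructor <;> nlinarith [hw.1, hw.2, ht.1, ht.2, h0.1, h0.2]

theorem sub_mem_Icc_sub {t θ : ℝ} (ht : t ∈ Set.Icc lo hi) :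
    t - θ ∈ Set.Icc (lo - θ) (hi - θ) := ⟨by linarith [ht.1], by linarith [ht.2]⟩

/-- The population step does not increase the length of the range. -/
theorem stepBar_mem_Icc (hf : IsDensity f) (hlam : 0 < lam) (hc : 0 < c)
    (hm : Measurable (rBar f S r)) (hb : ∀ u, c ≤ rBar f S r u) [IsMarkovKernel κ]
    (hg : Measurable g) (hr : ∀ x, g x ∈ Set.Icc lo hi) (x : Pt d) :
    stepBar f S r lam κ g x
      ∈ Set.Icc (lo - thetaBar f S r lam g) (hi - thetaBar f S r lam g) := by
  have hθ := thetaBar_mem_Icc (lam := lam) hf hlam hc hm hb hg hr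
  rw [stepBar_eq hg hr]
  refine mul_mem_Icc_of_zero_mem (wBar_mem_Icc hlam hc hb x)
    (sub_mem_Icc_sub (condMean_mem_Icc hg hr _)) ?_
  constructor <;> linarith [hθ.1, hθ.2]

/-- Product rule for weight times centred conditional mean. As the weight is at most one, `L` is not
multiplied, and the increment involves only the length of the range. -/
theorem LocHolder.stepBar (hf : IsDensity f) (hlam : 0 < lam) (hc : 0 < c)
    (hb : ∀ u, c ≤ rBar f S r u) [IsMarkovKernel κ] {β L L₂ L₃ : ℝ} (hβ : 0 < β)
    (hL : 0 ≤ L) (hL₂ : 0 ≤ L₂) (hL₃ : 0 ≤ L₃) (hg : LocHolder g β L)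
    (hr : ∀ x, g x ∈ Set.Icc lo hi)
    (hκ : ∀ u u' : S → ℝ, ‖u - u'‖ ≤ 1 → tvDist (κ u) (κ u') ≤ L₂ * ‖u - u'‖ ^ β)
    (hs : LocHolder (rBar f S r) β L₃) :
    LocHolder (IncompleteData.stepBar f S r lam κ g) β
      (L + (hi - lo) * (L₂ + L₃ / (4 * c))) := by
  intro x x' hx
  have hgm : Measurable g := (hg.continuous hβ).measurable
  have hm : Measurable (rBar f S r) := (hs.continuous hβ).measurable
  have hlh : 0 ≤ hi - lo := by linarith [(hr 0).1, (hr 0).2]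
  have hG := (hg.condMean hβ hL hr hκ).comp_restrict hβ.le
    (add_nonneg hL (mul_nonneg hlh hL₂)) x x' hx
  have hS := hs.comp_restrict hβ.le hL₃ x x' hx
  have hθ := thetaBar_mem_Icc (lam := lam) hf hlam hc hm hb hgm hr
  have hG' := condMean_mem_Icc (κ := κ) hgm hr (S.restrict x')
  rw [stepBar_eq hgm hr, stepBar_eq hgm hr]
  set θ := thetaBar f S r lam g
  have hw := wBar_mem_Icc (lam := lam) hlam hc hb x
  have hww : |wBar f S r lam x - wBar f S r lam x'| ≤ L₃ * ‖x - x'‖ ^ β / (4 * c) :=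
    (abs_weight_sub_weight_le hlam hc (hb _) (hb _)).trans (by gcongr)
  have hGθ : |IncompleteData.condMean S κ g (S.restrict x') - θ| ≤ hi - lo := by
    rw [abs_le]; constructor <;> linarith [hθ.1, hθ.2, hG'.1, hG'.2]
  calc _ = |wBar f S r lam x * (IncompleteData.condMean S κ g (S.restrict x)
            - IncompleteData.condMean S κ g (S.restrict x'))
        + (wBar f S r lam x - wBar f S r lam x')
            * (IncompleteData.condMean S κ g (S.restrict x') - θ)| := by congr 1; ring
    _ ≤ _ := abs_add_le _ _
    _ ≤ 1 * ((L + (hi - lo) * L₂) * ‖x - x'‖ ^ β)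
          + L₃ * ‖x - x'‖ ^ β / (4 * c) * (hi - lo) := by
        rw [abs_mul, abs_mul, abs_of_nonneg hw.1]
        exact add_le_add (mul_le_mul hw.2 hG (abs_nonneg _) zero_le_one)
          (mul_le_mul hww hGθ (abs_nonneg _) ((abs_nonneg _).trans hww))
    _ = _ := by ring

end Population

/-! ### Iterated population functions -/

section Iteration

/-- Range and smoothness of the iterated population functions. -/
theorem aBar_spec {𝕊 : Finset (Finset (Fin d))} {f : Pt d → ℝ} (hf : IsDensity f)
    {κ : ∀ S : Finset (Fin d), Kernel (S → ℝ) (↥Sᶜ → ℝ)} (hκ : ∀ S ∈ 𝕊, IsCondLaw f S (κ S))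
    {r : ∀ S : Finset (Fin d), (S → ℝ) → ℝ} {lam : Finset (Fin d) → ℝ}
    (hlam : ∀ S ∈ 𝕊, 0 < lam S) {a : Pt d → ℝ} {β L₁ L₂ L₃ c a₀ : ℝ} (ha : ∀ x, |a x| ≤ a₀)
    (hβ : 0 < β) (hL₁ : 0 ≤ L₁) (hL₂ : 0 ≤ L₂) (hL₃ : 0 ≤ L₃) (hA1 : LocHolder a β L₁)
    (hA2 : A2 𝕊 κ β L₂) (hA3 : A3 𝕊 f r β L₃) (hc : 0 < c)
    (hb : ∀ S ∈ 𝕊, ∀ u, c ≤ rBar f S (r S) u) (m : ℕ) :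
    ∀ Ss : Fin m → Finset (Fin d), (∀ j, Ss j ∈ 𝕊) →
      (∃ lo hi, (0 : ℝ) ∈ Set.Icc lo hi ∧ hi - lo ≤ 2 * a₀ ∧
        ∀ x, aBar f r lam κ a m Ss x ∈ Set.Icc lo hi) ∧
      LocHolder (aBar f r lam κ a m Ss) β (L₁ + m * (2 * a₀ * (L₂ + L₃ / (4 * c)))) := by
  have ha0 : 0 ≤ a₀ := (abs_nonneg _).trans (ha 0)
  induction m with
  | zero =>
    intro Ss _
    refine ⟨⟨-a₀, a₀, ⟨by linarith, ha0⟩, by linarith, fun x => abs_le.1 (ha x)⟩, ?_⟩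
    simpa using! hA1
  | succ m ih =>
    intro Ss hSs
    obtain ⟨⟨lo, hi, h0, hlh, hr⟩, hH⟩ := ih (fun j => Ss j.castSucc) fun j => hSs _
    set S := Ss (Fin.last m) with hS
    have hS𝕊 : S ∈ 𝕊 := hSs _
    have : IsMarkovKernel (κ S) := (hκ S hS𝕊).1
    have hs : LocHolder (rBar f S (r S)) β L₃ := hA3 S hS𝕊
    have hgm := (hH.continuous hβ).measurable
    have hK : 0 ≤ L₂ + L₃ / (4 * c) := by positivity
    have hθ := thetaBar_mem_Icc (lam := lam S) hf (hlam S hS𝕊) hc (hs.continuous hβ).measurable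
      (hb S hS𝕊) hgm hr
    -- The new range is the old one translated by `-θ`. It keeps its length, and it contains `0`
    -- because `θ` lies in the old range.
    refine ⟨⟨_, _, ?_, ?_, stepBar_mem_Icc (κ := κ S) hf (hlam S hS𝕊) hc
      (hs.continuous hβ).measurable (hb S hS𝕊) hgm hr⟩, ?_⟩
    · constructor <;> linarith [hθ.1, hθ.2]
    · linarith
    · have := hH.stepBar hf (hlam S hS𝕊) hc (hb S hS𝕊) hβ (by positivity) hL₂ hL₃ hr
        (hA2 S hS𝕊) hs
      intro x x' hx
      refine (this x x' hx).trans (mul_le_mul_of_nonneg_right ?_ (by positivity))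
      push_cast
      nlinarith [mul_le_mul_of_nonneg_right hlh hK]

end Iteration

/-! ### The marginal of the uniform kernel -/

section Kernel

theorem norm_glue_le_iff (S : Finset (Fin d)) (u : S → ℝ) (v : ↥Sᶜ → ℝ) {t : ℝ} (ht : 0 ≤ t) :
    ‖glue S u v‖ ≤ t ↔ ‖u‖ ≤ t ∧ ‖v‖ ≤ t := by
  simp only [pi_norm_le_iff_of_nonneg ht, glue]
  constructor
  · intro H
    refine ⟨fun s => ?_, fun s => ?_⟩
    · simpa using H s
    · have := H s
      rwa [dif_neg (Finset.mem_compl.1 s.2)] at this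
  · rintro ⟨h1, h2⟩ j
    split_ifs with hj
    · exact h1 _
    · exact h2 _

open Classical in
-- Marginals of the uniform kernel are again uniform. The value of `k` is irrelevant, since it
-- cancels in the regression quotient.
theorem exists_scaledKernel_eq (S : Finset (Fin d)) {h : ℝ} (hh : 0 < h) :
    ∃ k : ℝ, 0 < k ∧ ∀ u : S → ℝ, scaledKernel S h u = if ‖u‖ ≤ h then k else 0 := by
  set k₁ : ℝ := volume.real (Metric.closedBall (0 : ↥Sᶜ → ℝ) 1) * ((2 : ℝ) ^ d)⁻¹ with hk₁
  have hpos : 0 < k₁ := by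
    refine mul_pos (ENNReal.toReal_pos ?_ ?_) (by positivity)
    · exact (Metric.measure_closedBall_pos volume _ one_pos).ne'
    · exact measure_closedBall_lt_top.ne
  have hmarg : ∀ u : S → ℝ, margKernel S u = if ‖u‖ ≤ 1 then k₁ else 0 := by
    intro u
    unfold margKernel unifKernel
    simp only [norm_glue_le_iff S u _ zero_le_one]
    split_ifs with hu
    · have : (fun v : ↥Sᶜ → ℝ => if ‖u‖ ≤ 1 ∧ ‖v‖ ≤ 1 then ((2 : ℝ) ^ d)⁻¹ else 0)
          = (Metric.closedBall (0 : ↥Sᶜ → ℝ) 1).indicator fun _ => ((2 : ℝ) ^ d)⁻¹ := by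
        ext v
        simp [Set.indicator_apply, hu]
      rw [this, integral_indicator_const _ measurableSet_closedBall, smul_eq_mul]
    · simp [hu]
  refine ⟨(h ^ S.card)⁻¹ * k₁, by positivity, fun u => ?_⟩
  have hiff : ‖h⁻¹ • u‖ ≤ 1 ↔ ‖u‖ ≤ h := by
    rw [norm_smul, norm_inv, Real.norm_of_nonneg hh.le, inv_mul_le_iff₀ hh, mul_one]
  unfold scaledKernel
  rw [hmarg, mul_ite, mul_zero]
  simp only [hiff]

end Kernel

/-! ### The empirical step: neighbour form, locality, measurability -/

section Step

open Classical in
theorem stepHat_eq (S : Finset (Fin d)) (r : (S → ℝ) → ℝ) (lam T : ℝ) {h : ℝ} (hh : 0 < h)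
    (D : Finset (Fin n)) (z : Fin n → Pt d) (g : Pt d → ℝ) (x : Pt d) :
    stepHat S r lam T h D z g x = if ‖S.restrict x‖ ≤ T then
      wHat S r lam D z x *
        ((∑ i ∈ D, near S h x (z i) * trunc T g (z i)) / count S h D z x
          - (∑ i ∈ D, wHat S r lam D z (z i) * trunc T g (z i)) / ∑ i ∈ D, wHat S r lam D z (z i))
      else 0 := by
  obtain ⟨k, hk, hK⟩ := exists_scaledKernel_eq S hh
  have hn : ∀ i, scaledKernel S h (S.restrict x - S.restrict (z i)) = k * near S h x (z i) := by
    intro i; rw [hK, near, mul_ite, mul_one, mul_zero]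
  have hmain : (D.card : ℝ)⁻¹ * ∑ i ∈ D, trunc T g (z i) *
      (scaledKernel S h (S.restrict x - S.restrict (z i)) / fHat S h D z (S.restrict x))
      = (∑ i ∈ D, near S h x (z i) * trunc T g (z i)) / count S h D z x := by
    rcases D.eq_empty_or_nonempty with h0 | h0
    · simp [h0]
    have hN : (D.card : ℝ) ≠ 0 := by exact_mod_cast h0.card_pos.ne'
    have hf : fHat S h D z (S.restrict x) = (D.card : ℝ)⁻¹ * (k * count S h D z x) := by
      unfold fHat count
      simp_rw [hn, Finset.mul_sum]
    rw [hf, Finset.mul_sum, Finset.sum_div]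
    refine Finset.sum_congr rfl fun i _ => ?_
    rw [hn]
    rcases eq_or_ne (count S h D z x) 0 with h1 | h1
    · simp [h1]
    · field_simp
  unfold stepHat
  rw [hmain]

theorem rHat_congr (S : Finset (Fin d)) (r : (S → ℝ) → ℝ) {D : Finset (Fin n)}
    {z z' : Fin n → Pt d} (hz : ∀ i ∈ D, z i = z' i) : rHat S r D z = rHat S r D z' := by
  unfold rHat
  rw [Finset.sum_congr rfl fun i hi => by rw [hz i hi]]

theorem stepHat_congr (S : Finset (Fin d)) (r : (S → ℝ) → ℝ) (lam T h : ℝ) {D : Finset (Fin n)}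
    {z z' : Fin n → Pt d} (g : Pt d → ℝ) (hz : ∀ i ∈ D, z i = z' i) :
    stepHat S r lam T h D z g = stepHat S r lam T h D z' g := by
  ext x
  have hw : ∀ y, wHat S r lam D z y = wHat S r lam D z' y := fun y => by
    unfold wHat; rw [rHat_congr S r hz]
  have hf : ∀ u, fHat S h D z u = fHat S h D z' u := fun u => by
    unfold fHat
    rw [Finset.sum_congr rfl fun i hi => by rw [hz i hi]]
  unfold stepHat
  simp only [hw, hf]
  have h1 : ∀ F : Pt d → ℝ, ∑ i ∈ D, F (z i) = ∑ i ∈ D, F (z' i) := fun F =>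
    Finset.sum_congr rfl fun i hi => by rw [hz i hi]
  rw [h1 fun y => trunc T g y * (scaledKernel S h (S.restrict x - S.restrict y)
    / fHat S h D z' (S.restrict x)), h1 fun y => wHat S r lam D z' y * trunc T g y,
    h1 (wHat S r lam D z')]

/-- Iterate `m` reads the first `m` pieces only, hence it is not affected by redrawing points of
piece `m + 1`. -/
theorem aHat_congr (r : ∀ S : Finset (Fin d), (S → ℝ) → ℝ) (lam : Finset (Fin d) → ℝ) (T h : ℝ)
    (D : ℕ → Finset (Fin n)) (a : Pt d → ℝ) {z z' : Fin n → Pt d} (m : ℕ)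
    (hz : ∀ k ∈ Finset.Icc 1 m, ∀ i ∈ D k, z i = z' i) :
    ∀ Ss : Fin m → Finset (Fin d), aHat r lam T h D z a m Ss = aHat r lam T h D z' a m Ss := by
  induction m with
  | zero => intro Ss; rfl
  | succ m ih =>
    intro Ss
    have := ih (fun k hk => hz k (by
      rw [Finset.mem_Icc] at hk ⊢; omega)) fun j => Ss j.castSucc
    simp only [aHat]
    rw [this]
    exact stepHat_congr _ _ _ _ _ _ (hz (m + 1) (by rw [Finset.mem_Icc]; omega))

/-- The empirical weight is invariant under scaling of `r`, so the analysis may use the normalised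
shift, whose mean is one. -/
theorem wHat_eq_wHat_rBar {f : Pt d → ℝ} {S : Finset (Fin d)} {r : (S → ℝ) → ℝ}
    (hI : ∫ x, r (S.restrict x) ∂(law f) ≠ 0) (lam : ℝ) (D : Finset (Fin n)) (z : Fin n → Pt d) :
    wHat S r lam D z = wHat S (rBar f S r) lam D z := by
  ext x
  set I := ∫ x, r (S.restrict x) ∂(law f) with hIdef
  have hr : ∀ u, r u = I * rBar f S r u := fun u => by
    unfold rBar; rw [← hIdef]; field_simp
  have hR : rHat S r D z = I * rHat S (rBar f S r) D z := by
    unfold rHat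
    rw [Finset.sum_congr rfl fun i _ => hr _, ← Finset.mul_sum]; ring
  unfold wHat
  rw [hR, hr (S.restrict x), show lam * (I * rBar f S r (S.restrict x))
    = I * (lam * rBar f S r (S.restrict x)) by ring, ← mul_add, mul_div_mul_left _ _ hI]

theorem stepHat_eq_stepHat_rBar {f : Pt d → ℝ} {S : Finset (Fin d)} {r : (S → ℝ) → ℝ}
    (hI : ∫ x, r (S.restrict x) ∂(law f) ≠ 0) (lam T h : ℝ) (D : Finset (Fin n))
    (z : Fin n → Pt d) (g : Pt d → ℝ) :
    stepHat S r lam T h D z g = stepHat S (rBar f S r) lam T h D z g := by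
  unfold stepHat
  rw [wHat_eq_wHat_rBar hI]

theorem trunc_measurable {T : ℝ} {φ : (Fin n → Pt d) → Pt d → ℝ}
    (hφ : Measurable fun p : Pt d × (Fin n → Pt d) => φ p.2 p.1) :
    Measurable fun p : Pt d × (Fin n → Pt d) => trunc T (φ p.2) p.1 :=
  Measurable.ite (measurableSet_le measurable_fst.norm measurable_const) hφ measurable_const

theorem stepHat_measurable (S : Finset (Fin d)) {r : (S → ℝ) → ℝ} (hr : Measurable r)
    (lam T : ℝ) {h : ℝ} (hh : 0 < h) (D : Finset (Fin n)) {φ : (Fin n → Pt d) → Pt d → ℝ}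
    (hφ : Measurable fun p : Pt d × (Fin n → Pt d) => φ p.2 p.1) :
    Measurable fun p : Pt d × (Fin n → Pt d) => stepHat S r lam T h D p.2 (φ p.2) p.1 := by
  classical
  have hev : ∀ i : Fin n, Measurable fun p : Pt d × (Fin n → Pt d) => p.2 i := fun i =>
    (measurable_pi_apply i).comp measurable_snd
  have hrH : Measurable fun p : Pt d × (Fin n → Pt d) => rHat S r D p.2 :=
    (Finset.measurable_fun_sum _ fun i _ =>
      hr.comp ((measurable_restrict S).comp (hev i))).const_mul _
  have hw : Measurable fun p : Pt d × (Fin n → Pt d) => wHat S r lam D p.2 p.1 := by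
    have h1 : Measurable fun p : Pt d × (Fin n → Pt d) => lam * r (S.restrict p.1) :=
      (hr.comp ((measurable_restrict S).comp measurable_fst)).const_mul lam
    exact h1.div (hrH.add h1)
  have hsw : ∀ i : Fin n, Measurable fun p : Pt d × (Fin n → Pt d) => (p.2 i, p.2) := fun i =>
    (hev i).prodMk measurable_snd
  have hwi : ∀ i : Fin n, Measurable fun p : Pt d × (Fin n → Pt d) => wHat S r lam D p.2 (p.2 i) :=
    fun i => hw.comp (hsw i)
  have hti : ∀ i : Fin n, Measurable fun p : Pt d × (Fin n → Pt d) => trunc T (φ p.2) (p.2 i) :=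
    fun i => (trunc_measurable hφ).comp (hsw i)
  simp only [stepHat_eq S r lam T hh]
  refine Measurable.ite (measurableSet_le ((measurable_restrict S).comp measurable_fst).norm
    measurable_const) ?_ measurable_const
  refine hw.mul (Measurable.sub ?_ ?_)
  · exact (Finset.measurable_fun_sum _ fun i _ => (near_measurable S h measurable_fst (hev i)).mul
      (hti i)).div (count_measurable S h D measurable_fst measurable_snd)
  · exact (Finset.measurable_fun_sum _ fun i _ => (hwi i).mul (hti i)).div
      (Finset.measurable_fun_sum _ fun i _ => hwi i)

theorem aHat_measurable {𝕊 : Finset (Finset (Fin d))} {r : ∀ S : Finset (Fin d), (S → ℝ) → ℝ}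
    (hr : ∀ S ∈ 𝕊, Measurable (r S)) (lam : Finset (Fin d) → ℝ) (T : ℝ) {h : ℝ} (hh : 0 < h)
    (D : ℕ → Finset (Fin n)) {a : Pt d → ℝ} (ha : Measurable a) (m : ℕ) :
    ∀ Ss : Fin m → Finset (Fin d), (∀ j, Ss j ∈ 𝕊) →
      Measurable fun p : Pt d × (Fin n → Pt d) => aHat r lam T h D p.2 a m Ss p.1 := by
  induction m with
  | zero => intro Ss _; exact ha.comp measurable_fst
  | succ m ih =>
    intro Ss hSs
    have := stepHat_measurable _ (hr _ (hSs (Fin.last m))) (lam (Ss (Fin.last m))) T hh (D (m + 1))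
      (φ := fun z => aHat r lam T h D z a m fun j => Ss j.castSucc)
      (ih (fun j => Ss j.castSucc) fun j => hSs _)
    simpa only [aHat] using this

end Step

/-! ### Deterministic error decomposition of one step -/

section Error

/-- Centre `y` at its `q`-average: the `q`-sum vanishes, and only `(p - q)` times a deviation of
size `hi - lo` remains. -/
theorem abs_wavg_sub_wavg_le {ι : Type*} (I : Finset ι) (p q y : ι → ℝ) {lo hi ε : ℝ}
    (hq : ∀ i ∈ I, 0 ≤ q i) (hP : 0 < ∑ i ∈ I, p i)
    (hQ : 0 < ∑ i ∈ I, q i) (hpq : ∀ i ∈ I, |p i - q i| ≤ p i * ε)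
    (hy : ∀ i ∈ I, y i ∈ Set.Icc lo hi) (h0 : (0 : ℝ) ∈ Set.Icc lo hi) :
    |(∑ i ∈ I, p i * y i) / ∑ i ∈ I, p i - (∑ i ∈ I, q i * y i) / ∑ i ∈ I, q i|
      ≤ (hi - lo) * ε := by
  have hm := sum_mul_div_mem_Icc I q y hq hy h0
  set m := (∑ i ∈ I, q i * y i) / ∑ i ∈ I, q i with hmdef
  have hq0 : ∑ i ∈ I, q i * (y i - m) = 0 := by
    simp only [mul_sub, Finset.sum_sub_distrib, ← Finset.sum_mul]
    rw [hmdef, mul_div_cancel₀ _ hQ.ne', sub_self]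
  have e : (∑ i ∈ I, p i * y i) / ∑ i ∈ I, p i - m
      = (∑ i ∈ I, (p i - q i) * (y i - m)) / ∑ i ∈ I, p i := by
    have : ∑ i ∈ I, (p i - q i) * (y i - m) = ∑ i ∈ I, p i * y i - (∑ i ∈ I, p i) * m := by
      simp only [sub_mul (p _), Finset.sum_sub_distrib, hq0, sub_zero]
      simp only [mul_sub, Finset.sum_sub_distrib, ← Finset.sum_mul]
    rw [this]
    field_simp
  rw [e, abs_div, abs_of_pos hP, div_le_iff₀ hP]
  calc _ ≤ ∑ i ∈ I, |(p i - q i) * (y i - m)| := Finset.abs_sum_le_sum_abs _ _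
    _ ≤ ∑ i ∈ I, p i * ε * (hi - lo) := by
        refine Finset.sum_le_sum fun i hi' => ?_
        rw [abs_mul]
        have := hy i hi'
        refine mul_le_mul (hpq i hi') ?_ (abs_nonneg _) ((abs_nonneg _).trans (hpq i hi'))
        rw [abs_le]; constructor <;> linarith [this.1, this.2, hm.1, hm.2]
    _ = _ := by rw [← Finset.sum_mul, ← Finset.sum_mul]; ring

/-- Jensen's inequality, after which comparability of the weights bounds each normalised weight by
`Λ / |I|`. -/
theorem sq_wavg_le {ι : Type*} (I : Finset ι) (p e : ι → ℝ) {Λ : ℝ} (hp : ∀ i ∈ I, 0 ≤ p i)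
    (hP : 0 < ∑ i ∈ I, p i) (hΛ : ∀ i ∈ I, ∀ j ∈ I, p i ≤ Λ * p j) :
    ((∑ i ∈ I, p i * e i) / ∑ i ∈ I, p i) ^ 2 ≤ Λ * ((I.card : ℝ)⁻¹ * ∑ i ∈ I, e i ^ 2) := by
  refine (sq_sum_mul_div_le I p e hp).trans ?_
  have hI : I.Nonempty := by
    rw [Finset.nonempty_iff_ne_empty]; rintro rfl; simp at hP
  have hN : (0 : ℝ) < I.card := by exact_mod_cast hI.card_pos
  rw [div_le_iff₀ hP, show Λ * ((I.card : ℝ)⁻¹ * ∑ i ∈ I, e i ^ 2) * ∑ i ∈ I, p i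
    = ((I.card : ℝ)⁻¹ * (Λ * ∑ j ∈ I, p j)) * ∑ i ∈ I, e i ^ 2 by ring, Finset.mul_sum]
  refine Finset.sum_le_sum fun i hi => ?_
  have h1 : (I.card : ℝ) * p i ≤ Λ * ∑ j ∈ I, p j := by
    rw [Finset.mul_sum, ← nsmul_eq_mul, ← Finset.sum_const]
    exact Finset.sum_le_sum fun j hj => hΛ i hi j hj
  have h2 : p i ≤ (I.card : ℝ)⁻¹ * (Λ * ∑ j ∈ I, p j) := by
    rw [le_inv_mul_iff₀ hN]; exact h1
  exact mul_le_mul_of_nonneg_right h2 (sq_nonneg _)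

/-- Only the propagated terms `t₁`, `t₂` are iterated, so they get the small factor `3` of a
three-term split. The remainder has four terms once `r₁ - r₀` is merged by `h`, whence `12 = 3 * 4`.
-/
theorem sq_error_le {w t₁ t₂ r₁ r₀ r₂ r₄ δ : ℝ} (hw : w ∈ Set.Icc (0 : ℝ) 1) (h : r₁ * r₀ = 0) :
    (w * (t₁ - t₂ + r₁ + r₂ - r₀ - r₄) + δ) ^ 2
      ≤ 3 * t₁ ^ 2 + 3 * t₂ ^ 2 + 12 * (r₁ ^ 2 + r₀ ^ 2 + r₂ ^ 2 + r₄ ^ 2 + δ ^ 2) := by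
  have hw2 : w ^ 2 ≤ 1 := pow_le_one₀ hw.1 hw.2
  have h1 : (w * (t₁ - t₂ + r₁ + r₂ - r₀ - r₄) + δ) ^ 2
      ≤ 3 * (w * t₁) ^ 2 + 3 * (w * t₂) ^ 2
        + 12 * ((w * (r₁ - r₀)) ^ 2 + (w * r₂) ^ 2 + (w * r₄) ^ 2 + δ ^ 2) := by
    set A := w * t₁
    set B := w * t₂
    set F := w * (r₁ - r₀) with hF
    set G := w * r₂
    set H := w * r₄
    have e : w * (t₁ - t₂ + r₁ + r₂ - r₀ - r₄) + δ = A - B + (F + G - H + δ) := by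
      simp only [A, B, F, G, H]; ring
    rw [e]
    have h2 : (F + G - H + δ) ^ 2 ≤ 4 * (F ^ 2 + G ^ 2 + H ^ 2 + δ ^ 2) := by
      nlinarith [sq_nonneg (F - G), sq_nonneg (F + H), sq_nonneg (F - δ), sq_nonneg (G + H),
        sq_nonneg (G - δ), sq_nonneg (H + δ)]
    nlinarith [sq_nonneg (A + B), sq_nonneg (A - (F + G - H + δ)),
      sq_nonneg (B + (F + G - H + δ))]
  have h3 : (r₁ - r₀) ^ 2 = r₁ ^ 2 + r₀ ^ 2 := by linear_combination (-2) * h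
  have hs : ∀ t : ℝ, (w * t) ^ 2 ≤ t ^ 2 := fun t => by
    rw [mul_pow]; exact mul_le_of_le_one_left (sq_nonneg _) hw2
  have := hs t₁; have := hs t₂; have := hs (r₁ - r₀); have := hs r₂; have := hs r₄
  linarith

open Classical in
/-- The squared error of one regression step, split into the propagated error, the fluctuations
of the averages and of the weights, and the bias. -/
theorem sq_stepHat_sub_le {S : Finset (Fin d)} {s : (S → ℝ) → ℝ} {lam T h c C : ℝ}
    {D : Finset (Fin n)} (hD : D.Nonempty) (z : Fin n → Pt d) (hc : 0 < c)
    (hs : ∀ u, c ≤ s u ∧ s u ≤ C) (hlam : 0 < lam) (hh : 0 < h)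
    {g gh : Pt d → ℝ} {G : (S → ℝ) → ℝ} {θ lo hi V b : ℝ} (h0 : (0 : ℝ) ∈ Set.Icc lo hi)
    (hV : hi - lo ≤ V) (hg : ∀ x, g x ∈ Set.Icc lo hi) (hG : ∀ u, G u ∈ Set.Icc lo hi)
    (hθ : θ ∈ Set.Icc lo hi) (hb : ∀ u u' : S → ℝ, ‖u - u'‖ ≤ h → |G u - G u'| ≤ b)
    {x : Pt d} (hx : ‖S.restrict x‖ ≤ T) :
    (stepHat S s lam T h D z gh x
        - lam * s (S.restrict x) / (1 + lam * s (S.restrict x)) * (G (S.restrict x) - θ)) ^ 2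
      ≤ 3 * ((∑ i ∈ D, near S h x (z i) * (trunc T gh (z i) - g (z i)) ^ 2) / count S h D z x)
        + 3 * (C / c * ((D.card : ℝ)⁻¹ * ∑ i ∈ D, (trunc T gh (z i) - g (z i)) ^ 2))
        + 12 * ((∑ i ∈ D, near S h x (z i) / count S h D z x
              * (g (z i) - G (S.restrict (z i)))) ^ 2
            + (if count S h D z x = 0 then V ^ 2 else 0) + b ^ 2
            + ((∑ i ∈ D, lam * s (S.restrict (z i)) / (1 + lam * s (S.restrict (z i)))
                * (g (z i) - θ))
              / ∑ i ∈ D, lam * s (S.restrict (z i)) / (1 + lam * s (S.restrict (z i)))) ^ 2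
            + 4 * V ^ 2 * (1 - rHat S s D z) ^ 2) := by
  have hs0 : ∀ u, 0 < s u := fun u => hc.trans_le (hs u).1
  have hN : (0 : ℝ) < D.card := by exact_mod_cast hD.card_pos
  have hb0 : 0 ≤ b := (abs_nonneg _).trans (hb 0 0 (by simpa using hh.le))
  set ρ := rHat S s D z with hρdef
  have hρ : 0 < ρ := by
    rw [hρdef, rHat]
    exact mul_pos (inv_pos.2 hN) (Finset.sum_pos (fun i _ => hs0 _) hD)
  set wh := wHat S s lam D z with hwh
  have hwhe : ∀ y, wh y = lam * s (S.restrict y) / (ρ + lam * s (S.restrict y)) := fun y => rfl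
  set w : Pt d → ℝ := fun y => lam * s (S.restrict y) / (1 + lam * s (S.restrict y)) with hw
  have hwh01 : ∀ y, wh y ∈ Set.Icc (0 : ℝ) 1 := fun y =>
    ⟨weight_nonneg hlam hρ (hs0 _), weight_le_one hlam hρ (hs0 _)⟩
  have hwhpos : ∀ y, 0 < wh y := fun y => by
    rw [hwhe]; have := hs0 (S.restrict y); positivity
  have hwpos : ∀ y, 0 < w y := fun y => by
    have := hs0 (S.restrict y); simp only [hw]; positivity
  have hP : 0 < ∑ i ∈ D, wh (z i) := Finset.sum_pos (fun i _ => hwhpos _) hD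
  have hQ : 0 < ∑ i ∈ D, w (z i) := Finset.sum_pos (fun i _ => hwpos _) hD
  have hdw : ∀ y, |wh y - w y| ≤ wh y * |1 - ρ| := fun y => abs_weight_sub_le hlam hρ (hs0 _)
  set N := count S h D z x with hNdef
  set gt := trunc T gh with hgt
  -- `t₁`, `t₂` carry the previous error through the local average and the centring; `r₁` is the
  -- local noise, `r₂` the smoothing bias, `r₄` the noise of the centring with population weights,
  -- and `δ₁` the effect of empirical weights there. On an empty neighbourhood the quotient is `0`,
  -- so the whole of `G` is lost: this is `r₀`.
  set t₁ := (∑ i ∈ D, near S h x (z i) * (gt (z i) - g (z i))) / N with ht₁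
  set t₂ := (∑ i ∈ D, wh (z i) * (gt (z i) - g (z i))) / ∑ i ∈ D, wh (z i) with ht₂
  set r₁ := ∑ i ∈ D, near S h x (z i) / N * (g (z i) - G (S.restrict (z i))) with hr₁
  set r₂ := ∑ i ∈ D, near S h x (z i) / N * (G (S.restrict (z i)) - G (S.restrict x)) with hr₂
  set r₀ : ℝ := if N = 0 then G (S.restrict x) else 0 with hr₀
  set r₄ := (∑ i ∈ D, w (z i) * (g (z i) - θ)) / ∑ i ∈ D, w (z i) with hr₄
  set δ₁ := (∑ i ∈ D, wh (z i) * (g (z i) - θ)) / ∑ i ∈ D, wh (z i) - r₄ with hδ₁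
  have hV0 : 0 ≤ V := by linarith [h0.1, h0.2]
  have hδ₁b : |δ₁| ≤ V * |1 - ρ| := by
    refine (abs_wavg_sub_wavg_le D (fun i => wh (z i)) (fun i => w (z i)) (fun i => g (z i) - θ)
      (fun i _ => (hwpos _).le) hP hQ (fun i _ => hdw _)
      (fun i _ => sub_mem_Icc_sub (hg _)) ⟨by linarith [hθ.1], by linarith [hθ.2]⟩).trans ?_
    exact mul_le_mul_of_nonneg_right (by linarith) (abs_nonneg _)
  have hNW : (∑ i ∈ D, near S h x (z i) * gt (z i)) / N - G (S.restrict x)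
      = t₁ + r₁ + r₂ - r₀ := by
    by_cases h1 : N = 0
    · simp [ht₁, hr₁, hr₂, hr₀, h1]
    · rw [ht₁, hr₁, hr₂, hr₀, if_neg h1, sub_zero, Finset.sum_div, Finset.sum_div, ← Finset.sum_add_distrib,
        ← Finset.sum_add_distrib]
      have hone : ∑ i ∈ D, near S h x (z i) / N = 1 := by
        rw [← Finset.sum_div]; exact div_self h1
      rw [sub_eq_iff_eq_add]
      nth_rewrite 2 [← one_mul (G (S.restrict x))]
      rw [← hone, Finset.sum_mul, ← Finset.sum_add_distrib]
      exact Finset.sum_congr rfl fun i _ => by ring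
  have hθh : (∑ i ∈ D, wh (z i) * gt (z i)) / ∑ i ∈ D, wh (z i) - θ = t₂ + r₄ + δ₁ := by
    have : t₂ + r₄ + δ₁ = (∑ i ∈ D, wh (z i) * (gt (z i) - g (z i))) / ∑ i ∈ D, wh (z i)
        + (∑ i ∈ D, wh (z i) * (g (z i) - θ)) / ∑ i ∈ D, wh (z i) := by
      rw [hδ₁, ht₂]; ring
    rw [this, ← add_div, ← Finset.sum_add_distrib, eq_div_iff hP.ne', sub_mul,
      div_mul_cancel₀ _ hP.ne', Finset.mul_sum, ← Finset.sum_sub_distrib]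
    exact Finset.sum_congr rfl fun i _ => by ring
  set δ := -(wh x * δ₁) + (wh x - w x) * (G (S.restrict x) - θ) with hδ
  have herr : stepHat S s lam T h D z gh x - w x * (G (S.restrict x) - θ)
      = wh x * (t₁ - t₂ + r₁ + r₂ - r₀ - r₄) + δ := by
    rw [stepHat_eq S s lam T hh, if_pos hx, hδ]
    linear_combination wh x * hNW - wh x * hθh
  have hGθ : |G (S.restrict x) - θ| ≤ V := by
    have := hG (S.restrict x)
    rw [abs_le]; constructor <;> linarith [this.1, this.2, hθ.1, hθ.2]
  -- The normalisation error enters twice: through the centring and through the prefactor.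
  have hδb : |δ| ≤ 2 * V * |1 - ρ| := by
    have e1 : |wh x * δ₁| ≤ V * |1 - ρ| := by
      rw [abs_mul, abs_of_nonneg (hwh01 x).1]
      exact (mul_le_of_le_one_left (abs_nonneg _) (hwh01 x).2).trans hδ₁b
    have e2 : |(wh x - w x) * (G (S.restrict x) - θ)| ≤ |1 - ρ| * V := by
      rw [abs_mul]
      exact mul_le_mul ((hdw x).trans (mul_le_of_le_one_left (abs_nonneg _) (hwh01 x).2)) hGθ
        (abs_nonneg _) (abs_nonneg _)
    calc |δ| ≤ |-(wh x * δ₁)| + |(wh x - w x) * (G (S.restrict x) - θ)| := abs_add_le _ _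
      _ ≤ _ := by rw [abs_neg]; linarith
  have hδ2 : δ ^ 2 ≤ 4 * V ^ 2 * (1 - ρ) ^ 2 := by
    rw [← sq_abs δ, ← sq_abs (1 - ρ)]
    calc |δ| ^ 2 ≤ (2 * V * |1 - ρ|) ^ 2 := pow_le_pow_left₀ (abs_nonneg _) hδb 2
      _ = _ := by ring
  have h10 : r₁ * r₀ = 0 := by
    by_cases h1 : N = 0
    · simp [hr₁, h1]
    · simp [hr₀, h1]
  have hr₀2 : r₀ ^ 2 ≤ if N = 0 then V ^ 2 else 0 := by
    rw [hr₀]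
    split_ifs
    · have := hG (S.restrict x)
      rw [← sq_abs]
      refine pow_le_pow_left₀ (abs_nonneg _) ?_ 2
      rw [abs_le]; constructor <;> linarith [this.1, this.2, h0.1, h0.2]
    · simp
  have hr₂2 : r₂ ^ 2 ≤ b ^ 2 := by
    rw [← sq_abs]
    refine pow_le_pow_left₀ (abs_nonneg _) ?_ 2
    have hN0 : 0 ≤ N := count_nonneg _ _ _ _ _
    calc |r₂| ≤ ∑ i ∈ D, |near S h x (z i) / N * (G (S.restrict (z i)) - G (S.restrict x))| :=
          Finset.abs_sum_le_sum_abs _ _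
      _ ≤ ∑ i ∈ D, near S h x (z i) / N * b := by
          refine Finset.sum_le_sum fun i _ => ?_
          rw [abs_mul, abs_of_nonneg (div_nonneg (near_nonneg _ _ _ _) hN0)]
          by_cases h1 : ‖S.restrict x - S.restrict (z i)‖ ≤ h
          · refine mul_le_mul_of_nonneg_left (hb _ _ ?_) (div_nonneg (near_nonneg _ _ _ _) hN0)
            rwa [norm_sub_rev]
          · have : near S h x (z i) = 0 := if_neg h1
            simp [this]
      _ = N / N * b := by rw [← Finset.sum_mul, ← Finset.sum_div]; rfl
      _ ≤ 1 * b := mul_le_mul_of_nonneg_right (div_self_le_one _) hb0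
      _ = b := one_mul b
  have ht₁2 := sq_sum_mul_div_le D (fun i => near S h x (z i)) (fun i => gt (z i) - g (z i))
    fun i _ => near_nonneg _ _ _ _
  have ht₂2 := sq_wavg_le D (fun i => wh (z i)) (fun i => gt (z i) - g (z i)) (Λ := C / c)
    (fun i _ => (hwhpos _).le) hP fun i _ j _ =>
      weight_le_mul_weight hlam hρ hc (hs _).1 (hs _).2 (hs _).1
  have hmain := sq_error_le (t₁ := t₁) (t₂ := t₂) (r₂ := r₂) (r₄ := r₄) (δ := δ) (hwh01 x) h10
  rw [← herr] at hmain
  refine hmain.trans ?_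
  have e1 : t₁ ^ 2 ≤ (∑ i ∈ D, near S h x (z i) * (gt (z i) - g (z i)) ^ 2) / N := ht₁2
  have e2 : t₂ ^ 2 ≤ C / c * ((D.card : ℝ)⁻¹ * ∑ i ∈ D, (gt (z i) - g (z i)) ^ 2) := ht₂2
  linarith

end Error

/-! ### Calculus of bounds in mean -/

section MeanLE

variable {Ω : Type*} [MeasurableSpace Ω] {ν : Measure Ω} {F G : Ω → ℝ} {x y : ℝ}

/-- `F` is measurable and the integral of its positive part is at most `x`. -/
structure MeanLE (ν : Measure Ω) (F : Ω → ℝ) (x : ℝ) : Prop where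
  measurable : Measurable F
  nonneg : 0 ≤ x
  le : ∫⁻ ω, ENNReal.ofReal (F ω) ∂ν ≤ ENNReal.ofReal x

theorem MeanLE.add (hF : MeanLE ν F x) (hG : MeanLE ν G y) :
    MeanLE ν (fun ω => F ω + G ω) (x + y) := by
  refine ⟨hF.measurable.add hG.measurable, add_nonneg hF.nonneg hG.nonneg, ?_⟩
  rw [ENNReal.ofReal_add hF.nonneg hG.nonneg]
  calc _ ≤ ∫⁻ ω, (ENNReal.ofReal (F ω) + ENNReal.ofReal (G ω)) ∂ν :=
        lintegral_mono fun ω => ENNReal.ofReal_add_le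
    _ = _ := lintegral_add_left hF.measurable.ennreal_ofReal _
    _ ≤ _ := add_le_add hF.le hG.le

theorem MeanLE.const_mul (hF : MeanLE ν F x) {k : ℝ} (hk : 0 ≤ k) :
    MeanLE ν (fun ω => k * F ω) (k * x) := by
  refine ⟨hF.measurable.const_mul k, mul_nonneg hk hF.nonneg, ?_⟩
  simp_rw [ENNReal.ofReal_mul hk]
  rw [lintegral_const_mul' _ _ ENNReal.ofReal_ne_top]
  gcongr
  exact hF.le

theorem MeanLE.sum {ι : Type*} (I : Finset ι) {F : ι → Ω → ℝ} {x : ι → ℝ}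
    (hF : ∀ i ∈ I, MeanLE ν (F i) (x i)) :
    MeanLE ν (fun ω => ∑ i ∈ I, F i ω) (∑ i ∈ I, x i) := by
  classical
  induction I using Finset.induction_on with
  | empty => exact ⟨by simp, by simp, by simp⟩
  | insert i I hi ih =>
    simp only [Finset.sum_insert hi]
    exact (hF i (Finset.mem_insert_self i I)).add
      (ih fun j hj => hF j (Finset.mem_insert_of_mem hj))

theorem MeanLE.const [IsProbabilityMeasure ν] (hx : 0 ≤ x) : MeanLE ν (fun _ => x) x :=
  ⟨measurable_const, hx, by simp⟩

theorem MeanLE.mono (hF : MeanLE ν F x) (hG : Measurable G) (hGF : ∀ ω, G ω ≤ F ω) (hxy : x ≤ y) :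
    MeanLE ν G y :=
  ⟨hG, hF.nonneg.trans hxy, (lintegral_mono fun ω => ENNReal.ofReal_le_ofReal (hGF ω)).trans
    (hF.le.trans (ENNReal.ofReal_le_ofReal hxy))⟩

end MeanLE

/-! ### Fluctuations of averages over a piece -/

section Fluctuation

variable (μ : Measure (Pt d)) [IsProbabilityMeasure μ]

theorem measurable_sample (i : Fin n) : Measurable fun p : Pt d × (Fin n → Pt d) => p.2 i :=
  (measurable_pi_apply i).comp measurable_snd

theorem MeanLE.sq_sum_centred {ζ : Pt d → ℝ} (hζm : Measurable ζ) {B : ℝ} (hζb : ∀ x, |ζ x| ≤ B)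
    (hζ : ∫ y, ζ y ∂μ = 0) {v : ℝ} (hv : ∫ y, ζ y ^ 2 ∂μ ≤ v) (D : Finset (Fin n)) :
    MeanLE (μ.prod (Measure.pi fun _ : Fin n => μ)) (fun p => (∑ i ∈ D, ζ (p.2 i)) ^ 2)
      (D.card * v) := by
  have hv0 : 0 ≤ v := (integral_nonneg fun _ => sq_nonneg _).trans hv
  have hm : Measurable fun z : Fin n → Pt d => (∑ i ∈ D, ζ (z i)) ^ 2 :=
    (Finset.measurable_fun_sum _ fun i _ => hζm.comp (measurable_pi_apply i)).pow_const 2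
  refine ⟨hm.comp measurable_snd, by positivity, ?_⟩
  have h1 := (measurePreserving_snd (μ := μ) (ν := Measure.pi fun _ : Fin n => μ)).lintegral_comp
    hm.ennreal_ofReal
  rw [h1, ← ofReal_integral_eq_lintegral_ofReal, integral_sq_sum_centred μ hζm hζb hζ]
  · exact ENNReal.ofReal_le_ofReal (mul_le_mul_of_nonneg_left hv (by positivity))
  · refine integrable_of_bound hm (b := (D.card * B) ^ 2) fun z => ?_
    rw [abs_pow]
    refine pow_le_pow_left₀ (abs_nonneg _) ((Finset.abs_sum_le_sum_abs _ _).trans ?_) 2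
    rw [← nsmul_eq_mul, ← Finset.sum_const]
    exact Finset.sum_le_sum fun i _ => hζb _
  · exact Filter.Eventually.of_forall fun _ => sq_nonneg _

/-- The sum is `1 / N`, where `N` is the count, and is `0` if `N = 0`. The form `2 / (1 + N)` covers
both cases and matches the inverse count that exchangeability controls. -/
theorem sum_sq_near_div_count_le (S : Finset (Fin d)) (h : ℝ) (D : Finset (Fin n))
    (z : Fin n → Pt d) (x : Pt d) :
    ∑ i ∈ D, (near S h x (z i) / count S h D z x) ^ 2 ≤ 2 * (1 + count S h D z x)⁻¹ := by
  have h0 := count_nonneg S h D z x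
  have e : ∑ i ∈ D, (near S h x (z i) / count S h D z x) ^ 2
      = count S h D z x / count S h D z x ^ 2 := by
    simp_rw [div_pow, near_sq]
    rw [← Finset.sum_div]; rfl
  rw [e]
  rcases count_eq_zero_or_one_le S h D z x with h1 | h1
  · simp [h1]
  · rw [← div_eq_mul_inv, div_le_div_iff₀ (by positivity) (by positivity)]
    nlinarith

open Classical in
/-- The fluctuation of a local average of conditionally centred terms. -/
theorem MeanLE.sq_local_average (S : Finset (Fin d)) {h T : ℝ} (hh : 0 < h) (hh1 : h ≤ 1)
    (hT : 1 ≤ T) {ξ : Pt d → ℝ} (hξm : Measurable ξ) {V : ℝ} (hξb : ∀ x, |ξ x| ≤ V)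
    (hξ : ∀ φ : (S → ℝ) → ℝ, Measurable φ → (∃ b, ∀ u, |φ u| ≤ b) →
      ∫ y, φ (S.restrict y) * ξ y ∂μ = 0) (D : Finset (Fin n)) :
    MeanLE (μ.prod (Measure.pi fun _ : Fin n => μ))
      (fun p => if ‖S.restrict p.1‖ ≤ T then
        (∑ i ∈ D, near S h p.1 (p.2 i) / count S h D p.2 p.1 * ξ (p.2 i)) ^ 2 else 0)
      (2 * V ^ 2 * ((3 * (T / h)) ^ S.card / (D.card + 1))) := by
  have hq : ∀ i, Measurable fun p : Pt d × (Fin n → Pt d) =>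
      near S h p.1 (p.2 i) / count S h D p.2 p.1 := fun i =>
    (near_measurable S h measurable_fst (measurable_sample i)).div
      (count_measurable S h D measurable_fst measurable_snd)
  have hset : MeasurableSet {p : Pt d × (Fin n → Pt d) | ‖S.restrict p.1‖ ≤ T} :=
    measurableSet_le ((measurable_restrict S).comp measurable_fst).norm measurable_const
  have hm : Measurable fun p : Pt d × (Fin n → Pt d) => if ‖S.restrict p.1‖ ≤ T then
      (∑ i ∈ D, near S h p.1 (p.2 i) / count S h D p.2 p.1 * ξ (p.2 i)) ^ 2 else 0 :=
    Measurable.ite hset ((Finset.measurable_fun_sum _ fun i _ => (hq i).mul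
      (hξm.comp (measurable_sample i))).pow_const 2) measurable_const
  have hcm : Measurable fun p : Pt d × (Fin n → Pt d) =>
      if ‖S.restrict p.1‖ ≤ T then (1 + count S h D p.2 p.1)⁻¹ else 0 :=
    Measurable.ite hset ((count_measurable S h D measurable_fst measurable_snd).const_add 1).inv
      measurable_const
  have hT0 : 0 ≤ T / h := by positivity
  have hcount := (MeanLE.const_mul (k := 2 * V ^ 2) ⟨hcm, by positivity,
    lintegral_inv_one_add_count_le μ S hh hh1 hT D⟩ (by positivity))
  refine ⟨hm, hcount.nonneg, le_trans ?_ hcount.le⟩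
  -- The fresh point is fixed first: for fixed `x` the local weights are functions of the
  -- `S`-coordinates of the sample, and orthogonality applies.
  rw [lintegral_prod _ hm.ennreal_ofReal.aemeasurable,
    lintegral_prod _ hcount.measurable.ennreal_ofReal.aemeasurable]
  refine lintegral_mono fun x => ?_
  by_cases hx : ‖S.restrict x‖ ≤ T
  swap
  · simp [hx]
  simp only [hx, if_true]
  have hqx : ∀ i, Measurable fun z : Fin n → Pt d => near S h x (z i) / count S h D z x := fun i =>
    (near_measurable S h measurable_const (measurable_pi_apply i)).div
      (count_measurable S h D measurable_const measurable_id)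
  have hq01 : ∀ i z, |near S h x (z i) / count S h D z x| ≤ 1 := by
    intro i z
    rw [abs_of_nonneg (div_nonneg (near_nonneg _ _ _ _) (count_nonneg _ _ _ _ _))]
    rcases count_eq_zero_or_one_le S h D z x with h1 | h1
    · simp [h1]
    · rw [div_le_one (by linarith)]
      exact (near_le_one _ _ _ _).trans h1
  have hV0 : 0 ≤ V := (abs_nonneg _).trans (hξb 0)
  have hterm : ∀ i z, |near S h x (z i) / count S h D z x * ξ (z i)| ≤ V := fun i z => by
    rw [abs_mul]
    calc _ ≤ 1 * V := mul_le_mul (hq01 i z) (hξb _) (abs_nonneg _) zero_le_one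
      _ = V := one_mul V
  have hmx : Measurable fun z : Fin n → Pt d =>
      (∑ i ∈ D, near S h x (z i) / count S h D z x * ξ (z i)) ^ 2 :=
    (Finset.measurable_fun_sum _ fun i _ => (hqx i).mul
      (hξm.comp (measurable_pi_apply i))).pow_const 2
  have hint : Integrable (fun z : Fin n → Pt d =>
      (∑ i ∈ D, near S h x (z i) / count S h D z x * ξ (z i)) ^ 2) (Measure.pi fun _ => μ) := by
    refine integrable_of_bound hmx (b := (D.card * V) ^ 2) fun z => ?_
    rw [abs_pow]
    refine pow_le_pow_left₀ (abs_nonneg _) ((Finset.abs_sum_le_sum_abs _ _).trans ?_) 2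
    rw [← nsmul_eq_mul, ← Finset.sum_const]
    exact Finset.sum_le_sum fun i _ => hterm i z
  have hcx : Measurable fun z : Fin n → Pt d => 2 * V ^ 2 * (1 + count S h D z x)⁻¹ :=
    (((count_measurable S h D measurable_const measurable_id).const_add 1).inv).const_mul _
  have hcint : Integrable (fun z : Fin n → Pt d => 2 * V ^ 2 * (1 + count S h D z x)⁻¹)
      (Measure.pi fun _ => μ) := by
    refine integrable_of_bound hcx (b := 2 * V ^ 2) fun z => ?_
    have h0 := count_nonneg S h D z x
    rw [abs_of_nonneg (by positivity)]
    exact mul_le_of_le_one_right (by positivity) (inv_le_one_of_one_le₀ (by linarith))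
  rw [← ofReal_integral_eq_lintegral_ofReal hint (Filter.Eventually.of_forall fun _ => sq_nonneg _),
    ← ofReal_integral_eq_lintegral_ofReal hcint (Filter.Eventually.of_forall fun z => by
      have h0 := count_nonneg S h D z x
      simp only [Pi.zero_apply]
      positivity)]
  apply ENNReal.ofReal_le_ofReal
  have hupd : ∀ (i j : Fin n) (z : Fin n → Pt d) (y y' : Pt d), S.restrict y = S.restrict y' →
      near S h x (Function.update z j y i) = near S h x (Function.update z j y' i) := by
    intro i j z y y' hy
    apply near_congr S h rfl
    by_cases hij : i = j
    · subst hij; simpa using hy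
    · simp [hij]
  rw [integral_sq_sum_eq μ S hξm hξb hξ (q := fun i z => near S h x (z i) / count S h D z x)
    hqx hq01 (fun i j z y y' hy => by
      have hc : count S h D (Function.update z j y) x = count S h D (Function.update z j y') x :=
        Finset.sum_congr rfl fun k _ => hupd k j z y y' hy
      rw [hupd i j z y y' hy, hc]) D]
  have hsqint : ∀ i ∈ D, Integrable (fun z : Fin n → Pt d =>
      (near S h x (z i) / count S h D z x) ^ 2 * ξ (z i) ^ 2) (Measure.pi fun _ => μ) := fun i _ =>
    integrable_of_bound (((hqx i).pow_const 2).mul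
      ((hξm.comp (measurable_pi_apply i)).pow_const 2)) (b := V ^ 2) fun z => by
        rw [← mul_pow, abs_pow]
        exact pow_le_pow_left₀ (abs_nonneg _) (hterm i z) 2
  rw [← integral_finsetSum _ hsqint]
  refine integral_mono (integrable_finsetSum _ hsqint) hcint fun z => ?_
  calc ∑ i ∈ D, (near S h x (z i) / count S h D z x) ^ 2 * ξ (z i) ^ 2
      ≤ ∑ i ∈ D, (near S h x (z i) / count S h D z x) ^ 2 * V ^ 2 := by
        refine Finset.sum_le_sum fun i _ => mul_le_mul_of_nonneg_left ?_ (sq_nonneg _)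
        rw [← sq_abs]
        exact pow_le_pow_left₀ (abs_nonneg _) (hξb _) 2
    _ ≤ 2 * (1 + count S h D z x)⁻¹ * V ^ 2 := by
        rw [← Finset.sum_mul]
        exact mul_le_mul_of_nonneg_right (sum_sq_near_div_count_le S h D z x) (sq_nonneg _)
    _ = _ := by ring

open Classical in
-- The indicator of `N = 0` is at most `1 / (1 + N)`, so no lower bound on the density is needed.
theorem MeanLE.count_eq_zero (S : Finset (Fin d)) {h T : ℝ} (hh : 0 < h) (hh1 : h ≤ 1)
    (hT : 1 ≤ T) {V : ℝ} (D : Finset (Fin n)) :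
    MeanLE (μ.prod (Measure.pi fun _ : Fin n => μ))
      (fun p => if ‖S.restrict p.1‖ ≤ T then if count S h D p.2 p.1 = 0 then V ^ 2 else 0 else 0)
      (V ^ 2 * ((3 * (T / h)) ^ S.card / (D.card + 1))) := by
  have hset : MeasurableSet {p : Pt d × (Fin n → Pt d) | ‖S.restrict p.1‖ ≤ T} :=
    measurableSet_le ((measurable_restrict S).comp measurable_fst).norm measurable_const
  have hcm := count_measurable (n := n) S h D (F := fun p : Pt d × (Fin n → Pt d) => p.1)
    (Z := fun p => p.2) measurable_fst measurable_snd
  have hT0 : 0 ≤ T / h := by positivity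
  have hcount := (MeanLE.const_mul (k := V ^ 2) ⟨Measurable.ite hset (hcm.const_add 1).inv
    measurable_const, by positivity, lintegral_inv_one_add_count_le μ S hh hh1 hT D⟩ (by positivity))
  refine hcount.mono (Measurable.ite hset (Measurable.ite (hcm (measurableSet_singleton 0))
    measurable_const measurable_const) measurable_const) (fun p => ?_) le_rfl
  have h0 := count_nonneg S h D p.2 p.1
  split_ifs with h1 h2
  · simp [h2]
  · exact mul_nonneg (sq_nonneg _) (inv_nonneg.2 (by linarith))
  · simp

theorem lintegral_sample_eq {φ : (Fin n → Pt d) → Pt d → ℝ} {i : Fin n}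
    (hφ : ∀ z y, φ (Function.update z i y) = φ z) :
    ∫⁻ p, ENNReal.ofReal (φ p.2 (p.2 i)) ∂(μ.prod (Measure.pi fun _ : Fin n => μ))
      = ∫⁻ p, ENNReal.ofReal (φ p.2 p.1) ∂(μ.prod (Measure.pi fun _ : Fin n => μ)) := by
  rw [lintegral_swap μ i fun x z => ENNReal.ofReal (φ z x)]
  simp only [hφ]

end Fluctuation

/-! ### Mean squared error of one regression step -/

section OneStep

variable {f : Pt d → ℝ} {S : Finset (Fin d)} {κ : Kernel (S → ℝ) (↥Sᶜ → ℝ)} {r : (S → ℝ) → ℝ}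
  {lam c C : ℝ} {g : Pt d → ℝ} {lo hi V : ℝ}

/-- Weights lie between `w₀` and `C / c * w₀`, where `w₀` is the weight at `c`. The denominator is
at least `|D| * w₀`, so `w₀`, and with it `lam`, cancels from the variance bound. -/
theorem MeanLE.wavg_centred (hf : IsDensity f) (hlam : 0 < lam) (hc : 0 < c)
    (hm : Measurable (rBar f S r)) (hb : ∀ u, c ≤ rBar f S r u ∧ rBar f S r u ≤ C)
    (hg : Measurable g) (hr : ∀ x, g x ∈ Set.Icc lo hi) (hV : hi - lo ≤ V) {D : Finset (Fin n)}
    (hD : D.Nonempty) :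
    MeanLE ((law f).prod (Measure.pi fun _ : Fin n => law f))
      (fun p => ((∑ i ∈ D, wBar f S r lam (p.2 i) * (g (p.2 i) - thetaBar f S r lam g))
        / ∑ i ∈ D, wBar f S r lam (p.2 i)) ^ 2)
      (V ^ 2 * (C / c) ^ 2 / D.card) := by
  have := hf.isProbabilityMeasure
  have hb1 : ∀ u, c ≤ rBar f S r u := fun u => (hb u).1
  have hθ := thetaBar_mem_Icc (lam := lam) hf hlam hc hm hb1 hg hr
  have hN : (0 : ℝ) < D.card := by exact_mod_cast hD.card_pos
  have hC : 0 < C := hc.trans_le ((hb 0).1.trans (hb 0).2)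
  have hV0 : 0 ≤ V := by linarith [(hr 0).1, (hr 0).2]
  set θ := thetaBar f S r lam g with hθdef
  set w₀ := lam * c / (1 + lam * c) with hw₀
  have hw₀pos : 0 < w₀ := by positivity
  set ζ : Pt d → ℝ := fun x => wBar f S r lam x * (g x - θ) with hζdef
  have hwm := measurable_wBar (lam := lam) hm
  have hζm : Measurable ζ := hwm.mul (hg.sub_const θ)
  have hζb : ∀ x, |ζ x| ≤ C / c * w₀ * V := by
    intro x
    simp only [hζdef]
    rw [abs_mul, abs_of_nonneg (wBar_mem_Icc hlam hc hb1 x).1]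
    refine mul_le_mul (weight_le_mul_weight hlam one_pos hc (hb _).1 (hb _).2 le_rfl) ?_
      (abs_nonneg _) (by positivity)
    have := hr x
    rw [abs_le]; constructor <;> linarith [this.1, this.2, hθ.1, hθ.2]
  have hζ2 : ∫ y, ζ y ^ 2 ∂(law f) ≤ (C / c * w₀ * V) ^ 2 := by
    refine (integral_mem_Icc (law f) (lo := 0) (hζm.pow_const 2) fun x => ⟨sq_nonneg _, ?_⟩).2
    rw [← sq_abs]
    exact pow_le_pow_left₀ (abs_nonneg _) (hζb x) 2
  have h1 := (MeanLE.sq_sum_centred (law f) hζm hζb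
    (integral_wBar_mul_sub_thetaBar hf hlam hc hm hb1 hg hr) hζ2 D).const_mul
    (k := ((D.card * w₀) ^ 2)⁻¹) (by positivity)
  have hwi : ∀ i : Fin n, Measurable fun p : Pt d × (Fin n → Pt d) => wBar f S r lam (p.2 i) :=
    fun i => hwm.comp (measurable_sample i)
  refine h1.mono (((Finset.measurable_fun_sum _ fun i _ =>
    hζm.comp (measurable_sample i)).div (Finset.measurable_fun_sum _ fun i _ => hwi i)).pow_const 2)
    (fun p => ?_) (le_of_eq ?_)
  · rw [div_pow, div_eq_inv_mul]
    refine mul_le_mul_of_nonneg_right (inv_anti₀ (by positivity)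
      (pow_le_pow_left₀ (by positivity) ?_ 2)) (sq_nonneg _)
    rw [← nsmul_eq_mul, ← Finset.sum_const]
    exact Finset.sum_le_sum fun i _ => le_wBar hlam hc hb1 _
  · field_simp

theorem MeanLE.rHat_rBar (hf : IsDensity f) (hc : 0 < c) (hm : Measurable (rBar f S r))
    (hb : ∀ u, c ≤ rBar f S r u ∧ rBar f S r u ≤ C) {D : Finset (Fin n)} (hD : D.Nonempty) :
    MeanLE ((law f).prod (Measure.pi fun _ : Fin n => law f))
      (fun p => (1 - rHat S (rBar f S r) D p.2) ^ 2) (C / D.card) := by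
  have := hf.isProbabilityMeasure
  have hN : (0 : ℝ) < D.card := by exact_mod_cast hD.card_pos
  obtain ⟨hc1, hC1⟩ := le_one_le_of_rBar hf hc hm hb
  set s : Pt d → ℝ := fun x => rBar f S r (S.restrict x) with hs
  have hsm : Measurable s := hm.comp (measurable_restrict S)
  have hs0 : ∀ x, 0 ≤ s x := fun x => hc.le.trans (hb _).1
  have hsi : Integrable s (law f) := integrable_of_bound hsm (b := C) fun x => by
    rw [abs_of_nonneg (hs0 x)]; exact (hb _).2
  have hsint : ∫ x, s x ∂(law f) = 1 := integral_rBar hc fun u => (hb u).1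
  have hb' : ∀ x, |s x - 1| ≤ C := fun x => by
    rw [abs_le]; constructor <;> linarith [hs0 x, (hb (S.restrict x)).2,
      show s x = rBar f S r (S.restrict x) from rfl]
  have hz : ∫ x, (s x - 1) ∂(law f) = 0 := by
    rw [integral_sub hsi (integrable_const _), hsint]; simp
  have hsq : ∫ x, (s x - 1) ^ 2 ∂(law f) ≤ C := by
    have hi1 : Integrable (fun x => (s x - 1) ^ 2) (law f) :=
      integrable_of_bound ((hsm.sub_const 1).pow_const 2) (b := C ^ 2) fun x => by
        rw [abs_pow]; exact pow_le_pow_left₀ (abs_nonneg _) (hb' x) 2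
    -- Since `0 ≤ s ≤ C`, one has `s ^ 2 ≤ C * s`; with mean one this makes the variance linear in
    -- `C` rather than quadratic.
    have hi2 : Integrable (fun x => (C - 2) * s x + 1) (law f) :=
      (hsi.const_mul _).add (integrable_const _)
    calc _ ≤ ∫ x, ((C - 2) * s x + 1) ∂(law f) := by
          refine integral_mono hi1 hi2 fun x => ?_
          have h1 : s x ≤ C := (hb _).2
          have h2 := mul_le_mul_of_nonneg_left h1 (hs0 x)
          dsimp only
          nlinarith
      _ = (C - 2) * 1 + 1 := by
          rw [integral_add (hsi.const_mul _) (integrable_const _), integral_const_mul, hsint]; simp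
      _ ≤ C := by linarith
  have h1 := (MeanLE.sq_sum_centred (law f) (hsm.sub_const 1) hb' hz hsq D).const_mul
    (k := ((D.card : ℝ) ^ 2)⁻¹) (by positivity)
  refine h1.mono ?_ (fun p => le_of_eq ?_) (le_of_eq (by field_simp))
  · exact ((((Finset.measurable_fun_sum _ fun i _ =>
      hsm.comp (measurable_sample i)).const_mul _).const_sub 1)).pow_const 2
  · have : ∑ i ∈ D, (s (p.2 i) - 1) = ∑ i ∈ D, s (p.2 i) - D.card := by
      rw [Finset.sum_sub_distrib]; simp
    rw [this]
    unfold rHat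
    change (1 - (D.card : ℝ)⁻¹ * ∑ i ∈ D, s (p.2 i)) ^ 2 = _
    field_simp
    ring

open Classical in
/-- Propagation of the mean squared error through one regression step on a nonempty piece. -/
theorem MeanLE.stepHat_of_nonempty (hf : IsDensity f) (hκ : IsCondLaw f S κ) (hlam : 0 < lam)
    (hc : 0 < c) (hm : Measurable (rBar f S r)) (hrm : Measurable r)
    (hb : ∀ u, c ≤ rBar f S r u ∧ rBar f S r u ≤ C)
    (hg : Measurable g) (hr : ∀ x, g x ∈ Set.Icc lo hi) (h0 : (0 : ℝ) ∈ Set.Icc lo hi)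
    (hV : hi - lo ≤ V) {D : Finset (Fin n)} (hD : D.Nonempty) {h T b ε : ℝ} (hh : 0 < h)
    (hh1 : h ≤ 1) (hT : 1 ≤ T) (hGm : Measurable (condMean S κ g))
    (hgm : Measurable (stepBar f S r lam κ g))
    (hG : ∀ u u' : S → ℝ, ‖u - u'‖ ≤ h → |condMean S κ g u - condMean S κ g u'| ≤ b)
    {φ : (Fin n → Pt d) → Pt d → ℝ}
    (hφm : Measurable fun p : Pt d × (Fin n → Pt d) => φ p.2 p.1)
    (hφD : ∀ i ∈ D, ∀ z y, φ (Function.update z i y) = φ z)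
    (hφ : MeanLE ((law f).prod (Measure.pi fun _ : Fin n => law f))
      (fun p => (trunc T (φ p.2) p.1 - g p.1) ^ 2) ε) :
    MeanLE ((law f).prod (Measure.pi fun _ : Fin n => law f))
      (fun p => if ‖S.restrict p.1‖ ≤ T then
        (stepHat S r lam T h D p.2 (φ p.2) p.1 - stepBar f S r lam κ g p.1) ^ 2 else 0)
      (3 * (2 ^ S.card * ε) + 3 * (C / c * ε)
        + 12 * (2 * V ^ 2 * ((3 * (T / h)) ^ S.card / (D.card + 1))
          + V ^ 2 * ((3 * (T / h)) ^ S.card / (D.card + 1)) + b ^ 2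
          + V ^ 2 * (C / c) ^ 2 / D.card + 4 * V ^ 2 * (C / D.card))) := by
  have := hf.isProbabilityMeasure
  have : IsMarkovKernel κ := hκ.1
  have hb1 : ∀ u, c ≤ rBar f S r u := fun u => (hb u).1
  have hN : (0 : ℝ) < D.card := by exact_mod_cast hD.card_pos
  have hC : 0 < C := hc.trans_le ((hb 0).1.trans (hb 0).2)
  have hV0 : 0 ≤ V := by linarith [(hr 0).1, (hr 0).2]
  have hθ := thetaBar_mem_Icc (lam := lam) hf hlam hc hm hb1 hg hr
  set ν := (law f).prod (Measure.pi fun _ : Fin n => law f) with hν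
  set ψ : (Fin n → Pt d) → Pt d → ℝ := fun z y => (trunc T (φ z) y - g y) ^ 2 with hψ
  have hψD : ∀ i ∈ D, ∀ z y, ψ (Function.update z i y) = ψ z := fun i hi z y => by
    simp only [hψ, hφD i hi]
  have hψi : ∀ i, Measurable fun p : Pt d × (Fin n → Pt d) => ψ p.2 (p.2 i) := fun i => by
    have := hφ.measurable.comp ((measurable_sample (d := d) i).prodMk measurable_snd)
    exact this
  have hnear : ∀ i, Measurable fun p : Pt d × (Fin n → Pt d) => near S h p.1 (p.2 i) := fun i =>
    near_measurable S h measurable_fst (measurable_sample i)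
  have hcnt := count_measurable (n := n) S h D (F := fun p : Pt d × (Fin n → Pt d) => p.1)
    (Z := fun p => p.2) measurable_fst measurable_snd
  have m₁ : MeanLE ν (fun p => (∑ i ∈ D, near S h p.1 (p.2 i) * ψ p.2 (p.2 i))
      / count S h D p.2 p.1) (2 ^ S.card * ε) := by
    refine ⟨(Finset.measurable_fun_sum _ fun i _ => (hnear i).mul (hψi i)).div hcnt,
      mul_nonneg (by positivity) hφ.nonneg, ?_⟩
    refine (lintegral_sum_near_div_count_le (law f) S hh.le D (φ := ψ) hφ.measurable
      (fun _ _ => sq_nonneg _) hψD).trans ?_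
    rw [ENNReal.ofReal_mul (by positivity)]
    gcongr
    exact hφ.le
  have m₂ : MeanLE ν (fun p => C / c * ((D.card : ℝ)⁻¹ * ∑ i ∈ D, ψ p.2 (p.2 i))) (C / c * ε) := by
    have h1 := (MeanLE.sum D (F := fun i p => ψ p.2 (p.2 i)) (ν := ν) (x := fun _ => ε)
      fun i hi => ⟨hψi i, hφ.nonneg, by
        rw [hν, lintegral_sample_eq (law f) (φ := ψ) (hψD i hi)]; exact hφ.le⟩).const_mul
      (k := (D.card : ℝ)⁻¹) (by positivity)
    have h2 := h1.const_mul (k := C / c) (by positivity)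
    refine h2.mono h2.measurable (fun _ => le_rfl) (le_of_eq ?_)
    rw [Finset.sum_const, nsmul_eq_mul]
    field_simp
  set ξ : Pt d → ℝ := fun x => g x - condMean S κ g (S.restrict x) with hξ
  have hGc : ∀ u, condMean S κ g u ∈ Set.Icc lo hi := fun u => condMean_mem_Icc hg hr u
  have hξm : Measurable ξ := hg.sub (hGm.comp (measurable_restrict S))
  have hξb : ∀ x, |ξ x| ≤ V := fun x => by
    have h1 := hr x
    have h2 := hGc (S.restrict x)
    rw [abs_le]; constructor <;> simp only [hξ] <;> linarith [h1.1, h1.2, h2.1, h2.2]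
  have m₃ := MeanLE.sq_local_average (n := n) (law f) S hh hh1 hT hξm hξb (by
    rintro χ hχ ⟨bχ, hbχ⟩
    have hbd : ∀ G : Pt d → ℝ, Measurable G → (∀ x, G x ∈ Set.Icc lo hi) →
        Integrable (fun x => χ (S.restrict x) * G x) (law f) := fun G hG hGr =>
      integrable_of_bound ((hχ.comp (measurable_restrict S)).mul hG) (b := bχ * max |lo| |hi|)
        fun x => by
          rw [abs_mul]
          exact mul_le_mul (hbχ _) (abs_le_max_abs_abs (hGr x).1 (hGr x).2) (abs_nonneg _)
            ((abs_nonneg _).trans (hbχ 0))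
    simp only [hξ, mul_sub]
    rw [integral_sub (hbd g hg hr) (hbd (fun x => condMean S κ g (S.restrict x))
        (hGm.comp (measurable_restrict S)) fun x => hGc _),
      integral_mul_condMean hf hκ hg hr hχ hbχ, sub_self]) D
  have m₄ := MeanLE.count_eq_zero (n := n) (law f) S hh hh1 hT (V := V) D
  have m₅ : MeanLE ν (fun _ => b ^ 2) (b ^ 2) := MeanLE.const (sq_nonneg b)
  have m₆ := MeanLE.wavg_centred (lam := lam) hf hlam hc hm hb hg hr hV hD
  have m₇ := (MeanLE.rHat_rBar hf hc hm hb hD).const_mul (k := 4 * V ^ 2) (by positivity)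
  have mtot := ((m₁.const_mul (k := 3) (by norm_num)).add
    (m₂.const_mul (k := 3) (by norm_num))).add
    (((((m₃.add m₄).add m₅).add m₆).add m₇).const_mul (k := 12) (by norm_num))
  refine mtot.mono ?_ (fun p => ?_) le_rfl
  · exact Measurable.ite (measurableSet_le ((measurable_restrict S).comp measurable_fst).norm
      measurable_const) (((stepHat_measurable S hrm lam T hh D hφm).sub
        (hgm.comp measurable_fst)).pow_const 2) measurable_const
  · by_cases hx : ‖S.restrict p.1‖ ≤ T
    · simp only [hx, if_true]
      rw [stepHat_eq_stepHat_rBar (integral_ne_zero_of_le_rBar hc hb1), stepBar_eq hg hr]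
      exact sq_stepHat_sub_le hD p.2 hc hb hlam hh h0 hV hr hGc hθ hG hx
    · simp only [hx, if_false]
      have h1 : 0 ≤ (∑ i ∈ D, near S h p.1 (p.2 i) * ψ p.2 (p.2 i)) / count S h D p.2 p.1 :=
        div_nonneg (Finset.sum_nonneg fun i _ => mul_nonneg (near_nonneg _ _ _ _) (sq_nonneg _))
          (count_nonneg _ _ _ _ _)
      have h2 : 0 ≤ ∑ i ∈ D, ψ p.2 (p.2 i) := Finset.sum_nonneg fun i _ => sq_nonneg _
      positivity

open Classical in
/-- Propagation of the mean squared error through one regression step. -/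
theorem MeanLE.stepHat (hf : IsDensity f) (hκ : IsCondLaw f S κ) (hlam : 0 < lam)
    (hc : 0 < c) (hm : Measurable (rBar f S r)) (hrm : Measurable r)
    (hb : ∀ u, c ≤ rBar f S r u ∧ rBar f S r u ≤ C)
    (hg : Measurable g) (hr : ∀ x, g x ∈ Set.Icc lo hi) (h0 : (0 : ℝ) ∈ Set.Icc lo hi)
    (hV : hi - lo ≤ V) (D : Finset (Fin n)) {h T b ε : ℝ} (hh : 0 < h)
    (hh1 : h ≤ 1) (hT : 1 ≤ T) (hGm : Measurable (condMean S κ g))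
    (hgm : Measurable (stepBar f S r lam κ g))
    (hG : ∀ u u' : S → ℝ, ‖u - u'‖ ≤ h → |condMean S κ g u - condMean S κ g u'| ≤ b)
    {φ : (Fin n → Pt d) → Pt d → ℝ}
    (hφm : Measurable fun p : Pt d × (Fin n → Pt d) => φ p.2 p.1)
    (hφD : ∀ i ∈ D, ∀ z y, φ (Function.update z i y) = φ z)
    (hφ : MeanLE ((law f).prod (Measure.pi fun _ : Fin n => law f))
      (fun p => (trunc T (φ p.2) p.1 - g p.1) ^ 2) ε) :
    MeanLE ((law f).prod (Measure.pi fun _ : Fin n => law f))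
      (fun p => if ‖S.restrict p.1‖ ≤ T then
        (IncompleteData.stepHat S r lam T h D p.2 (φ p.2) p.1 - stepBar f S r lam κ g p.1) ^ 2
        else 0)
      (3 * (C / c + 2 ^ d) * ε + 12 * b ^ 2
        + 12 * V ^ 2 * (3 * 3 ^ d * (T / h) ^ d + 10 * (C / c) ^ 2) / (D.card + 1)) := by
  have := hf.isProbabilityMeasure
  have hV0 : 0 ≤ V := by linarith [(hr 0).1, (hr 0).2]
  obtain ⟨hc1, hC1⟩ := le_one_le_of_rBar hf hc hm hb
  have hCc : 1 ≤ C / c := by rw [le_div_iff₀ hc]; linarith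
  -- The normalised shift has mean one, which forces `c ≤ 1 ≤ C`.
  have hCC : C ≤ (C / c) ^ 2 := by
    have : C ≤ C / c := by rw [le_div_iff₀ hc]; nlinarith
    nlinarith
  have hTh : 1 ≤ T / h := by rw [le_div_iff₀ hh]; linarith
  have hε := hφ.nonneg
  have hcard : S.card ≤ d := by simpa using S.card_le_univ
  -- A piece may be empty if `M` is large. The step then returns `0`, the squared error is at most
  -- `V ^ 2`, and the denominator `|D| + 1` keeps the bound valid.
  rcases D.eq_empty_or_nonempty with hD | hD
  · subst hD
    have : IsMarkovKernel κ := hκ.1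
    have hb1 : ∀ u, c ≤ rBar f S r u := fun u => (hb u).1
    refine (MeanLE.const (x := V ^ 2) (sq_nonneg V)).mono ?_ (fun p => ?_) ?_
    · exact Measurable.ite (measurableSet_le ((measurable_restrict S).comp measurable_fst).norm
        measurable_const) (((stepHat_measurable S hrm lam T hh ∅ hφm).sub
          (hgm.comp measurable_fst)).pow_const 2) measurable_const
    · split_ifs with hx
      · have hθ := thetaBar_mem_Icc (lam := lam) hf hlam hc hm hb1 hg hr
        have h1 := stepBar_mem_Icc (κ := κ) (lam := lam) hf hlam hc hm hb1 hg hr p.1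
        have e : IncompleteData.stepHat S r lam T h ∅ p.2 (φ p.2) p.1 = 0 := by
          simp [IncompleteData.stepHat]
        rw [e, zero_sub, neg_sq, ← sq_abs]
        refine pow_le_pow_left₀ (abs_nonneg _) ?_ 2
        rw [abs_le]; constructor <;> linarith [h1.1, h1.2, hθ.1, hθ.2]
      · positivity
    · simp only [Finset.card_empty, Nat.cast_zero, zero_add, div_one]
      have e1 : 0 ≤ V ^ 2 * (3 * 3 ^ d * (T / h) ^ d) := by positivity
      have e2 : V ^ 2 ≤ V ^ 2 * (C / c) ^ 2 :=
        le_mul_of_one_le_right (sq_nonneg _) (by nlinarith)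
      have e3 : 0 ≤ 3 * (C / c + 2 ^ d) * ε := by positivity
      nlinarith [sq_nonneg b, sq_nonneg V]
  · have hN : (1 : ℝ) ≤ D.card := by exact_mod_cast hD.card_pos
    have hstep := MeanLE.stepHat_of_nonempty hf hκ hlam hc hm hrm hb hg hr h0 hV hD hh hh1 hT hGm
      hgm hG hφm hφD hφ
    refine hstep.mono hstep.measurable (fun _ => le_rfl) ?_
    have hQ : (3 * (T / h)) ^ S.card ≤ 3 ^ d * (T / h) ^ d := by
      rw [← mul_pow]; exact pow_le_pow_right₀ (by linarith) hcard
    have h2 : (2 : ℝ) ^ S.card ≤ 2 ^ d := pow_le_pow_right₀ (by norm_num) hcard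
    set Q := (3 : ℝ) ^ d * (T / h) ^ d with hQdef
    have hQ' : (3 * (T / h)) ^ S.card / ((D.card : ℝ) + 1) ≤ Q / (D.card + 1) := by gcongr
    have hinv : (D.card : ℝ)⁻¹ ≤ 2 / (D.card + 1) := by
      rw [inv_eq_one_div, div_le_div_iff₀ (by linarith) (by linarith)]; linarith
    -- The constant is `10 = (1 + 4) * 2`, the factor `2` being the price of `|D| + 1` in place of
    -- `|D|`.
    have hrest : V ^ 2 * (C / c) ^ 2 / D.card + 4 * V ^ 2 * (C / D.card)
        ≤ V ^ 2 * (10 * (C / c) ^ 2) / (D.card + 1) := by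
      calc V ^ 2 * (C / c) ^ 2 / D.card + 4 * V ^ 2 * (C / D.card)
          = V ^ 2 * ((C / c) ^ 2 + 4 * C) * (D.card : ℝ)⁻¹ := by ring
        _ ≤ V ^ 2 * ((C / c) ^ 2 + 4 * (C / c) ^ 2) * (2 / (D.card + 1)) := by gcongr
        _ = _ := by ring
    have hV2 := mul_le_mul_of_nonneg_left hQ' (sq_nonneg V)
    have hε2 := mul_le_mul_of_nonneg_right h2 hε
    have e : 12 * V ^ 2 * (3 * 3 ^ d * (T / h) ^ d + 10 * (C / c) ^ 2) / ((D.card : ℝ) + 1)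
        = 12 * (3 * (V ^ 2 * (Q / (D.card + 1)))
          + V ^ 2 * (10 * (C / c) ^ 2) / (D.card + 1)) := by
      rw [hQdef]; ring
    rw [e]
    linarith

end OneStep

/-! ### Binomial tails, paths and sizes of the pieces -/

section Combinatorics

theorem binTail_nonneg (M m : ℕ) {η : ℝ} (h0 : 0 ≤ η) (h1 : η ≤ 1) : 0 ≤ binTail M η m :=
  Finset.sum_nonneg fun j _ => by
    have : 0 ≤ 1 - η := by linarith
    positivity

/-- Union bound over the `m`-subsets of trials that all succeed, in the form `M.choose (m + i) ≤
M.choose m * (M - m).choose i` followed by the binomial theorem. -/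
theorem binTail_le_choose_mul (M m : ℕ) {η : ℝ} (h0 : 0 ≤ η) (h1 : η ≤ 1) :
    binTail M η m ≤ M.choose m * η ^ m := by
  have h1' : 0 ≤ 1 - η := by linarith
  rcases lt_or_ge M m with hm | hm
  · rw [binTail, Finset.Icc_eq_empty (by omega), Finset.sum_empty]; positivity
  have e : Finset.Icc m M = Finset.Ico m (M + 1) := by ext; simp
  rw [binTail, e, Finset.sum_Ico_eq_sum_range]
  have hbin : ∑ i ∈ Finset.range (M - m + 1), η ^ i * (1 - η) ^ (M - m - i) * ((M - m).choose i : ℝ)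
      = 1 := by
    rw [← add_pow]; simp
  calc _ ≤ ∑ i ∈ Finset.range (M - m + 1), (M.choose m : ℝ) * η ^ m
          * (η ^ i * (1 - η) ^ (M - m - i) * ((M - m).choose i : ℝ)) := by
        rw [show M + 1 - m = M - m + 1 by omega]
        refine Finset.sum_le_sum fun i hi => ?_
        have hi' : m + i ≤ M := by rw [Finset.mem_range] at hi; omega
        have hc : M.choose (m + i) ≤ M.choose m * (M - m).choose i := by
          have := Nat.choose_mul (n := M) (Nat.le_add_right m i)
          rw [Nat.add_sub_cancel_left] at this
          rw [← this]
          exact Nat.le_mul_of_pos_right _ (Nat.choose_pos (Nat.le_add_right m i))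
        have hc' : (M.choose (m + i) : ℝ) ≤ M.choose m * (M - m).choose i := by exact_mod_cast hc
        rw [Nat.sub_add_eq]
        calc (M.choose (m + i) : ℝ) * η ^ (m + i) * (1 - η) ^ (M - m - i)
            ≤ (M.choose m * (M - m).choose i) * η ^ (m + i) * (1 - η) ^ (M - m - i) := by gcongr
          _ = _ := by rw [pow_add]; ring
    _ = _ := by rw [← Finset.mul_sum, hbin, mul_one]

/-- The last entry is prescribed, so the first `m` entries determine the path. -/
theorem card_paths_le (𝕊 : Finset (Finset (Fin d))) (m : ℕ) (S : Finset (Fin d)) :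
    (paths 𝕊 m S).card ≤ 𝕊.card ^ m := by
  have h : (Fintype.piFinset fun _ : Fin m => 𝕊).card = 𝕊.card ^ m := by simp
  rw [← h]
  refine Finset.card_le_card_of_injOn (fun Ss j => Ss j.castSucc) ?_ ?_
  · intro Ss hSs
    have := Finset.mem_coe.1 hSs
    simp only [paths, Finset.mem_filter, Fintype.mem_piFinset] at this
    simp only [Finset.mem_coe, Fintype.mem_piFinset]
    exact fun j => this.1 _
  · intro Ss hSs Ss' hSs' he
    have h1 := Finset.mem_coe.1 hSs
    have h2 := Finset.mem_coe.1 hSs'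
    simp only [paths, Finset.mem_filter] at h1 h2
    funext j
    refine Fin.lastCases ?_ (fun j => ?_) j
    · rw [h1.2.2, h2.2.2]
    · exact congrFun he j

/-- This is what the choice `η = 1 / |𝕊|` achieves: `η ^ (m + 1)` outweighs the at most `|𝕊| ^ m`
paths. -/
theorem card_paths_mul_binTail_le {𝕊 : Finset (Finset (Fin d))} {S : Finset (Fin d)} (hS : S ∈ 𝕊)
    (M m : ℕ) :
    ((paths 𝕊 m S).card : ℝ) * binTail M (𝕊.card : ℝ)⁻¹ (m + 1) ≤ M.choose (m + 1) := by
  have hpos : (1 : ℝ) ≤ 𝕊.card := by exact_mod_cast Finset.card_pos.2 ⟨S, hS⟩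
  have h0 : (0 : ℝ) ≤ (𝕊.card : ℝ)⁻¹ := by positivity
  have h1 : (𝕊.card : ℝ)⁻¹ ≤ 1 := inv_le_one_of_one_le₀ hpos
  calc _ ≤ (𝕊.card : ℝ) ^ m * (M.choose (m + 1) * ((𝕊.card : ℝ)⁻¹) ^ (m + 1)) :=
        mul_le_mul (by exact_mod_cast card_paths_le 𝕊 m S)
          (binTail_le_choose_mul M (m + 1) h0 h1) (binTail_nonneg _ _ h0 h1) (by positivity)
    _ = M.choose (m + 1) * (𝕊.card : ℝ)⁻¹ := by
        rw [pow_succ, inv_pow]; field_simp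
    _ ≤ _ := mul_le_of_le_one_right (by positivity) h1

theorem sum_choose_succ_mul_pow_le (M : ℕ) (q : ℝ) :
    ∑ m ∈ Finset.range M, (M.choose (m + 1) : ℝ) * q ^ (m + 1) ≤ (1 + q) ^ M := by
  rw [add_comm 1 q, add_pow, Finset.sum_range_succ']
  have : ∑ m ∈ Finset.range M, (M.choose (m + 1) : ℝ) * q ^ (m + 1)
      = ∑ k ∈ Finset.range M, q ^ (k + 1) * 1 ^ (M - (k + 1)) * (M.choose (k + 1) : ℝ) :=
    Finset.sum_congr rfl fun k _ => by rw [one_pow]; ring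
  rw [this]
  simp

/-- All `M` pieces have at most `(D m).card + 1` points, and together they hold at least `n / 2`. -/
theorem IsSplit.le_two_mul {M : ℕ} {D : ℕ → Finset (Fin n)} (hD : IsSplit n M D)
    {m : ℕ} (hm : m ∈ Finset.Icc 1 M) : n ≤ 2 * M * ((D m).card + 1) := by
  have h1 := congrArg Finset.card hD.union
  rw [Finset.card_biUnion hD.disjoint] at h1
  have h2 : ∑ k ∈ Finset.Icc 1 M, (D k).card ≤ ∑ k ∈ Finset.Icc 1 M, ((D m).card + 1) :=
    Finset.sum_le_sum fun k hk => hD.balanced k hk m hm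
  rw [Finset.sum_const, Nat.card_Icc, smul_eq_mul, Nat.add_sub_cancel] at h2
  have h3 : (Finset.univ.filter fun i : Fin n => (i : ℕ) < (n + 1) / 2).card = (n + 1) / 2 := by
    rw [Fin.card_filter_val_lt]
    omega
  rw [h3] at h1
  have h4 : (n + 1) / 2 ≤ M * ((D m).card + 1) := h1 ▸ h2
  have : 2 * M * ((D m).card + 1) = 2 * (M * ((D m).card + 1)) := by ring
  omega

end Combinatorics

/-! ### Numerical constants of the recursion -/

section Constants

/-- The growth of the error constants along the iteration. -/
theorem error_constant_succ_le {K : ℝ} (hK : 5 ≤ K) (m : ℕ) :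
    3 * K * (16 * (14 * K - 1) ^ m - 15) + 1001 + 48 * (1 + m * K) ^ 2
      ≤ 16 * (14 * K - 1) ^ (m + 1) - 15 := by
  -- For `m = 0` the claim is `3 * K + 1049 ≤ 224 * K - 31`, which `K ≥ 5` ensures. Afterwards the
  -- geometric gap between `3 * K` and `14 * K - 1` absorbs the quadratic growth in `m`.
  rcases m with _ | m
  · norm_num; linarith
  set q := 14 * K - 1 with hq
  have hq4 : 4 ≤ q := by rw [hq]; linarith
  have hp : (4 : ℝ) ^ m ≤ q ^ m := pow_le_pow_left₀ (by norm_num) hq4 m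
  have h1 : (1 : ℝ) ≤ 4 ^ m := one_le_pow₀ (by norm_num)
  have hm : ((m : ℝ) + 2) ^ 2 ≤ 4 * 4 ^ m := by
    have : ∀ k : ℕ, ((k : ℝ) + 2) ^ 2 ≤ 4 * 4 ^ k := by
      intro k
      induction k with
      | zero => norm_num
      | succ k ih =>
        push_cast
        rw [pow_succ (4 : ℝ)]
        nlinarith [(Nat.cast_nonneg k : (0 : ℝ) ≤ k)]
    exact this m
  have h2 : (1 + ((m + 1 : ℕ) : ℝ) * K) ^ 2 ≤ 4 * 4 ^ m * K ^ 2 := by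
    calc (1 + ((m + 1 : ℕ) : ℝ) * K) ^ 2 ≤ ((m + 2) * K) ^ 2 := by
          refine pow_le_pow_left₀ (by positivity) ?_ 2
          push_cast; nlinarith
      _ = (m + 2) ^ 2 * K ^ 2 := by ring
      _ ≤ _ := mul_le_mul_of_nonneg_right hm (sq_nonneg _)
  have hK2 : 25 ≤ K ^ 2 := by nlinarith
  have h3 : q * (11 * K - 1) * q ^ m ≥ 130 * K ^ 2 * 4 ^ m := by
    have h4 : 130 * K ^ 2 ≤ q * (11 * K - 1) := by rw [hq]; nlinarith
    exact mul_le_mul h4 hp (by positivity) (le_trans (by positivity) h4)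
  have h5 : K ^ 2 ≤ K ^ 2 * 4 ^ m := le_mul_of_one_le_right (sq_nonneg _) h1
  have e : 16 * q ^ (m + 1 + 1) - 3 * K * (16 * q ^ (m + 1)) = 16 * (q * (11 * K - 1) * q ^ m) := by
    rw [pow_succ, pow_succ, hq]; ring
  nlinarith

/-- The Hölder constant is linear in `m`, and `1 / c ≤ K` absorbs the factor coming from the
weights. With `R = max a₀ 1`, so that `R ^ 2 = A`, the terms with and without `a₀` are treated
alike. -/
theorem error_bias_le {m : ℕ} {a₀ L₁ L₂ L₃ c H K W A : ℝ} (ha : 0 ≤ a₀) (hL₁ : 0 < L₁)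
    (hL₂ : 0 < L₂) (hL₃ : 0 < L₃) (hc : 0 < c) (hK : 1 ≤ K) (hcK : 1 ≤ K * c)
    (hA : A = max (a₀ ^ 2) 1) (hW : (L₁ + L₂ + L₃) ^ 2 ≤ W) :
    ((L₁ + m * (2 * a₀ * (L₂ + L₃ / (4 * c))) + 2 * a₀ * L₂) * H) ^ 2
      ≤ 4 * (1 + m * K) ^ 2 * (A * W) * H ^ 2 := by
  obtain ⟨R, hR1, haR, hRA⟩ : ∃ R : ℝ, 1 ≤ R ∧ a₀ ≤ R ∧ R ^ 2 = A := by
    refine ⟨max a₀ 1, le_max_right _ _, le_max_left _ _, ?_⟩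
    rw [hA]
    rcases le_total a₀ 1 with h | h
    · rw [max_eq_right h, max_eq_right (pow_le_one₀ ha h), one_pow]
    · rw [max_eq_left h, max_eq_left (one_le_pow₀ h)]
  have hA0 : 0 ≤ A := hRA ▸ sq_nonneg R
  have hR0 : 0 ≤ R := by linarith
  have hc4 : L₃ / (4 * c) ≤ L₃ * K := by
    rw [div_le_iff₀ (by positivity)]
    have := mul_le_mul_of_nonneg_left hcK hL₃.le
    linarith
  have hK0 : 0 ≤ K := by linarith
  have hlin : L₁ + m * (2 * a₀ * (L₂ + L₃ / (4 * c))) + 2 * a₀ * L₂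
      ≤ 2 * R * ((L₁ + L₂ + L₃) * (1 + m * K)) := by
    have t1 : L₂ + L₃ / (4 * c) ≤ (L₁ + L₂ + L₃) * K := by
      have u1 : L₂ ≤ L₂ * K := le_mul_of_one_le_right hL₂.le hK
      have u2 : 0 ≤ L₁ * K := by positivity
      linarith
    have t2 : L₁ ≤ R * L₁ := le_mul_of_one_le_left hL₁.le hR1
    have t3 : m * (2 * a₀ * (L₂ + L₃ / (4 * c))) ≤ m * (2 * R * ((L₁ + L₂ + L₃) * K)) := by gcongr
    have t4 : 2 * a₀ * L₂ ≤ 2 * R * L₂ := by gcongr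
    have t5 : 0 ≤ R * L₁ := by positivity
    have t6 : 0 ≤ R * L₃ := by positivity
    calc _ ≤ R * L₁ + m * (2 * R * ((L₁ + L₂ + L₃) * K)) + 2 * R * L₂ := by linarith
      _ ≤ _ := by linarith
  have hlin0 : 0 ≤ L₁ + m * (2 * a₀ * (L₂ + L₃ / (4 * c))) + 2 * a₀ * L₂ := by positivity
  rw [mul_pow _ H]
  refine mul_le_mul_of_nonneg_right ((pow_le_pow_left₀ hlin0 hlin 2).trans ?_) (sq_nonneg _)
  calc (2 * R * ((L₁ + L₂ + L₃) * (1 + m * K))) ^ 2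
      = 4 * (1 + m * K) ^ 2 * (A * (L₁ + L₂ + L₃) ^ 2) := by rw [← hRA]; ring
    _ ≤ _ := by gcongr

/-- Numerical bound on the error added by one step. -/
theorem error_step_le {d m : ℕ} (hd : 2 ≤ d) {a₀ L₁ L₂ L₃ c C η τ H p K W A Δ N : ℝ}
    (ha : 0 ≤ a₀) (hL₁ : 0 < L₁) (hL₂ : 0 < L₂) (hL₃ : 0 < L₃) (hc : 0 < c) (hC : 1 ≤ C)
    (hη : 0 ≤ η) (hτ : 1 ≤ τ) (hp : 0 ≤ p) (hK : K = C / c + 2 ^ d) (hCc : 1 ≤ C / c)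
    (hA : A = max (a₀ ^ 2) 1)
    (hW : W = max ((C / c) ^ 2) (max ((L₁ + L₂ + L₃) ^ 2) (8 ^ d)))
    (hΔ : Δ = η * τ + H ^ 2 + p) (hN : (N + 1)⁻¹ ≤ 2 * η) (hN0 : 0 ≤ N) {ε : ℝ}
    (hε : ε = (16 * (14 * K - 1) ^ m - 15) * (A * W * Δ)) :
    3 * (C / c + 2 ^ d) * ε
        + 12 * ((L₁ + m * (2 * a₀ * (L₂ + L₃ / (4 * c))) + 2 * a₀ * L₂) * H) ^ 2
        + 12 * (2 * a₀) ^ 2 * (3 * 3 ^ d * τ + 10 * (C / c) ^ 2) / (N + 1) + (2 * a₀) ^ 2 * p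
      ≤ (16 * (14 * K - 1) ^ (m + 1) - 15) * (A * W * Δ) := by
  have h2d : (4 : ℝ) ≤ 2 ^ d := by
    calc (4 : ℝ) = 2 ^ 2 := by norm_num
      _ ≤ 2 ^ d := pow_le_pow_right₀ (by norm_num) hd
  have hK5 : 5 ≤ K := by rw [hK]; linarith
  have hA1 : 1 ≤ A := hA ▸ le_max_right _ _
  have haA : a₀ ^ 2 ≤ A := hA ▸ le_max_left _ _
  have hW1 : (C / c) ^ 2 ≤ W := hW ▸ le_max_left _ _
  have hW2 : (L₁ + L₂ + L₃) ^ 2 ≤ W := hW ▸ (le_max_left _ _).trans (le_max_right _ _)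
  have hW3 : (8 : ℝ) ^ d ≤ W := hW ▸ (le_max_right _ _).trans (le_max_right _ _)
  have hWpos : 1 ≤ W := (one_le_pow₀ (by norm_num)).trans hW3
  -- Equality holds at `d = 2`.
  have h3d : 64 * (3 : ℝ) ^ d ≤ 9 * 8 ^ d := by
    obtain ⟨k, rfl⟩ := Nat.exists_eq_add_of_le hd
    have : (3 : ℝ) ^ k ≤ 8 ^ k := pow_le_pow_left₀ (by norm_num) (by norm_num) k
    rw [pow_add, pow_add]
    linarith
  have hAW : 0 < A * W := by positivity
  have hbias := error_bias_le (m := m) (H := H) ha hL₁ hL₂ hL₃ hc (K := K) (by linarith) (by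
    have h1 : C / c * c = C := div_mul_cancel₀ C hc.ne'
    have h2 : 0 ≤ 2 ^ d * c := by positivity
    rw [hK, add_mul, h1]
    linarith) hA hW2
  have hfluc : 12 * (2 * a₀) ^ 2 * (3 * 3 ^ d * τ + 10 * (C / c) ^ 2) / (N + 1)
      ≤ 1001 * (A * W) * (η * τ) := by
    -- `1001 / 96` is `10 + 27 / 64` rounded up so that multiplication by `48 * 2` gives `1001`.
    have hin : 3 * 3 ^ d * τ + 10 * (C / c) ^ 2 ≤ (1001 / 96) * (W * τ) := by
      have t1 : (C / c) ^ 2 ≤ W * τ := hW1.trans (le_mul_of_one_le_right (by linarith) hτ)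
      have t2 : 3 * (3 : ℝ) ^ d ≤ 27 / 64 * W := by linarith
      have t3 := mul_le_mul_of_nonneg_right t2 (show 0 ≤ τ by linarith)
      have t4 : 0 ≤ W * τ := (sq_nonneg _).trans t1
      linarith
    calc 12 * (2 * a₀) ^ 2 * (3 * 3 ^ d * τ + 10 * (C / c) ^ 2) / (N + 1)
        = 48 * (a₀ ^ 2 * (3 * 3 ^ d * τ + 10 * (C / c) ^ 2)) * (N + 1)⁻¹ := by ring
      _ ≤ 48 * (A * ((1001 / 96) * (W * τ))) * (2 * η) := by gcongr
      _ = _ := by ring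
  have htail : (2 * a₀) ^ 2 * p ≤ 4 * (A * W) * p := by
    have : a₀ ^ 2 ≤ A * W := haA.trans (le_mul_of_one_le_right (by linarith) hWpos)
    have := mul_le_mul_of_nonneg_right this hp
    linarith
  have hrec := mul_le_mul_of_nonneg_right (error_constant_succ_le hK5 m)
    (show 0 ≤ A * W * Δ by rw [hΔ]; positivity)
  refine le_trans ?_ hrec
  have hrest : 12 * (4 * (1 + m * K) ^ 2 * (A * W) * H ^ 2) + 1001 * (A * W) * (η * τ)
      + 4 * (A * W) * p ≤ (1001 + 48 * (1 + m * K) ^ 2) * (A * W * Δ) := by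
    have e1 : 0 ≤ (1 + m * K) ^ 2 * (A * W) * (η * τ) := by positivity
    have e2 : 0 ≤ (1 + m * K) ^ 2 * (A * W) * p := by positivity
    have e3 : 0 ≤ A * W * H ^ 2 := by positivity
    have e4 : 0 ≤ A * W * p := by positivity
    rw [hΔ]
    generalize (1 + m * K) ^ 2 = P at *
    generalize A * W = Y at *
    linarith
  have e : 3 * (C / c + 2 ^ d) * ε = 3 * K * (16 * (14 * K - 1) ^ m - 15) * (A * W * Δ) := by
    rw [hε, hK]; ring
  rw [e]
  linarith

end Constants

/-! ### Recursion for the mean squared errors -/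

section Recursion

theorem aHat_succ_eq_zero (r : ∀ S : Finset (Fin d), (S → ℝ) → ℝ) (lam : Finset (Fin d) → ℝ)
    (T h : ℝ) (D : ℕ → Finset (Fin n)) (z : Fin n → Pt d) (a : Pt d → ℝ) {m : ℕ}
    (Ss : Fin (m + 1) → Finset (Fin d)) {x : Pt d}
    (hx : ¬ ‖(Ss (Fin.last m)).restrict x‖ ≤ T) : aHat r lam T h D z a (m + 1) Ss x = 0 := by
  simp only [aHat, stepHat, if_neg hx]

open Classical in
theorem MeanLE.tail (μ : Measure (Pt d)) [IsProbabilityMeasure μ] (T V : ℝ) :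
    MeanLE (μ.prod (Measure.pi fun _ : Fin n => μ)) (fun p => if T ≤ ‖p.1‖ then V ^ 2 else 0)
      (V ^ 2 * μ.real {x | T ≤ ‖x‖}) := by
  have hset : MeasurableSet {x : Pt d | T ≤ ‖x‖} := measurableSet_le measurable_const measurable_norm
  have hm : Measurable fun x : Pt d => if T ≤ ‖x‖ then V ^ 2 else 0 :=
    Measurable.ite hset measurable_const measurable_const
  refine ⟨hm.comp measurable_fst, by positivity, le_of_eq ?_⟩
  rw [(measurePreserving_fst (μ := μ) (ν := Measure.pi fun _ : Fin n => μ)).lintegral_comp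
    (f := fun x : Pt d => ENNReal.ofReal (if T ≤ ‖x‖ then V ^ 2 else 0)) hm.ennreal_ofReal]
  have e : (fun x : Pt d => ENNReal.ofReal (if T ≤ ‖x‖ then V ^ 2 else 0))
      = {x : Pt d | T ≤ ‖x‖}.indicator fun _ => ENNReal.ofReal (V ^ 2) := by
    ext x
    by_cases hx : T ≤ ‖x‖ <;> simp [hx]
  rw [e, lintegral_indicator_const hset, ENNReal.ofReal_mul (sq_nonneg V), ofReal_measureReal]

/-- The mean squared errors of the iterated estimators. -/
theorem MeanLE.aHat {𝕊 : Finset (Finset (Fin d))} (hd : 2 ≤ d) {f : Pt d → ℝ} (hf : IsDensity f)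
    {κ : ∀ S : Finset (Fin d), Kernel (S → ℝ) (↥Sᶜ → ℝ)} (hκ : ∀ S ∈ 𝕊, IsCondLaw f S (κ S))
    {r : ∀ S : Finset (Fin d), (S → ℝ) → ℝ} (hrm : ∀ S ∈ 𝕊, Measurable (r S))
    {lam : Finset (Fin d) → ℝ} (hlam : ∀ S ∈ 𝕊, 0 < lam S) {a : Pt d → ℝ}
    {β L₁ L₂ L₃ c C a₀ : ℝ} (ha : ∀ x, |a x| ≤ a₀) (hβ : 0 < β) (hL₁ : 0 < L₁) (hL₂ : 0 < L₂)
    (hL₃ : 0 < L₃) (hA1 : LocHolder a β L₁) (hA2 : A2 𝕊 κ β L₂) (hA3 : A3 𝕊 f r β L₃) (hc : 0 < c)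
    (hb : ∀ S ∈ 𝕊, ∀ u, c ≤ rBar f S (r S) u ∧ rBar f S (r S) u ≤ C)
    (hn : 0 < n) {M : ℕ} {D : ℕ → Finset (Fin n)} (hD : IsSplit n M D) {T h : ℝ} (hT : 1 ≤ T)
    (hh : 0 < h) (hh1 : h ≤ 1) {K A W Δ : ℝ} (hK : K = C / c + 2 ^ d) (hA : A = max (a₀ ^ 2) 1)
    (hW : W = max ((C / c) ^ 2) (max ((L₁ + L₂ + L₃) ^ 2) (8 ^ d)))
    (hΔ : Δ = (M : ℝ) / n * (T / h) ^ d + (h ^ β) ^ 2 + (law f).real {x | T ≤ ‖x‖}) (m : ℕ) :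
    m ≤ M → ∀ Ss : Fin m → Finset (Fin d), (∀ j, Ss j ∈ 𝕊) →
      MeanLE ((law f).prod (Measure.pi fun _ : Fin n => law f))
        (fun p => (trunc T (aHat r lam T h D p.2 a m Ss) p.1 - aBar f r lam κ a m Ss p.1) ^ 2)
        ((16 * (14 * K - 1) ^ m - 15) * (A * W * Δ)) ∧
      (0 < m → MeanLE ((law f).prod (Measure.pi fun _ : Fin n => law f))
        (fun p => (aHat r lam T h D p.2 a m Ss p.1 - aBar f r lam κ a m Ss p.1) ^ 2)
        ((16 * (14 * K - 1) ^ m - 15) * (A * W * Δ))) := by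
  -- The truncated error feeds the next regression, which truncates its input, while the untruncated
  -- one enters the final sum. Both obey the same bound, since the estimator vanishes wherever the
  -- step bound does not apply.
  classical
  have := hf.isProbabilityMeasure
  have ha0 : 0 ≤ a₀ := (abs_nonneg _).trans (ha 0)
  have ham : Measurable a := (hA1.continuous hβ).measurable
  have hspec := aBar_spec hf hκ hlam ha hβ hL₁.le hL₂.le hL₃.le hA1 hA2 hA3 hc
    fun S hS u => (hb S hS u).1
  have hset : MeasurableSet {x : Pt d | T ≤ ‖x‖} := measurableSet_le measurable_const measurable_norm
  have hbarm : ∀ m (Ss : Fin m → Finset (Fin d)), (∀ j, Ss j ∈ 𝕊) →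
      Measurable (aBar f r lam κ a m Ss) := fun m Ss hSs =>
    ((hspec m Ss hSs).2.continuous hβ).measurable
  have htail := MeanLE.tail (n := n) (law f) T (2 * a₀)
  have hnR : (0 : ℝ) < n := by exact_mod_cast hn
  have hTh : 1 ≤ T / h := by rw [le_div_iff₀ hh]; linarith
  have hΔp : (law f).real {x | T ≤ ‖x‖} ≤ Δ := by
    rw [hΔ]
    have : 0 ≤ (M : ℝ) / n * (T / h) ^ d + (h ^ β) ^ 2 := by positivity
    linarith
  have hA1' : 1 ≤ A := hA ▸ le_max_right _ _
  have haA : a₀ ^ 2 ≤ A := hA ▸ le_max_left _ _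
  have hW1 : 1 ≤ W := hW ▸ (one_le_pow₀ (by norm_num)).trans
    ((le_max_right _ _).trans (le_max_right _ _))
  induction m with
  | zero =>
    intro _ Ss _
    refine ⟨?_, fun h => absurd h (lt_irrefl 0)⟩
    refine (MeanLE.tail (n := n) (law f) T a₀).mono ?_ (fun p => ?_) ?_
    · exact ((trunc_measurable (φ := fun _ => a) (ham.comp measurable_fst)).sub
        (ham.comp measurable_fst)).pow_const 2
    · simp only [IncompleteData.aHat, aBar, trunc]
      split_ifs with h1 h2 h2
      · simp; positivity
      · simp
      · rw [zero_sub, neg_sq, ← sq_abs]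
        exact pow_le_pow_left₀ (abs_nonneg _) (ha _) 2
      · exact absurd (not_le.1 h1).le h2
    · rw [pow_zero, show (16 * 1 - 15 : ℝ) = 1 by norm_num, one_mul]
      exact mul_le_mul (haA.trans (le_mul_of_one_le_right (by linarith) hW1)) hΔp
        measureReal_nonneg (by positivity)
  | succ m ih =>
    intro hmM Ss hSs
    have hSs' : ∀ j : Fin m, Ss j.castSucc ∈ 𝕊 := fun j => hSs _
    have hprev := (ih (by omega) (fun j => Ss j.castSucc) hSs').1
    obtain ⟨⟨lo, hi, h0, hlh, hr⟩, hH⟩ := hspec m (fun j => Ss j.castSucc) hSs'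
    obtain ⟨⟨lo', hi', h0', hlh', hr'⟩, -⟩ := hspec (m + 1) Ss hSs
    set S := Ss (Fin.last m) with hS
    have hS𝕊 : S ∈ 𝕊 := hSs _
    have : IsMarkovKernel (κ S) := (hκ S hS𝕊).1
    have hs : LocHolder (rBar f S (r S)) β L₃ := hA3 S hS𝕊
    have hsm := (hs.continuous hβ).measurable
    have hgm := hbarm m _ hSs'
    obtain ⟨hc1, hC1⟩ := le_one_le_of_rBar hf hc hsm (hb S hS𝕊)
    have hCc : 1 ≤ C / c := by rw [le_div_iff₀ hc]; linarith
    set g := aBar f r lam κ a m fun j => Ss j.castSucc with hg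
    set ℓ := L₁ + m * (2 * a₀ * (L₂ + L₃ / (4 * c))) with hℓ
    have hℓ0 : 0 ≤ ℓ := by positivity
    have hGH := hH.condMean hβ hℓ0 hr (hA2 S hS𝕊)
    have hbias : ∀ u u' : S → ℝ, ‖u - u'‖ ≤ h →
        |condMean S (κ S) g u - condMean S (κ S) g u'| ≤ (ℓ + 2 * a₀ * L₂) * h ^ β := by
      intro u u' hu
      refine (hGH u u' (hu.trans hh1)).trans ?_
      have : ‖u - u'‖ ^ β ≤ h ^ β := Real.rpow_le_rpow (norm_nonneg _) hu hβ.le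
      have h00 : 0 ≤ hi - lo := by linarith [h0.1, h0.2]
      gcongr
    have hmem : m + 1 ∈ Finset.Icc 1 M := by rw [Finset.mem_Icc]; omega
    have hstep := MeanLE.stepHat hf (hκ S hS𝕊) (hlam S hS𝕊) hc hsm (hrm S hS𝕊) (hb S hS𝕊) hgm hr
      h0 hlh (D (m + 1)) hh hh1 hT (hGH.continuous hβ).measurable (hbarm (m + 1) Ss hSs) hbias
      (φ := fun z => IncompleteData.aHat r lam T h D z a m fun j => Ss j.castSucc)
      (aHat_measurable hrm lam T hh D ham m _ hSs') (fun i hi z y => by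
        refine aHat_congr r lam T h D a m (fun k hk j hj => ?_) _
        rw [Finset.mem_Icc] at hk
        -- Disjointness of the pieces makes the previous iterate independent of the data of the
        -- current step.
        have hdis := hD.disjoint k (by rw [Finset.mem_Icc]; omega) (m + 1) hmem (by omega)
        have hji : j ≠ i := by
          rintro rfl
          exact Finset.disjoint_left.1 hdis hj hi
        exact Function.update_of_ne hji _ _)
      hprev
    -- Outside the cube the error is the population function itself. Its range contains `0` and has
    -- length at most `2 * a₀`, so its square is covered by the tail term.
    have htot := hstep.add htail
    have hbound := error_step_le (m := m) hd ha0 hL₁ hL₂ hL₃ hc hC1 (η := (M : ℝ) / n)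
      (by positivity) (one_le_pow₀ hTh) measureReal_nonneg hK hCc hA hW hΔ
      (N := ((D (m + 1)).card : ℝ)) (by
        have h1 : (n : ℝ) ≤ 2 * M * ((D (m + 1)).card + 1) := by exact_mod_cast hD.le_two_mul hmem
        rw [inv_eq_one_div, div_le_iff₀ (by positivity)]
        rw [show 2 * ((M : ℝ) / n) * ((D (m + 1)).card + 1)
          = 2 * M * ((D (m + 1)).card + 1) / n by ring, le_div_iff₀ hnR]
        linarith) (by positivity) rfl
    have hhatm := aHat_measurable hrm lam T hh D ham (m + 1) Ss hSs
    have hV : ∀ x, aBar f r lam κ a (m + 1) Ss x ^ 2 ≤ (2 * a₀) ^ 2 := fun x => by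
      rw [← sq_abs]
      refine pow_le_pow_left₀ (abs_nonneg _) ?_ 2
      have := hr' x
      rw [abs_le]; constructor <;> linarith [this.1, this.2, h0'.1, h0'.2]
    have hdiff : ∀ p : Pt d × (Fin n → Pt d), ‖S.restrict p.1‖ ≤ T →
        (IncompleteData.aHat r lam T h D p.2 a (m + 1) Ss p.1
          - aBar f r lam κ a (m + 1) Ss p.1) ^ 2
        ≤ (if ‖S.restrict p.1‖ ≤ T then
          (IncompleteData.stepHat S (r S) (lam S) T h (D (m + 1)) p.2
            (IncompleteData.aHat r lam T h D p.2 a m fun j => Ss j.castSucc) p.1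
            - stepBar f S (r S) (lam S) (κ S) g p.1) ^ 2 else 0)
          + if T ≤ ‖p.1‖ then (2 * a₀) ^ 2 else 0 := by
      intro p hp
      rw [if_pos hp]
      refine le_add_of_le_of_nonneg le_rfl ?_
      split_ifs <;> positivity
    have hout : ∀ p : Pt d × (Fin n → Pt d), T ≤ ‖p.1‖ →
        aBar f r lam κ a (m + 1) Ss p.1 ^ 2
        ≤ (if ‖S.restrict p.1‖ ≤ T then
          (IncompleteData.stepHat S (r S) (lam S) T h (D (m + 1)) p.2
            (IncompleteData.aHat r lam T h D p.2 a m fun j => Ss j.castSucc) p.1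
            - stepBar f S (r S) (lam S) (κ S) g p.1) ^ 2 else 0)
          + if T ≤ ‖p.1‖ then (2 * a₀) ^ 2 else 0 := by
      intro p hp
      rw [if_pos hp]
      refine le_add_of_nonneg_of_le ?_ (hV _)
      split_ifs <;> positivity
    refine ⟨htot.mono ?_ (fun p => ?_) hbound, fun _ => htot.mono ?_ (fun p => ?_) hbound⟩
    · exact ((trunc_measurable
        (φ := fun z => IncompleteData.aHat r lam T h D z a (m + 1) Ss) hhatm).sub ((hbarm _ _ hSs).comp measurable_fst)).pow_const 2
    · by_cases hp : ‖p.1‖ ≤ T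
      · rw [trunc, if_pos hp]
        exact hdiff p ((norm_restrict_le S p.1).trans hp)
      · rw [trunc, if_neg hp, zero_sub, neg_sq]
        exact hout p (not_le.1 hp).le
    · exact (hhatm.sub ((hbarm _ _ hSs).comp measurable_fst)).pow_const 2
    · by_cases hp : ‖S.restrict p.1‖ ≤ T
      · exact hdiff p hp
      · rw [aHat_succ_eq_zero r lam T h D p.2 a Ss hp, zero_sub, neg_sq]
        exact hout p ((not_le.1 hp).le.trans (norm_restrict_le S p.1))

end Recursion

/-! ### Combination over all paths -/

section Total

theorem mem_of_mem_paths {𝕊 : Finset (Finset (Fin d))} {m : ℕ} {S : Finset (Fin d)}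
    {Ss : Fin (m + 1) → Finset (Fin d)} (h : Ss ∈ paths 𝕊 m S) :
    (∀ j, Ss j ∈ 𝕊) ∧ Ss (Fin.last m) = S := by
  simp only [paths, Finset.mem_filter, Fintype.mem_piFinset] at h
  exact ⟨h.1, h.2.2⟩

/-- The outer truncation is redundant: every summand ends with a step on `S`, which already vanishes
where `‖x_S‖ > T`. -/
theorem alphaHat_eq (𝕊 : Finset (Finset (Fin d))) (r : ∀ S : Finset (Fin d), (S → ℝ) → ℝ)
    (lam : Finset (Fin d) → ℝ) (T h : ℝ) (D : ℕ → Finset (Fin n)) (z : Fin n → Pt d)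
    (a : Pt d → ℝ) (η : ℝ) (M : ℕ) (S : Finset (Fin d)) (x : Pt d) :
    alphaHat 𝕊 r lam T h D z a η M S x = ∑ m ∈ Finset.range M, (-1) ^ m *
      ∑ Ss ∈ paths 𝕊 m S, binTail M η (m + 1) * aHat r lam T h D z a (m + 1) Ss x := by
  unfold alphaHat
  split_ifs with hx
  · rfl
  · symm
    refine Finset.sum_eq_zero fun m _ => ?_
    rw [Finset.sum_eq_zero fun Ss hSs => ?_, mul_zero]
    obtain ⟨-, rfl⟩ := mem_of_mem_paths hSs
    rw [aHat_succ_eq_zero r lam T h D z a Ss hx, mul_zero]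

/-- The mean squared error of a signed combination over the paths ending at `S`. -/
theorem MeanLE.sq_alternating_sum {Ω : Type*} [MeasurableSpace Ω] {ν : Measure Ω}
    {𝕊 : Finset (Finset (Fin d))} {S : Finset (Fin d)} (hS : S ∈ 𝕊) {M : ℕ} {q Y : ℝ}
    (hq : 1 ≤ q) (hY : 0 ≤ Y) {e : (m : ℕ) → (Fin (m + 1) → Finset (Fin d)) → Ω → ℝ}
    (hem : ∀ m ∈ Finset.range M, ∀ Ss ∈ paths 𝕊 m S, Measurable (e m Ss))
    (he : ∀ m ∈ Finset.range M, ∀ Ss ∈ paths 𝕊 m S,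
      MeanLE ν (fun ω => e m Ss ω ^ 2) (16 * q ^ (m + 1) * Y)) :
    MeanLE ν (fun ω => (∑ m ∈ Finset.range M, (-1) ^ m *
        ∑ Ss ∈ paths 𝕊 m S, binTail M (𝕊.card : ℝ)⁻¹ (m + 1) * e m Ss ω) ^ 2)
      ((2 * (1 + q)) ^ M * (16 * Y)) := by
  have hpos : (1 : ℝ) ≤ 𝕊.card := by exact_mod_cast Finset.card_pos.2 ⟨S, hS⟩
  set η := (𝕊.card : ℝ)⁻¹ with hη
  have h0 : 0 ≤ η := by positivity
  have h1 : η ≤ 1 := inv_le_one_of_one_le₀ hpos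
  set B : ℕ → ℝ := fun m => binTail M η (m + 1) with hB
  have hB0 : ∀ m, 0 ≤ B m := fun m => binTail_nonneg _ _ h0 h1
  have hcardB : ∀ m, ((paths 𝕊 m S).card : ℝ) * B m ≤ M.choose (m + 1) := fun m =>
    card_paths_mul_binTail_le hS M m
  set w := ∑ m ∈ Finset.range M, ∑ _Ss ∈ paths 𝕊 m S, B m with hw
  have hw0 : 0 ≤ w := Finset.sum_nonneg fun m _ => Finset.sum_nonneg fun _ _ => hB0 m
  have hw2 : w ≤ 2 ^ M := by
    calc w ≤ ∑ m ∈ Finset.range M, (M.choose (m + 1) : ℝ) * 1 ^ (m + 1) := by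
          refine Finset.sum_le_sum fun m _ => ?_
          rw [Finset.sum_const, nsmul_eq_mul, one_pow, mul_one]
          exact hcardB m
      _ ≤ (1 + 1) ^ M := sum_choose_succ_mul_pow_le M 1
      _ = 2 ^ M := by norm_num
  have hmean := (MeanLE.sum (Finset.range M) fun m hm => MeanLE.sum (paths 𝕊 m S) fun Ss hSs =>
    (he m hm Ss hSs).const_mul (hB0 m)).const_mul hw0
  refine hmean.mono ?_ (fun ω => ?_) ?_
  · exact (Finset.measurable_fun_sum _ fun m hm => (Finset.measurable_fun_sum _ fun Ss hSs =>
      (hem m hm Ss hSs).const_mul _).const_mul _).pow_const 2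
  -- Cauchy–Schwarz with the binomial tails as weights: the signs disappear, and one factor is the
  -- total weight `w ≤ 2 ^ M`.
  · have := sq_sum_mul_le ((Finset.range M).sigma fun m => paths 𝕊 m S) (fun s => B s.1)
      (fun s => (-1) ^ s.1 * e s.1 s.2 ω) fun s _ => hB0 s.1
    rw [Finset.sum_sigma, Finset.sum_sigma, Finset.sum_sigma] at this
    refine le_trans (le_of_eq ?_) (this.trans (le_of_eq ?_))
    · congr 1
      refine Finset.sum_congr rfl fun m _ => ?_
      rw [Finset.mul_sum]
      exact Finset.sum_congr rfl fun Ss _ => by ring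
    · rw [hw]
      congr 1
      refine Finset.sum_congr rfl fun m _ => Finset.sum_congr rfl fun Ss _ => ?_
      rw [mul_pow, ← pow_mul, mul_comm m 2, pow_mul]
      norm_num
  · have h2 : ∑ m ∈ Finset.range M, ∑ _Ss ∈ paths 𝕊 m S, B m * (16 * q ^ (m + 1) * Y)
        ≤ (1 + q) ^ M * (16 * Y) := by
      calc _ ≤ ∑ m ∈ Finset.range M, (M.choose (m + 1) : ℝ) * q ^ (m + 1) * (16 * Y) := by
            refine Finset.sum_le_sum fun m _ => ?_
            rw [Finset.sum_const, nsmul_eq_mul, ← mul_assoc]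
            calc ((paths 𝕊 m S).card : ℝ) * B m * (16 * q ^ (m + 1) * Y)
                ≤ M.choose (m + 1) * (16 * q ^ (m + 1) * Y) :=
                  mul_le_mul_of_nonneg_right (hcardB m) (by positivity)
              _ = _ := by ring
        _ ≤ _ := by
            rw [← Finset.sum_mul]
            exact mul_le_mul_of_nonneg_right (sum_choose_succ_mul_pow_le M q) (by positivity)
    calc _ ≤ 2 ^ M * ((1 + q) ^ M * (16 * Y)) := by
          refine mul_le_mul hw2 h2 (Finset.sum_nonneg fun m _ => Finset.sum_nonneg fun Ss _ => ?_)
            (by positivity)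
          exact mul_nonneg (hB0 m) (by positivity)
      _ = _ := by rw [mul_pow]; ring

end Total

end

end IncompleteData

/-! ### The main theorem -/

open IncompleteData
theorem proposition7 {d : ℕ} (hd : 2 ≤ d)
    (𝕊 : Finset (Finset (Fin d))) (h𝕊 : Finset.univ ∉ 𝕊)
    (f : Pt d → ℝ) (hf : IsDensity f)
    (κ : ∀ S : Finset (Fin d), Kernel (S → ℝ) (↥Sᶜ → ℝ))
    (hκ : ∀ S ∈ 𝕊, IsCondLaw f S (κ S))
    (r : ∀ S : Finset (Fin d), (S → ℝ) → ℝ) (hr : ∀ S ∈ 𝕊, ∀ u, 0 < r S u)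
    (lam : Finset (Fin d) → ℝ) (hlam : ∀ S ∈ 𝕊, 0 < lam S)
    (a : Pt d → ℝ) (ha : BddAbove (Set.range fun x => |a x|))
    (β₁ β₂ β₃ L₁ L₂ L₃ c C : ℝ)
    (hβ₁ : β₁ ∈ Set.Ioc (0 : ℝ) 1) (hβ₂ : β₂ ∈ Set.Ioc (0 : ℝ) 1)
    (hβ₃ : β₃ ∈ Set.Ioc (0 : ℝ) 1)
    (hL₁ : 0 < L₁) (hL₂ : 0 < L₂) (hL₃ : 0 < L₃)
    (hA1 : A1 a β₁ L₁) (hA2 : A2 𝕊 κ β₂ L₂) (hA3 : A3 𝕊 f r β₃ L₃)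
    (hc : 0 < c)
    (hrBar : ∀ S ∈ 𝕊, ∀ u, c ≤ rBar f S (r S) u ∧ rBar f S (r S) u ≤ C)
    {Ω : Type*} [MeasurableSpace Ω] (P : Measure Ω) [IsProbabilityMeasure P]
    (n : ℕ) (hn : 0 < n) (X : Fin n → Ω → Pt d)
    (hX : ∀ i, HasLaw (X i) (law f) P) (hindep : iIndepFun X P)
    (M : ℕ) (hM : 1 ≤ M) (D : ℕ → Finset (Fin n)) (hD : IsSplit n M D)
    (T h : ℝ) (hT : 1 ≤ T) (hh : h ∈ Set.Ioo (0 : ℝ) 1)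
    (S : Finset (Fin d)) (hS : S ∈ 𝕊) :
    ∫⁻ ω, ∫⁻ x, ENNReal.ofReal
        ((alphaHat 𝕊 r lam T h D (fun i => X i ω) a (𝕊.card : ℝ)⁻¹ M S x
          - alpha 𝕊 f r lam κ a (𝕊.card : ℝ)⁻¹ M S x) ^ 2) ∂(law f) ∂P
      ≤ ENNReal.ofReal
        ((28 * (C / c + 2 ^ d)) ^ M
          * (16 * max ((⨆ x, |a x|) ^ 2) 1
              * max ((C / c) ^ 2) (max ((L₁ + L₂ + L₃) ^ 2) (8 ^ d)))
          * ((M : ℝ) / n * (T / h) ^ d + h ^ (2 * min β₁ (min β₂ β₃))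
              + (law f).real {x | T ≤ ‖x‖})) := by
  have := hf.isProbabilityMeasure
  set a₀ := ⨆ x, |a x| with ha₀
  have ha' : ∀ x, |a x| ≤ a₀ := fun x => le_ciSup ha x
  set β := min β₁ (min β₂ β₃) with hβdef
  have hβ : 0 < β := lt_min hβ₁.1 (lt_min hβ₂.1 hβ₃.1)
  have hb₁ : β ≤ β₁ := min_le_left _ _
  have hb₂ : β ≤ β₂ := (min_le_right _ _).trans (min_le_left _ _)
  have hb₃ : β ≤ β₃ := (min_le_right _ _).trans (min_le_right _ _)
  have hA1' : LocHolder a β L₁ := LocHolder.mono_exponent (β := β₁) hA1 hL₁.le hβ.le hb₁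
  have hA2' : A2 𝕊 κ β L₂ := fun S hS u u' hu => (hA2 S hS u u' hu).trans
    (mul_le_mul_of_nonneg_left (Real.rpow_le_rpow_of_exponent_ge' (norm_nonneg _) hu hβ.le hb₂)
      hL₂.le)
  have hA3' : A3 𝕊 f r β L₃ := fun S hS =>
    LocHolder.mono_exponent (F := rBar f S (r S)) (hA3 S hS) hL₃.le hβ.le hb₃
  -- Measurability of `r S` is not assumed: (A3) makes the normalised shift continuous, and `r S` is
  -- a constant multiple of it.
  have hrm : ∀ S ∈ 𝕊, Measurable (r S) := by
    intro S hS
    have hI := integral_ne_zero_of_le_rBar hc fun u => (hrBar S hS u).1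
    have h1 : Measurable (rBar f S (r S)) :=
      (LocHolder.continuous (F := rBar f S (r S)) (hA3' S hS) hβ).measurable
    have h2 := h1.const_mul (∫ x, r S (S.restrict x) ∂(law f))
    convert h2 using 2 with u
    unfold rBar
    field_simp
  have ham : Measurable a := (hA1'.continuous hβ).measurable
  have hspec := aBar_spec hf hκ hlam ha' hβ hL₁.le hL₂.le hL₃.le hA1' hA2' hA3' hc
    fun S hS u => (hrBar S hS u).1
  set K := C / c + 2 ^ d with hK
  set A := max (a₀ ^ 2) 1 with hA
  set W := max ((C / c) ^ 2) (max ((L₁ + L₂ + L₃) ^ 2) (8 ^ d)) with hW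
  have hexp : h ^ (2 * β) = (h ^ β) ^ 2 := by
    rw [mul_comm, Real.rpow_mul hh.1.le]; norm_num
  rw [hexp]
  set Δ := (M : ℝ) / n * (T / h) ^ d + (h ^ β) ^ 2 + (law f).real {x | T ≤ ‖x‖} with hΔ
  have hT0 : 0 ≤ T / h := div_nonneg (by linarith) hh.1.le
  have hΔ0 : 0 ≤ Δ := by positivity
  have hA0 : 0 ≤ A := zero_le_one.trans (le_max_right _ _)
  have hW0 : 0 ≤ W := (sq_nonneg _).trans (le_max_left _ _)
  have hC0 : 0 < C := hc.trans_le ((hrBar S hS 0).1.trans (hrBar S hS 0).2)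
  have hK4 : 4 ≤ K := by
    have h1 : (4 : ℝ) ≤ 2 ^ d := by
      calc (4 : ℝ) = 2 ^ 2 := by norm_num
        _ ≤ 2 ^ d := pow_le_pow_right₀ (by norm_num) hd
    have h2 : 0 < C / c := by positivity
    linarith
  have hrec := MeanLE.aHat hd hf hκ hrm hlam ha' hβ hL₁ hL₂ hL₃ hA1' hA2' hA3' hc hrBar hn hD hT
    hh.1 hh.2.le hK hA hW hΔ
  have htot := MeanLE.sq_alternating_sum (ν := (law f).prod (Measure.pi fun _ : Fin n => law f))
    hS (M := M) (q := 14 * K - 1) (Y := A * W * Δ) (by linarith) (by positivity)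
    (e := fun m Ss p => aHat r lam T h D p.2 a (m + 1) Ss p.1 - aBar f r lam κ a (m + 1) Ss p.1)
    (fun m _ Ss hSs => (aHat_measurable hrm lam T hh.1 D ham (m + 1) Ss (mem_of_mem_paths hSs).1).sub
      (((hspec (m + 1) Ss (mem_of_mem_paths hSs).1).2.continuous hβ).measurable.comp
        measurable_fst))
    (fun m hm Ss hSs => by
      have h1 := (hrec (m + 1) (by rw [Finset.mem_range] at hm; omega) Ss
        (mem_of_mem_paths hSs).1).2 (Nat.succ_pos m)
      -- The `-15`, needed only to start and close the recursion, is dropped here.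
      refine h1.mono h1.measurable (fun _ => le_rfl) (mul_le_mul_of_nonneg_right ?_ (by positivity))
      linarith)
  have hdiff : ∀ p : Pt d × (Fin n → Pt d),
      alphaHat 𝕊 r lam T h D p.2 a (𝕊.card : ℝ)⁻¹ M S p.1
        - alpha 𝕊 f r lam κ a (𝕊.card : ℝ)⁻¹ M S p.1
      = ∑ m ∈ Finset.range M, (-1) ^ m * ∑ Ss ∈ paths 𝕊 m S, binTail M (𝕊.card : ℝ)⁻¹ (m + 1)
        * (aHat r lam T h D p.2 a (m + 1) Ss p.1 - aBar f r lam κ a (m + 1) Ss p.1) := by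
    intro p
    rw [alphaHat_eq, alpha, ← Finset.sum_sub_distrib]
    refine Finset.sum_congr rfl fun m _ => ?_
    rw [← mul_sub, ← Finset.sum_sub_distrib]
    simp only [mul_sub]
  simp only [← hdiff] at htot
  have hmap : P.map (fun ω i => X i ω) = Measure.pi fun _ : Fin n => law f := by
    rw [(iIndepFun_iff_map_fun_eq_pi_map fun i => (hX i).aemeasurable).1 hindep]
    simp only [fun i => (hX i).map_eq]
  have hXm : AEMeasurable (fun ω i => X i ω) P := aemeasurable_pi_lambda _ fun i => (hX i).aemeasurable
  have hmF := htot.measurable.ennreal_ofReal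
  -- The risk depends on `P` only through the product law of the sample; Tonelli then identifies it
  -- with the joint mean over fresh point and sample.
  have hswap : ∫⁻ ω, ∫⁻ x, ENNReal.ofReal
        ((alphaHat 𝕊 r lam T h D (fun i => X i ω) a (𝕊.card : ℝ)⁻¹ M S x
          - alpha 𝕊 f r lam κ a (𝕊.card : ℝ)⁻¹ M S x) ^ 2) ∂(law f) ∂P
      = ∫⁻ p, ENNReal.ofReal ((alphaHat 𝕊 r lam T h D p.2 a (𝕊.card : ℝ)⁻¹ M S p.1
          - alpha 𝕊 f r lam κ a (𝕊.card : ℝ)⁻¹ M S p.1) ^ 2)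
          ∂((law f).prod (Measure.pi fun _ : Fin n => law f)) := by
    rw [lintegral_prod_symm _ hmF.aemeasurable, ← hmap,
      lintegral_map' (by
        have := hmF.lintegral_prod_left' (μ := law f)
        exact this.aemeasurable) hXm]
  rw [hswap]
  refine htot.le.trans (ENNReal.ofReal_le_ofReal (le_of_eq ?_))
  rw [show 2 * (1 + (14 * K - 1)) = 28 * K by ring]
  ring
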